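/- **Setting.** Let $1<p<\infty$, $A\in\mathbb R^{n\times d}$, $b\in\mathbb R^n$, $c\in\ker(A)^\perp$, and $s(x)=Ax-b$. For $t>0$ let $f_t(s)=\frac p2t^{p-2}s^2$ if $|s|\le t$ and $f_t(s)=|s|^p+(\frac p2-1)t^p$ otherwise, and let $x(t)$ be the minimizer of $c\cdot x+\sum_i f_t(s_i(x))$ over $x\in\ker(A)^\perp$ (it exists and is unique). Put $h=\frac1{2p}$, $t_k=(1-h)^kt_0$, and write $s^{q}$ for the signed power $\mathrm{sign}(s)|s|^q$. For $s\in\mathbb R^n$ let $\mathcal N_s(\gamma)=\{s':\forall i,\ |(s'_i)^{p/2}-(s_i)^{p/2}|\le\gamma\}$ (a box), $\gamma_t=\bigl(1+\frac{p^3}{p-1}\sqrt n\,h\bigr)t^{p/2}$ and $\kappa=\frac{4p^2}{p-1}\bigl(3+\frac{2p^3}{p-1}\sqrt n\,h\bigr)^{|2-4/p|}$. **Method.** One phase takes a parameter $t$ and a point $x$ (an approximation of $x(t)$). Let $D_t$ be the diagonal matrix with entries $\frac{p-1}2\max\bigl(t^{p/2},|s_i(x)|^{p/2}-\mathrm{sign}(p-2)\gamma_t\bigr)^{2-4/p}$,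 and let $P$ be either $P_t=((A^\top D_tA)^\dagger)^{1/2}$ or $P_t'=(A^\top D_tA)^\dagger A^\top\sqrt{D_t}$. Let $g_t(y)=c\cdot Py+\sum_i\tilde f_i\bigl((APy-b)_i\bigr)$, where $\tilde f_i$ equals $f_{(1-h)t}$ on the $i$-th side $[\ell_i,u_i]$ of the box $\mathcal N_{s(x)}(\gamma_t)$ and is continued outside by its second-order Taylor polynomials at $u_i$ and $\ell_i$ (at the corners $|s|=t$ of $f_t'$ the value $f_t''=pt^{p-2}$ is used). The phase runs $T$ steps of Nesterov's accelerated gradient descent (AGD) on $g_t$ with strong convexity constant $1$ and smoothness constant $\kappa$, i.e. $y_{j+1}=z_j-\frac1\kappa\nabla g_t(z_j)$, $z_{j+1}=y_{j+1}+\frac{\sqrt\kappa-1}{\sqrt\kappa+1}(y_{j+1}-y_j)$, from $y_0=z_0=P^\top A^\top D_tAx$, and returns $Py_T$. The homotopy method starts from $\hat x_0=x(t_0)$ and obtains $\hat x_{k+1}$ from $\hat x_k$ by one phase with parameter $t_k$. **Theorem.** There are absolute constants $C>0$ and $a\in\mathbb N$ such that the following holds for all $p,n,d,A,b,c$ as above.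 1. (Initial point.) If $t_0=\max\bigl((2\sqrt{c^\top(A^\top A)^\dagger c})^{1/(p-1)},2\|b\|_2\bigr)>0$, then $x(t_0)=(A^\top A)^\dagger A^\top b-\frac1pt_0^{2-p}(A^\top A)^\dagger c$. The same formula holds for $t_0=\max\bigl((2c^\top(A^\top A)^\dagger c)^{1/(p-1)},2\|b\|_2\bigr)>0$ if $p^2c^\top(A^\top A)^\dagger c\ge1$. 2. (Phases and iterations.) Let $t_0>0$ be arbitrary, in particular one of the two values in 1, and let the number $T$ of AGD iterations per phase satisfy $T\ge C\bigl(\frac{p^2}{p-1}\bigr)^an^{|1/2-1/p|}\log(n+1)$. Then, with either choice of the preconditioner, $s(\hat x_k)\in\mathcal N_{s(x(t_k))}(\gamma_{t_k})$ for all $k\ge 0$, and for every $\varepsilon>0$ and every integer $K\ge0$ with $K\ge C\log\bigl(\frac{np}{\varepsilon}t_0^p\bigr)$ both $x(t_K)$ and the computed point $\hat x_K$ are $\varepsilon$-optimal: $$c\cdot\hat x_K+\|A\hat x_K-b\|_p^p\le\varepsilon+\min_{x\in\mathbb R^d}\bigl(c\cdot x+\|Ax-b\|_p^p\bigr).$$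 (For $n=0$ the last condition on $K$ is void.) Hence $O(\log(\frac{np}{\varepsilon}t_0^p))$ phases of $O_p(n^{|1/2-1/p|}\log n)$ AGD iterations suffice, where $O_p$ hides a polynomial in $\frac{p^2}{p-1}$. 3. (Cost of an iteration.) For all $n,d,m$ and all $S\subseteq[n]\times[d]$ there is a straight-line program over the reals that performs one AGD step $(y_j,z_j)\mapsto(y_{j+1},z_{j+1})$ in place, in every phase, for every $A$ whose nonzero entries lie in $S$, for all $b,c,p$ and every preconditioner $P\in\mathbb R^{d\times m}$. It reads the entries of $A,b,c$, the numbers $p,\ (1-h)t,\ \kappa,\ \ell_i,\ u_i$ and the state from memory, and uses at most $C$ multiplications of a vector by $P$ or $P^\top$ and at most $C(|S|+n+d+m+1)$ elementary operations (rational constants, $+,-,\times,/$, real powers, comparisons). Here $m=d$ for $P_t$ and $m=n$ for $P_t'$, so the work is linear in the size of the input. -/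

import Mathlib

open Matrix

noncomputable section

namespace LpHomotopy

/-! ### The regression problem, the smoothing family and the homotopy path -/

/-- The residual `s(x) = A x - b`. -/
def residual {n d : ℕ} (A : Matrix (Fin n) (Fin d) ℝ) (b : Fin n → ℝ) (x : Fin d → ℝ) :
    Fin n → ℝ :=
  A *ᵥ x - b

/-- The `ℓ_p` regression objective `c · x + ‖A x - b‖_p ^ p`. -/
def objective {n d : ℕ} (A : Matrix (Fin n) (Fin d) ℝ) (b : Fin n → ℝ) (c : Fin d → ℝ) (p : ℝ)
    (x : Fin d → ℝ) : ℝ :=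
  c ⬝ᵥ x + ∑ i, |residual A b x i| ^ p

/-- `x` is an `ε`-optimal solution of the `ℓ_p` regression problem. -/
def IsEpsOptimal {n d : ℕ} (A : Matrix (Fin n) (Fin d) ℝ) (b : Fin n → ℝ) (c : Fin d → ℝ) (p : ℝ)
    (ε : ℝ) (x : Fin d → ℝ) : Prop :=
  ∀ x' : Fin d → ℝ, objective A b c p x ≤ ε + objective A b c p x'

/-- `v` is orthogonal to the kernel of `A`. -/
def KerOrth {n d : ℕ} (A : Matrix (Fin n) (Fin d) ℝ) (v : Fin d → ℝ) : Prop :=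
  ∀ w : Fin d → ℝ, A *ᵥ w = 0 → v ⬝ᵥ w = 0

/-- The smoothing `f_t` of `|s| ^ p`, quadratic on `[-t, t]`. -/
def smooth (p t s : ℝ) : ℝ :=
  if |s| ≤ t then p / 2 * t ^ (p - 2) * s ^ 2 else |s| ^ p + (p / 2 - 1) * t ^ p

/-- The derivative `f_t'`. -/
def smooth' (p t s : ℝ) : ℝ :=
  if |s| ≤ t then p * t ^ (p - 2) * s else p * |s| ^ (p - 2) * s

/-- The second derivative `f_t''`, with the inner value at the two points `|s| = t` where `f_t'`
has a corner. -/
def smooth'' (p t s : ℝ) : ℝ :=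
  if |s| ≤ t then p * t ^ (p - 2) else p * (p - 1) * |s| ^ (p - 2)

/-- The smoothed objective `c · x + ∑ i, f_t (s_i(x))`. -/
def smoothObjective {n d : ℕ} (A : Matrix (Fin n) (Fin d) ℝ) (b : Fin n → ℝ) (c : Fin d → ℝ)
    (p t : ℝ) (x : Fin d → ℝ) : ℝ :=
  c ⬝ᵥ x + ∑ i, smooth p t (residual A b x i)

/-- `x` is the point `x(t)` of the homotopy path: it minimizes the smoothed objective over
`ker(A)ᗮ`. -/
def IsPathPoint {n d : ℕ} (A : Matrix (Fin n) (Fin d) ℝ) (b : Fin n → ℝ) (c : Fin d → ℝ)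
    (p t : ℝ) (x : Fin d → ℝ) : Prop :=
  KerOrth A x ∧
    ∀ x' : Fin d → ℝ, KerOrth A x' → smoothObjective A b c p t x ≤ smoothObjective A b c p t x'

/-! ### The neighbourhood and the quadratic extension -/

/-- The signed power `sign(s) |s| ^ q`. -/
def spow (s q : ℝ) : ℝ :=
  SignType.sign s * |s| ^ q

/-- The relative decrease of the smoothing parameter in one phase. -/
def stepH (p : ℝ) : ℝ := 1 / (2 * p)

/-- The radius `γ` of the neighbourhood. -/
def radius (p : ℝ) (n : ℕ) (t : ℝ) : ℝ :=
  (1 + p ^ 3 / (p - 1) * √(n : ℝ) * stepH p) * t ^ (p / 2)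

/-- The neighbourhood `𝒩_s(γ)`; powers of real numbers of either sign are signed powers. -/
def Nbhd {n : ℕ} (p : ℝ) (s : Fin n → ℝ) (γ : ℝ) : Set (Fin n → ℝ) :=
  {s' | ∀ i, |spow (s' i) (p / 2) - spow (s i) (p / 2)| ≤ γ}

/-- The endpoints of the `i`-th side of the box `𝒩_s(γ)`, as functions of `s_i`. -/
def lower (p γ s : ℝ) : ℝ := spow (spow s (p / 2) - γ) (2 / p)

def upper (p γ s : ℝ) : ℝ := spow (spow s (p / 2) + γ) (2 / p)

/-- The quadratic extension of `f_t` outside `[l, u]`. -/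
def extend (p t l u s : ℝ) : ℝ :=
  if l ≤ s ∧ s ≤ u then smooth p t s
  else if u ≤ s then
    smooth p t u + smooth' p t u * (s - u) + 1 / 2 * smooth'' p t u * (s - u) ^ 2
  else smooth p t l + smooth' p t l * (s - l) + 1 / 2 * smooth'' p t l * (s - l) ^ 2

/-! ### The preconditioners -/

/-- The Moore-Penrose inverse `M†` of a symmetric matrix `M`: the nonzero eigenvalues are inverted,
the eigenvalue `0` is kept. -/
def pinv {d : ℕ} (M : Matrix (Fin d) (Fin d) ℝ) : Matrix (Fin d) (Fin d) ℝ :=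
  cfc (fun x : ℝ => x⁻¹) M

/-- `(M†)^{1/2}` for a positive semidefinite matrix `M`. -/
def pinvSqrt {d : ℕ} (M : Matrix (Fin d) (Fin d) ℝ) : Matrix (Fin d) (Fin d) ℝ :=
  cfc (fun x : ℝ => √(x⁻¹)) M

/-- The diagonal of the matrix `D_t`, for the residual vector `s`. -/
def weight {n : ℕ} (p t : ℝ) (s : Fin n → ℝ) (i : Fin n) : ℝ :=
  (p - 1) / 2 *
    max (t ^ (p / 2)) (|s i| ^ (p / 2) - SignType.sign (p - 2) * radius p n t) ^ (2 - 4 / p)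

/-- The matrix `Aᵀ D_t A`, where `D_t` is built at the point `x`. -/
def gram {n d : ℕ} (A : Matrix (Fin n) (Fin d) ℝ) (b : Fin n → ℝ) (p t : ℝ) (x : Fin d → ℝ) :
    Matrix (Fin d) (Fin d) ℝ :=
  Aᵀ * Matrix.diagonal (weight p t (residual A b x)) * A

/-- The preconditioner `P_t = ((Aᵀ D_t A)†)^{1/2}`, built at the point `x`. -/
def precond {n d : ℕ} (A : Matrix (Fin n) (Fin d) ℝ) (b : Fin n → ℝ) (p t : ℝ) (x : Fin d → ℝ) :
    Matrix (Fin d) (Fin d) ℝ :=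
  pinvSqrt (gram A b p t x)

/-- The preconditioner `P_t' = (Aᵀ D_t A)† Aᵀ √D_t`, built at the point `x`. -/
def precond' {n d : ℕ} (A : Matrix (Fin n) (Fin d) ℝ) (b : Fin n → ℝ) (p t : ℝ) (x : Fin d → ℝ) :
    Matrix (Fin d) (Fin n) ℝ :=
  pinv (gram A b p t x) * Aᵀ * Matrix.diagonal (fun i => √(weight p t (residual A b x) i))

/-! ### Accelerated gradient descent and the homotopy method -/

/-- One step of Nesterov's accelerated gradient descent, with constant step size and momentum, for
a function with strong convexity constant `1` and smoothness constant `κ`. -/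
def agdStep {E : Type*} [NormedAddCommGroup E] [InnerProductSpace ℝ E] [CompleteSpace E]
    (g : E → ℝ) (κ : ℝ) (yz : E × E) : E × E :=
  let y' := yz.2 - (1 / κ) • gradient g yz.2
  (y', y' + ((√κ - 1) / (√κ + 1)) • (y' - yz.1))

/-- `T` steps of accelerated gradient descent from `y₀`. -/
def agd {E : Type*} [NormedAddCommGroup E] [InnerProductSpace ℝ E] [CompleteSpace E]
    (g : E → ℝ) (κ : ℝ) (T : ℕ) (y₀ : E) : E :=
  ((agdStep g κ)^[T] (y₀, y₀)).1

/-- The condition number with which accelerated gradient descent is run. -/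
def kappa (p : ℝ) (n : ℕ) : ℝ :=
  4 * p ^ 2 / (p - 1) * (3 + 2 * p ^ 3 / (p - 1) * √(n : ℝ) * stepH p) ^ |2 - 4 / p|

/-- The function `g_t(y) = c · P y + f̃_t(A P y - b)`, where `f̃_t` is the quadratic extension of
`f_{(1-h)t}` outside the box `𝒩_{s(x)}(γ)`. -/
def precondObjective {n d m : ℕ} (A : Matrix (Fin n) (Fin d) ℝ) (b : Fin n → ℝ) (c : Fin d → ℝ)
    (p t : ℝ) (x : Fin d → ℝ) (P : Matrix (Fin d) (Fin m) ℝ) (y : EuclideanSpace ℝ (Fin m)) : ℝ :=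
  c ⬝ᵥ (P *ᵥ y.ofLp) +
    ∑ i, extend p ((1 - stepH p) * t)
      (lower p (radius p n t) (residual A b x i)) (upper p (radius p n t) (residual A b x i))
      (residual A b (P *ᵥ y.ofLp) i)

/-- One phase: from the current approximation `x` of `x(t)`, run `T` steps of accelerated gradient
descent on `g_t` and return the resulting approximation of `x((1-h)t)`. The argument `P` is the
preconditioner built at `x`; the run starts at `y₀ = Pᵀ Aᵀ D_t A x`, which for both preconditioners
is the preimage of `x`: `P y₀ = x` for `x ∈ ker(A)ᗮ`. -/
def phase {n d m : ℕ} (A : Matrix (Fin n) (Fin d) ℝ) (b : Fin n → ℝ) (c : Fin d → ℝ)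
    (p t : ℝ) (T : ℕ) (P : Matrix (Fin d) (Fin m) ℝ) (x : Fin d → ℝ) : Fin d → ℝ :=
  P *ᵥ (agd (precondObjective A b c p t x P) (kappa p n) T
    (WithLp.toLp 2 (Pᵀ *ᵥ (gram A b p t x *ᵥ x)))).ofLp

/-- The smoothing parameters `t_k = (1-h)^k t₀`. -/
def tSeq (p t₀ : ℝ) (k : ℕ) : ℝ := (1 - stepH p) ^ k * t₀

/-- The point computed by the homotopy method after `k` phases of `T` steps of accelerated gradient
descent each, started at `x₀`; `pre t x` is the preconditioner built at parameter `t` and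
point `x`. -/
def homotopy {n d m : ℕ} (A : Matrix (Fin n) (Fin d) ℝ) (b : Fin n → ℝ) (c : Fin d → ℝ) (p t₀ : ℝ)
    (pre : ℝ → (Fin d → ℝ) → Matrix (Fin d) (Fin m) ℝ) (T : ℕ) (x₀ : Fin d → ℝ) :
    ℕ → (Fin d → ℝ)
  | 0 => x₀
  | k + 1 =>
    phase A b c p (tSeq p t₀ k) T (pre (tSeq p t₀ k) (homotopy A b c p t₀ pre T x₀ k))
      (homotopy A b c p t₀ pre T x₀ k)

/-! ### The initial point -/

/-- The number `cᵀ (Aᵀ A)† c`. -/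
def costEnergy {n d : ℕ} (A : Matrix (Fin n) (Fin d) ℝ) (c : Fin d → ℝ) : ℝ :=
  c ⬝ᵥ (pinv (Aᵀ * A) *ᵥ c)

/-- The closed form `(Aᵀ A)† Aᵀ b - (1/p) t^{2-p} (Aᵀ A)† c` of the initial point. -/
def initialPoint {n d : ℕ} (A : Matrix (Fin n) (Fin d) ℝ) (b : Fin n → ℝ) (c : Fin d → ℝ)
    (p t : ℝ) : Fin d → ℝ :=
  pinv (Aᵀ * A) *ᵥ (Aᵀ *ᵥ b) - (1 / p * t ^ (2 - p)) • (pinv (Aᵀ * A) *ᵥ c)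

/-! ### Cost of one step: straight-line programs over the reals with preconditioner calls -/

/-- Memory cells. The data of a phase sit in named cells, `y` and `z` hold the state of accelerated
gradient descent, and `work r i` is the `i`-th entry of the `r`-th work array. -/
inductive Cell (n d m : ℕ) : Type
  | matA (i : Fin n) (j : Fin d)
  | vecB (i : Fin n)
  | vecC (j : Fin d)
  | lo (i : Fin n)
  | hi (i : Fin n)
  | expo
  | smoothing
  | cond
  | y (k : Fin m)
  | z (k : Fin m)
  | work (r i : ℕ)
  deriving DecidableEq

inductive BinOp : Type
  | add
  | sub
  | mul
  | div
  | pow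

def BinOp.eval : BinOp → ℝ → ℝ → ℝ
  | .add, a, b => a + b
  | .sub, a, b => a - b
  | .mul, a, b => a * b
  | .div, a, b => a / b
  | .pow, a, b => a ^ b

/-- Instructions. `const`, `op` and `select` are elementary: each writes one cell. `applyP` and
`applyPT` multiply the vector in a work array by the preconditioner `P`, respectively by its
transpose, and write the result into a work array. -/
inductive Instr (n d m : ℕ) : Type
  | const (dst : Cell n d m) (q : ℚ)
  | op (o : BinOp) (dst a b : Cell n d m)
  /-- `dst := if a ≤ b then u else v` -/
  | select (dst a b u v : Cell n d m)
  | applyP (dst src : ℕ)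
  | applyPT (dst src : ℕ)

/-- Write the vector `v` into the work array `dst`. -/
def writeArray {n d m k : ℕ} (mem : Cell n d m → ℝ) (dst : ℕ) (v : Fin k → ℝ) :
    Cell n d m → ℝ
  | .work r i => if h : r = dst ∧ i < k then v ⟨i, h.2⟩ else mem (.work r i)
  | cell => mem cell

/-- The effect of an instruction on the memory. -/
def Instr.exec {n d m : ℕ} (P : Matrix (Fin d) (Fin m) ℝ) (mem : Cell n d m → ℝ) :
    Instr n d m → (Cell n d m → ℝ)
  | .const dst q => Function.update mem dst (q : ℝ)
  | .op o dst a b => Function.update mem dst (o.eval (mem a) (mem b))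
  | .select dst a b u v => Function.update mem dst (if mem a ≤ mem b then mem u else mem v)
  | .applyP dst src => writeArray mem dst (P *ᵥ fun k : Fin m => mem (.work src k))
  | .applyPT dst src => writeArray mem dst (Pᵀ *ᵥ fun j : Fin d => mem (.work src j))

/-- Whether an instruction is a preconditioner application. -/
def Instr.isApply {n d m : ℕ} : Instr n d m → Bool
  | .applyP _ _ => true
  | .applyPT _ _ => true
  | _ => false

/-- Run a straight-line program. -/
def run {n d m : ℕ} (P : Matrix (Fin d) (Fin m) ℝ) (prog : List (Instr n d m))
    (mem : Cell n d m → ℝ) : Cell n d m → ℝ :=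
  prog.foldl (fun mem' instr => instr.exec P mem') mem

/-- The number of preconditioner applications of a program. -/
def applyCount {n d m : ℕ} (prog : List (Instr n d m)) : ℕ :=
  prog.countP fun instr => instr.isApply

/-- The number of elementary operations of a program. -/
def elemCount {n d m : ℕ} (prog : List (Instr n d m)) : ℕ :=
  prog.countP fun instr => !instr.isApply

/-- The memory holds the data of the phase with parameter `t` and point `x`, and the state `yz` of
accelerated gradient descent; the work arrays are arbitrary. -/
structure Holds {n d m : ℕ} (A : Matrix (Fin n) (Fin d) ℝ) (b : Fin n → ℝ) (c : Fin d → ℝ)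
    (p t : ℝ) (x : Fin d → ℝ) (yz : EuclideanSpace ℝ (Fin m) × EuclideanSpace ℝ (Fin m))
    (mem : Cell n d m → ℝ) : Prop where
  matA : ∀ i j, mem (.matA i j) = A i j
  vecB : ∀ i, mem (.vecB i) = b i
  vecC : ∀ j, mem (.vecC j) = c j
  lo : ∀ i, mem (.lo i) = lower p (radius p n t) (residual A b x i)
  hi : ∀ i, mem (.hi i) = upper p (radius p n t) (residual A b x i)
  expo : mem .expo = p
  smoothing : mem .smoothing = (1 - stepH p) * t
  cond : mem .cond = kappa p n
  y : ∀ k, mem (.y k) = yz.1 k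
  z : ∀ k, mem (.z k) = yz.2 k

/-- The program performs one step of accelerated gradient descent on `g_t`, in place, for every
matrix `A` whose nonzero entries have positions in `S`, for all other data and in every phase. -/
def ImplementsStep {n d m : ℕ} (S : Finset (Fin n × Fin d)) (prog : List (Instr n d m)) : Prop :=
  ∀ (A : Matrix (Fin n) (Fin d) ℝ), (∀ i j, A i j ≠ 0 → (i, j) ∈ S) →
  ∀ (b : Fin n → ℝ) (c : Fin d → ℝ) (p t : ℝ), 1 < p → 0 < t →
  ∀ (x : Fin d → ℝ) (P : Matrix (Fin d) (Fin m) ℝ)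
    (yz : EuclideanSpace ℝ (Fin m) × EuclideanSpace ℝ (Fin m)) (mem : Cell n d m → ℝ),
    Holds A b c p t x yz mem →
    Holds A b c p t x (agdStep (precondObjective A b c p t x P) (kappa p n) yz) (run P prog mem)

end LpHomotopy

end

/-!
On the box of radius `γ_t` around the current residual the curvature of `f_{(1-h)t}` exceeds the
weights `D_t` by at most the factor `κ`, and the quadratic continuation preserves this. Both
preconditioners satisfy `P Pᵀ = (Aᵀ D_t A)†`, so on the range of `Pᵀ` the objective `g_t` is
`1`-strongly convex and `κ`-smooth, and AGD contracts by the factor `1 - 1/√κ` per step.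

Comparing the stationarity conditions at `t` and `(1-h)t` shows that the point `x(t)` of the path
moves by at most `(p³/(p-1)) √n h t^(p/2)` in the metric of the box. Hence `x((1-h)t)` stays in the
box, where `g_t` agrees with the smoothed objective, and is the point which AGD approximates. Strong
convexity turns accuracy in the objective into accuracy in the box metric, so that the next phase
starts from a point as good as the previous one. At the end, `|f_t(s) - |s|^p| = O(p t^p)` turns an
approximate minimizer of the smoothed objective into one of the original objective.

The gradient of `g_t` is `Pᵀ (c + Aᵀ f̃'(A P z - b))`. It takes one product with `P`, one with `Pᵀ`,
and two passes over the nonzero entries of `A`.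
-/

noncomputable section

namespace LpHomotopy

open Set

/-! ### Slopes of functions of one variable -/

/-- All difference quotients of `f` between points of `s` lie in `[m, L]`. This is the form of a
two-sided bound on `f'` that survives the corners of `f`. -/
def SlopesIn (m L : ℝ) (f : ℝ → ℝ) (s : Set ℝ) : Prop :=
  ∀ a ∈ s, ∀ b ∈ s, a ≤ b → m * (b - a) ≤ f b - f a ∧ f b - f a ≤ L * (b - a)

namespace SlopesIn

variable {m L c : ℝ} {f g : ℝ → ℝ} {s : Set ℝ}

lemma congr (hf : SlopesIn m L f s) (hfg : EqOn f g s) : SlopesIn m L g s :=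
  fun a ha b hb hab => by simpa only [← hfg ha, ← hfg hb] using hf a ha b hb hab

lemma glue (hs : s.OrdConnected) (h₁ : SlopesIn m L f (s ∩ Iic c))
    (h₂ : SlopesIn m L f (s ∩ Ici c)) : SlopesIn m L f s := by
  intro a ha b hb hab
  rcases le_total b c with hbc | hcb
  · exact h₁ a ⟨ha, hab.trans hbc⟩ b ⟨hb, hbc⟩ hab
  rcases le_total c a with hca | hac
  · exact h₂ a ⟨ha, hca⟩ b ⟨hb, hcb⟩ hab
  have hc : c ∈ s := hs.out ha hb ⟨hac, hcb⟩
  obtain ⟨hm₁, hL₁⟩ := h₁ a ⟨ha, hac⟩ c ⟨hc, self_mem_Iic⟩ hac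
  obtain ⟨hm₂, hL₂⟩ := h₂ c ⟨hc, self_mem_Ici⟩ b ⟨hb, hcb⟩ hcb
  constructor <;> linarith

lemma of_affine {k v w : ℝ} (hk : k ∈ Icc m L) : SlopesIn m L (fun x => v + k * (x - w)) s := by
  intro a _ b _ hab
  have hba : 0 ≤ b - a := sub_nonneg.2 hab
  constructor <;> nlinarith [mul_le_mul_of_nonneg_right hk.1 hba,
    mul_le_mul_of_nonneg_right hk.2 hba]

lemma of_hasDerivAt {f' : ℝ → ℝ} (hs : Convex ℝ s) (hf : ContinuousOn f s)
    (hf' : ∀ x ∈ interior s, HasDerivAt f (f' x) x) (hmL : ∀ x ∈ s, f' x ∈ Icc m L) :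
    SlopesIn m L f s := by
  have hdiff : DifferentiableOn ℝ f (interior s) := fun x hx =>
    (hf' x hx).differentiableAt.differentiableWithinAt
  exact fun a ha b hb hab =>
    ⟨hs.mul_sub_le_image_sub_of_le_deriv hf hdiff
      (fun x hx => (hf' x hx).deriv ▸ (hmL x (interior_subset hx)).1) a ha b hb hab,
    hs.image_sub_le_mul_sub_of_deriv_le hf hdiff
      (fun x hx => (hf' x hx).deriv ▸ (hmL x (interior_subset hx)).2) a ha b hb hab⟩

end SlopesIn

lemma quadratic_minorant_le {F f : ℝ → ℝ} {m : ℝ} (hF : ∀ s, HasDerivAt F (f s) s)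
    (hf : ∀ a b, a ≤ b → m * (b - a) ≤ f b - f a) (a b : ℝ) :
    F a + f a * (b - a) + m / 2 * (b - a) ^ 2 ≤ F b := by
  have hG : ∀ s, HasDerivAt (fun s => F s - m / 2 * s ^ 2) (f s - m * s) s := fun s =>
    ((hF s).sub ((hasDerivAt_pow 2 s).const_mul (m / 2))).congr_deriv (by norm_num; ring)
  have hconv : ConvexOn ℝ univ (fun s => F s - m / 2 * s ^ 2) := by
    refine Monotone.convexOn_univ_of_deriv (fun s => (hG s).differentiableAt) fun x y hxy => ?_
    rw [(hG x).deriv, (hG y).deriv]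
    linarith [hf x y hxy]
  rcases lt_trichotomy a b with hab | rfl | hab
  · have := hconv.le_slope_of_hasDerivAt (mem_univ a) (mem_univ b) hab (hG a)
    rw [slope_def_field, le_div_iff₀ (by linarith)] at this
    nlinarith
  · simp
  · have := hconv.slope_le_of_hasDerivAt (mem_univ b) (mem_univ a) hab (hG a)
    rw [slope_def_field, div_le_iff₀ (by linarith)] at this
    nlinarith

lemma SlopesIn.quadratic_bounds {F f : ℝ → ℝ} {m L : ℝ} (hf : SlopesIn m L f univ)
    (hF : ∀ s, HasDerivAt F (f s) s) (a b : ℝ) :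
    F a + f a * (b - a) + m / 2 * (b - a) ^ 2 ≤ F b ∧
      F b ≤ F a + f a * (b - a) + L / 2 * (b - a) ^ 2 := by
  refine ⟨quadratic_minorant_le hF (fun a b hab => (hf a trivial b trivial hab).1) a b, ?_⟩
  have := quadratic_minorant_le (F := fun s => -F s) (f := fun s => -f s) (m := -L)
    (fun s => (hF s).neg) (fun a b hab => by linarith [(hf a trivial b trivial hab).2]) a b
  linarith

lemma hasDerivAt_ite_le {f₁ f₂ f₁' f₂' : ℝ → ℝ} {c : ℝ}
    (h₁ : ∀ s ≤ c, HasDerivAt f₁ (f₁' s) s) (h₂ : ∀ s, c ≤ s → HasDerivAt f₂ (f₂' s) s)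
    (hf : f₁ c = f₂ c) (hf' : f₁' c = f₂' c) (s : ℝ) :
    HasDerivAt (fun s => if s ≤ c then f₁ s else f₂ s) (if s ≤ c then f₁' s else f₂' s) s := by
  have heq : ∀ x, c ≤ x → (if x ≤ c then f₁ x else f₂ x) = f₂ x := fun x hx => by
    split_ifs with h
    · rw [le_antisymm h hx, hf]
    · rfl
  rcases lt_trichotomy s c with h | rfl | h
  · rw [if_pos h.le]
    refine (h₁ s h.le).congr_of_eventuallyEq ?_
    filter_upwards [Iio_mem_nhds h] with x hx using if_pos (le_of_lt hx)
  · rw [if_pos le_rfl]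
    have hl := (h₁ s le_rfl).hasDerivWithinAt.congr (s := Iic s)
      (f₁ := fun x => if x ≤ s then f₁ x else f₂ x) (fun x (hx : x ≤ s) => if_pos hx)
      (if_pos le_rfl)
    have hr := (h₂ s le_rfl).hasDerivWithinAt.congr (s := Ici s) heq (heq s le_rfl)
    have h := hl.union (hr.congr_deriv hf'.symm)
    rwa [Iic_union_Ici, hasDerivWithinAt_univ] at h
  · rw [if_neg h.not_ge]
    refine (h₂ s h.le).congr_of_eventuallyEq ?_
    filter_upwards [Ioi_mem_nhds h] with x hx using if_neg (not_le.2 hx)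

/-! ### The smoothing -/

section Smooth

variable {p t : ℝ}

lemma rpow_sub_one_mul {r a : ℝ} (hr : 0 < r) (ha : 0 ≤ a) : a ^ (r - 1) * a = a ^ r := by
  rcases ha.eq_or_lt with rfl | ha
  · simp [Real.zero_rpow hr.ne']
  · rw [← Real.rpow_add_one ha.ne', sub_add_cancel]

lemma rpow_sub_two_mul_sq {a : ℝ} (ha : 0 < a) : a ^ (p - 2) * a ^ 2 = a ^ p := by
  rw [← Real.rpow_natCast, ← Real.rpow_add ha]
  norm_num

lemma smooth'_eq (s : ℝ) : smooth' p t s = p * max t |s| ^ (p - 2) * s := by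
  unfold smooth'
  split_ifs with h
  · rw [max_eq_left h]
  · rw [max_eq_right (not_le.1 h).le]

lemma smooth_of_le {s : ℝ} (ht : 0 < t) (h : t ≤ |s|) :
    smooth p t s = |s| ^ p + (p / 2 - 1) * t ^ p := by
  unfold smooth
  split_ifs with h'
  · rw [← sq_abs s, le_antisymm h' h, mul_assoc, rpow_sub_two_mul_sq ht]
    ring
  · rfl

lemma smooth'_of_le {s : ℝ} (h : t ≤ |s|) : smooth' p t s = p * |s| ^ (p - 2) * s := by
  rw [smooth'_eq, max_eq_right h]

lemma hasDerivAt_smooth (hp : 1 < p) (ht : 0 < t) (s : ℝ) :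
    HasDerivAt (smooth p t) (smooth' p t s) s := by
  have hin : ∀ x, HasDerivAt (fun x => p / 2 * t ^ (p - 2) * x ^ 2) (p * t ^ (p - 2) * x) x :=
    fun x => ((hasDerivAt_pow 2 x).const_mul _).congr_deriv (by norm_num; ring)
  have hout : ∀ x, HasDerivAt (fun x => |x| ^ p + (p / 2 - 1) * t ^ p)
      (p * |x| ^ (p - 2) * x) x := fun x => (hasDerivAt_abs_rpow x hp).add_const _
  have hval : p / 2 * t ^ (p - 2) * t ^ 2 = t ^ p + (p / 2 - 1) * t ^ p := by
    rw [mul_assoc, rpow_sub_two_mul_sq ht]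
    ring
  have hright := hasDerivAt_ite_le (c := t) (fun x _ => hin x) (fun x _ => hout x)
    (by rwa [abs_of_pos ht]) (by rw [abs_of_pos ht])
  have hglued := hasDerivAt_ite_le (c := -t) (fun x _ => hout x) (fun x _ => hright x)
    (by rw [if_pos (by linarith), abs_neg, abs_of_pos ht, neg_sq, hval])
    (by rw [if_pos (by linarith), abs_neg, abs_of_pos ht]) s
  have hcases : ∀ (x : ℝ) (F G : ℝ), (|x| = t → F = G) →
      (if x ≤ -t then G else if x ≤ t then F else G) = if |x| ≤ t then F else G := by
    intro x F G hFG
    split_ifs with hl hx hu hx hx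
    · exact (hFG (le_antisymm hx (le_abs.2 (.inr (by linarith))))).symm
    · rfl
    · rfl
    · exact absurd (abs_le.2 ⟨(not_le.1 hl).le, hu⟩) hx
    · exact absurd (abs_le.1 hx).2 hu
    · rfl
  convert hglued using 1
  · ext x
    rw [hcases _ _ _ fun hx => by rw [← sq_abs, hx, hval], smooth]
  · rw [hcases _ _ _ fun hx => by rw [hx], smooth']

lemma continuous_smooth (hp : 1 < p) (ht : 0 < t) : Continuous (smooth p t) :=
  continuous_iff_continuousAt.2 fun s => (hasDerivAt_smooth hp ht s).continuousAt

lemma continuous_smooth' (ht : 0 < t) : Continuous (smooth' p t) := by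
  rw [funext smooth'_eq]
  exact (continuous_const.mul (Continuous.rpow_const (by fun_prop)
    fun s => .inl (lt_max_of_lt_left ht).ne')).mul continuous_id

lemma smooth'_neg (s : ℝ) : smooth' p t (-s) = -smooth' p t s := by
  rw [smooth'_eq, smooth'_eq, abs_neg, mul_neg]

lemma hasDerivAt_smooth' {s : ℝ} (ht : 0 < t) (hs : |s| ≠ t) :
    HasDerivAt (smooth' p t) (smooth'' p t s) s := by
  rcases hs.lt_or_gt with h | h
  · rw [smooth'', if_pos h.le]
    refine (((hasDerivAt_id s).const_mul (p * t ^ (p - 2))).congr_of_eventuallyEq ?_).congr_deriv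
      (mul_one _)
    filter_upwards [continuous_abs.continuousAt.eventually_lt continuousAt_const h] with x hx
      using if_pos hx.le
  · rw [smooth'', if_neg h.not_ge]
    have hs0 : s ≠ 0 := abs_pos.1 (ht.trans h)
    have habs := (hasDerivAt_abs hs0).rpow_const (p := p - 2) (.inl (abs_ne_zero.2 hs0))
    refine (((habs.mul (hasDerivAt_id s)).const_mul p).congr_of_eventuallyEq ?_).congr_deriv ?_
    · filter_upwards [continuousAt_const.eventually_lt continuous_abs.continuousAt h] with x hx
      rw [smooth'_of_le hx.le, mul_assoc]
      rfl
    · have hmul : |s| ^ (p - 2 - 1) * |s| = |s| ^ (p - 2) := by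
        rw [← Real.rpow_add_one (abs_ne_zero.2 hs0), sub_add_cancel]
      have hsign : (SignType.sign s : ℝ) * s = |s| := sign_mul_self s
      rw [id_eq]
      linear_combination p * (p - 2) * |s| ^ (p - 2 - 1) * hsign + p * (p - 2) * hmul

lemma smooth''_bounds (hp : 1 < p) (ht : 0 < t) (s : ℝ) :
    p * min 1 (p - 1) * max t |s| ^ (p - 2) ≤ smooth'' p t s ∧
      smooth'' p t s ≤ p * max 1 (p - 1) * max t |s| ^ (p - 2) := by
  have : 0 < max t |s| ^ (p - 2) := Real.rpow_pos_of_pos (lt_max_of_lt_left ht) _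
  obtain ⟨k, hk, hkeq⟩ : ∃ k ∈ Icc (min 1 (p - 1)) (max 1 (p - 1)),
      smooth'' p t s = p * k * max t |s| ^ (p - 2) := by
    rw [smooth'']
    split_ifs with h
    · exact ⟨1, ⟨min_le_left _ _, le_max_left _ _⟩, by rw [max_eq_left h, mul_one]⟩
    · exact ⟨p - 1, ⟨min_le_right _ _, le_max_right _ _⟩, by rw [max_eq_right (not_le.1 h).le]⟩
  rw [hkeq]
  constructor <;> gcongr
  exacts [hk.1, hk.2]

lemma slopesIn_smooth' {m L : ℝ} {s : Set ℝ} (ht : 0 < t) (hs : Convex ℝ s)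
    (h : ∀ x ∈ s, smooth'' p t x ∈ Icc m L) : SlopesIn m L (smooth' p t) s := by
  have hpiece : ∀ I : Set ℝ, Convex ℝ I → (∀ x ∈ interior I, |x| ≠ t) →
      SlopesIn m L (smooth' p t) (s ∩ I) := fun I hI hIt =>
    .of_hasDerivAt (hs.inter hI) (continuous_smooth' ht).continuousOn
      (fun x hx => hasDerivAt_smooth' ht (hIt x (interior_mono inter_subset_right hx)))
      fun x hx => h x hx.1
  refine .glue (c := -t) hs.ordConnected (hpiece _ (convex_Iic _) fun x hx => ?_)
    (.glue (c := t) (hs.inter (convex_Ici _)).ordConnected ?_ ?_)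
  · rw [interior_Iic, mem_Iio] at hx
    exact (lt_abs.2 (.inr (by linarith))).ne'
  · rw [inter_assoc, Ici_inter_Iic]
    refine hpiece _ (convex_Icc _ _) fun x hx => ?_
    rw [interior_Icc] at hx
    exact (abs_lt.2 hx).ne
  · rw [inter_assoc, Ici_inter_Ici, sup_eq_right.2 (by linarith)]
    refine hpiece _ (convex_Ici _) fun x hx => ?_
    rw [interior_Ici, mem_Ioi] at hx
    exact (hx.trans_le (le_abs_self x)).ne'

lemma smooth'_strictMono (hp : 1 < p) (ht : 0 < t) : StrictMono (smooth' p t) := by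
  refine strictMono_of_odd_strictMonoOn_nonneg smooth'_neg ?_
  have hin : StrictMonoOn (smooth' p t) (Icc 0 t) := by
    intro a ha b hb hab
    have : 0 < p * t ^ (p - 2) := mul_pos (by linarith) (Real.rpow_pos_of_pos ht _)
    rw [smooth', smooth', abs_of_nonneg ha.1, abs_of_nonneg hb.1, if_pos ha.2, if_pos hb.2]
    gcongr
  have hout : StrictMonoOn (smooth' p t) (Ici t) := by
    have heq : ∀ s ∈ Ici t, smooth' p t s = p * s ^ (p - 1) := fun s (hs : t ≤ s) => by
      rw [smooth'_of_le (hs.trans (le_abs_self s)), abs_of_pos (ht.trans_le hs), mul_assoc,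
        ← rpow_sub_one_mul (sub_pos.2 hp) (ht.le.trans hs), show p - 1 - 1 = p - 2 by ring]
    intro a ha b hb hab
    rw [heq a ha, heq b hb]
    have : a ^ (p - 1) < b ^ (p - 1) :=
      Real.rpow_lt_rpow (ht.le.trans ha) hab (sub_pos.2 hp)
    gcongr
  rw [← Icc_union_Ici_eq_Ici ht.le]
  exact hin.union hout (isGreatest_Icc ht.le) isLeast_Ici

lemma smooth_add_le (hp : 1 < p) (ht : 0 < t) (a b : ℝ) :
    smooth p t a + smooth' p t a * (b - a) ≤ smooth p t b := by
  simpa using quadratic_minorant_le (m := 0) (hasDerivAt_smooth hp ht)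
    (fun a b hab => by simpa using (smooth'_strictMono hp ht).monotone hab) a b

end Smooth

/-! ### Signed powers and the box -/

section SignedPower

variable {p q r s : ℝ}

lemma spow_of_nonneg (hq : q ≠ 0) (hs : 0 ≤ s) : spow s q = s ^ q := by
  rcases hs.eq_or_lt with rfl | h
  · simp [spow, Real.zero_rpow hq]
  · simp [spow, sign_pos h, abs_of_pos h]

lemma spow_neg (s q : ℝ) : spow (-s) q = -spow s q := by
  simp [spow, Left.sign_neg]

lemma spow_one (s : ℝ) : spow s 1 = s := by
  rw [spow, Real.rpow_one, sign_mul_abs]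

lemma spow_mul (a u r : ℝ) : spow (a * u) r = spow a r * spow u r := by
  rw [spow, spow, spow, sign_mul, SignType.coe_mul, abs_mul,
    Real.mul_rpow (abs_nonneg a) (abs_nonneg u)]
  ring

lemma abs_spow (hq : q ≠ 0) (s : ℝ) : |spow s q| = |s| ^ q := by
  rcases le_total 0 s with h | h
  · rw [spow_of_nonneg hq h, abs_of_nonneg (Real.rpow_nonneg h _), abs_of_nonneg h]
  · have h' : 0 ≤ -s := neg_nonneg.2 h
    rw [← abs_neg, ← spow_neg, spow_of_nonneg hq h', abs_of_nonneg (Real.rpow_nonneg h' _),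
      abs_of_nonpos h]

lemma spow_strictMono (hq : 0 < q) : StrictMono fun s => spow s q :=
  strictMono_of_odd_strictMonoOn_nonneg (fun s => spow_neg s q) fun a ha b hb hab => by
    simpa only [spow_of_nonneg hq.ne' ha, spow_of_nonneg hq.ne' hb] using
      Real.rpow_lt_rpow ha hab hq

lemma spow_spow (hq : 0 < q) (hqr : q * r = 1) (s : ℝ) : spow (spow s q) r = s := by
  have hr : r ≠ 0 := right_ne_zero_of_mul_eq_one hqr
  have hnonneg : ∀ s, 0 ≤ s → spow (spow s q) r = s := fun s hs => by
    rw [spow_of_nonneg hq.ne' hs, spow_of_nonneg hr (Real.rpow_nonneg hs _), ← Real.rpow_mul hs,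
      hqr, Real.rpow_one]
  rcases le_total 0 s with h | h
  · exact hnonneg s h
  · simpa only [spow_neg, neg_inj] using hnonneg (-s) (neg_nonneg.2 h)

lemma lower_le_iff (hp : 0 < p) {γ x : ℝ} :
    lower p γ s ≤ x ↔ spow s (p / 2) - γ ≤ spow x (p / 2) := by
  rw [lower, ← (spow_strictMono (half_pos hp)).le_iff_le,
    spow_spow (q := 2 / p) (by positivity) (by field_simp)]

lemma le_upper_iff (hp : 0 < p) {γ x : ℝ} :
    x ≤ upper p γ s ↔ spow x (p / 2) ≤ spow s (p / 2) + γ := by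
  rw [upper, ← (spow_strictMono (half_pos hp)).le_iff_le,
    spow_spow (q := 2 / p) (by positivity) (by field_simp)]

lemma mem_Icc_lower_upper (hp : 0 < p) {γ x : ℝ} :
    x ∈ Icc (lower p γ s) (upper p γ s) ↔ |spow x (p / 2) - spow s (p / 2)| ≤ γ := by
  rw [mem_Icc, lower_le_iff hp, le_upper_iff hp, abs_sub_le_iff, sub_le_comm, and_comm,
    ← sub_le_iff_le_add']

lemma lower_le_upper (hp : 0 < p) {γ : ℝ} (hγ : 0 ≤ γ) : lower p γ s ≤ upper p γ s :=
  have h : s ∈ Icc (lower p γ s) (upper p γ s) := (mem_Icc_lower_upper hp).2 (by simpa)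
  h.1.trans h.2

lemma one_sub_spow_le (hr : 0 < r) {u : ℝ} (hu : |u| ≤ 1) :
    1 - spow u r ≤ max 2 r * (1 - u) := by
  have hu1 : 0 ≤ 1 - u := sub_nonneg.2 (le_of_abs_le hu)
  have h₂ : 2 * (1 - u) ≤ max 2 r * (1 - u) := by gcongr; exact le_max_left _ _
  rcases le_total 0 u with h | h
  · rw [spow_of_nonneg hr.ne' h]
    rcases le_total r 1 with hr1 | hr1
    · linarith [Real.self_le_rpow_of_le_one h (by linarith) hr1]
    · have hbern := one_add_mul_self_le_rpow_one_add (s := u - 1) (by linarith) hr1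
      have : r * (1 - u) ≤ max 2 r * (1 - u) := by gcongr; exact le_max_right _ _
      rw [add_sub_cancel] at hbern
      linarith
  · have : |spow u r| ≤ 1 := abs_spow hr.ne' u ▸ Real.rpow_le_one (abs_nonneg u) hu hr.le
    linarith [neg_le_of_abs_le this]

lemma half_one_sub_le_one_sub_spow (hr : 1 / 2 ≤ r) {u : ℝ} (hu : |u| ≤ 1) :
    1 / 2 * (1 - u) ≤ 1 - spow u r := by
  have hr0 : 0 < r := by linarith
  have hu1 : u ≤ 1 := le_of_abs_le hu
  rcases le_total 0 u with h | h
  · rw [spow_of_nonneg hr0.ne' h]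
    rcases le_total r 1 with hr1 | hr1
    · have hbern := rpow_one_add_le_one_add_mul_self (s := u - 1) (by linarith) hr0.le hr1
      rw [add_sub_cancel] at hbern
      nlinarith
    · linarith [Real.rpow_le_self_of_le_one h hu1 hr1]
  · have : spow u r ≤ spow 0 r := (spow_strictMono hr0).monotone h
    rw [spow_of_nonneg hr0.ne' le_rfl, Real.zero_rpow hr0.ne'] at this
    linarith [neg_le_of_abs_le hu]

-- The ratio of two numbers reduces estimates for `|spow a r - spow b r|` to Bernoulli's inequality.
lemma exists_abs_spow_sub {a b : ℝ} (hab : |b| ≤ |a|) :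
    ∃ u : ℝ, |u| ≤ 1 ∧ ∀ r > 0, |spow a r - spow b r| = |a| ^ r * (1 - spow u r) := by
  rcases eq_or_ne a 0 with rfl | ha
  · obtain rfl : b = 0 := by simpa using hab
    exact ⟨0, by simp, fun r hr => by simp [Real.zero_rpow hr.ne']⟩
  have hu : |b / a| ≤ 1 := by rw [abs_div]; exact div_le_one_of_le₀ hab (abs_nonneg a)
  refine ⟨b / a, hu, fun r hr => ?_⟩
  have : |spow (b / a) r| ≤ 1 :=
    abs_spow hr.ne' (b / a) ▸ Real.rpow_le_one (abs_nonneg _) hu hr.le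
  have hb : spow b r = spow a r * spow (b / a) r := by rw [← spow_mul, mul_div_cancel₀ b ha]
  rw [hb, ← mul_one_sub, abs_mul, abs_spow hr.ne',
    abs_of_nonneg (sub_nonneg.2 (le_of_abs_le this))]

lemma abs_spow_sub_le (hr : 0 < r) (a b : ℝ) :
    |spow a r - spow b r| ≤ max 2 r * max |a| |b| ^ (r - 1) * |a - b| := by
  wlog hab : |b| ≤ |a| generalizing a b
  · simpa only [abs_sub_comm, max_comm] using this b a (le_of_not_ge hab)
  obtain ⟨u, hu, h⟩ := exists_abs_spow_sub hab
  have h₁ := h 1 one_pos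
  rw [spow_one, spow_one, spow_one, Real.rpow_one] at h₁
  rw [max_eq_left hab, h r hr, h₁, mul_assoc, ← mul_assoc (_ ^ _),
    rpow_sub_one_mul hr (abs_nonneg a), mul_left_comm]
  have := one_sub_spow_le hr hu
  gcongr

lemma half_mul_abs_sub_le_abs_spow_sub (hr : 1 / 2 ≤ r) (a b : ℝ) :
    1 / 2 * max |a| |b| ^ (r - 1) * |a - b| ≤ |spow a r - spow b r| := by
  wlog hab : |b| ≤ |a| generalizing a b
  · simpa only [abs_sub_comm, max_comm] using this b a (le_of_not_ge hab)
  have hr0 : 0 < r := by linarith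
  obtain ⟨u, hu, h⟩ := exists_abs_spow_sub hab
  have h₁ := h 1 one_pos
  rw [spow_one, spow_one, spow_one, Real.rpow_one] at h₁
  rw [max_eq_left hab, h r hr0, h₁, mul_assoc, ← mul_assoc (_ ^ _),
    rpow_sub_one_mul hr0 (abs_nonneg a), mul_left_comm]
  have := half_one_sub_le_one_sub_spow hr hu
  gcongr

end SignedPower

/-! ### Convergence of accelerated gradient descent -/

section AGD

variable {E : Type*} [NormedAddCommGroup E] [InnerProductSpace ℝ E]

/-- The point `z + √κ (z - y)`: the distance to it measures how far the state `(y, z)` of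
accelerated gradient descent is from the minimizer. -/
def agdCenter (κ : ℝ) (yz : E × E) : E :=
  yz.2 + √κ • (yz.2 - yz.1)

/-- The Lyapunov function of accelerated gradient descent relative to a comparison point `w`. -/
def lyapunov (g : E → ℝ) (κ : ℝ) (w : E) (yz : E × E) : ℝ :=
  g yz.1 - g w + 1 / 2 * ‖agdCenter κ yz - w‖ ^ 2

variable [CompleteSpace E] {g : E → ℝ} {κ : ℝ}

lemma agdCenter_agdStep (hκ : 0 < κ) (yz : E × E) :
    agdCenter κ (agdStep g κ yz) = (1 - 1 / √κ) • agdCenter κ yz + (1 / √κ) • yz.2 -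
      (1 / √κ) • gradient g yz.2 := by
  have : 0 < √κ := Real.sqrt_pos.2 hκ
  have hsq : 1 / κ = 1 / √κ ^ 2 := by rw [Real.sq_sqrt hκ.le]
  simp only [agdCenter, agdStep, hsq]
  match_scalars <;> field_simp <;> ring

lemma lyapunov_agdStep_le (hκ : 1 ≤ κ) {w y z : E}
    (hy : g z + inner ℝ (gradient g z) (y - z) ≤ g y)
    (hw : g z + inner ℝ (gradient g z) (w - z) + 1 / 2 * ‖w - z‖ ^ 2 ≤ g w)
    (hstep : g (z - (1 / κ) • gradient g z) ≤ g z - 1 / (2 * κ) * ‖gradient g z‖ ^ 2) :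
    lyapunov g κ w (agdStep g κ (y, z)) ≤ (1 - 1 / √κ) * lyapunov g κ w (y, z) := by
  have hκ0 : 0 < κ := one_pos.trans_le hκ
  have hsqrt : 0 < √κ := Real.sqrt_pos.2 hκ0
  set G := gradient g z
  set v := agdCenter κ (y, z) with hv
  set θ := 1 / √κ with hθ
  have hθ0 : 0 ≤ θ := by positivity
  have hθ1 : 0 ≤ 1 - θ := sub_nonneg.2 ((div_le_one hsqrt).2 (Real.one_le_sqrt.2 hκ))
  have hθκ : 1 / (2 * κ) = θ ^ 2 / 2 := by
    rw [hθ, div_pow, Real.sq_sqrt hκ0.le]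
    field_simp
  set u := (1 - θ) • (v - w) + θ • (z - w) with hu
  have hcenter : agdCenter κ (agdStep g κ (y, z)) - w = u - θ • G := by
    rw [agdCenter_agdStep hκ0, hu]
    module
  have hconv : ‖u‖ ^ 2 ≤ (1 - θ) * ‖v - w‖ ^ 2 + θ * ‖z - w‖ ^ 2 :=
    ((convexOn_norm (E := E) convex_univ).pow (fun _ _ => norm_nonneg _) 2).2 trivial trivial
      hθ1 hθ0 (by ring)
  have hlin : (1 - θ) * inner ℝ G (y - z) + θ * inner ℝ G (w - z) + θ * inner ℝ G u = 0 := by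
    rw [← inner_smul_right, ← inner_smul_right, ← inner_smul_right, ← inner_add_right,
      ← inner_add_right]
    have : (1 - θ) • (y - z) + θ • (w - z) + θ • u = 0 := by
      rw [hu, hv, agdCenter, hθ]
      match_scalars <;> field_simp <;> ring
    rw [this, inner_zero_right]
  have hy' := mul_le_mul_of_nonneg_left hy hθ1
  have hw' := mul_le_mul_of_nonneg_left hw hθ0
  rw [hθκ] at hstep
  simp only [lyapunov, hcenter, norm_sub_sq_real, norm_smul, inner_smul_right, mul_pow,
    Real.norm_eq_abs, sq_abs, real_inner_comm G u, norm_sub_rev w z] at *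
  change g (z - (1 / κ) • G) - _ + _ ≤ _
  linarith

lemma map_gradient_step_le (hκ : 0 < κ) {z : E}
    (hup : g (z - (1 / κ) • gradient g z) ≤ g z +
      inner ℝ (gradient g z) (z - (1 / κ) • gradient g z - z) +
        κ / 2 * ‖z - (1 / κ) • gradient g z - z‖ ^ 2) :
    g (z - (1 / κ) • gradient g z) ≤ g z - 1 / (2 * κ) * ‖gradient g z‖ ^ 2 := by
  refine hup.trans_eq ?_
  rw [sub_sub_cancel_left, inner_neg_right, inner_smul_right, norm_neg, norm_smul,
    real_inner_self_eq_norm_sq, Real.norm_of_nonneg (by positivity)]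
  field_simp
  ring

lemma agd_mem_and_lyapunov_le (hκ : 1 ≤ κ) (V : Submodule ℝ E) (hV : ∀ z ∈ V, gradient g z ∈ V)
    (hlow : ∀ z ∈ V, ∀ u ∈ V, g z + inner ℝ (gradient g z) (u - z) + 1 / 2 * ‖u - z‖ ^ 2 ≤ g u)
    (hup : ∀ z ∈ V, ∀ u ∈ V, g u ≤ g z + inner ℝ (gradient g z) (u - z) + κ / 2 * ‖u - z‖ ^ 2)
    {w y₀ : E} (hw : w ∈ V) (hy₀ : y₀ ∈ V) (T : ℕ) :
    (((agdStep g κ)^[T] (y₀, y₀)).1 ∈ V ∧ ((agdStep g κ)^[T] (y₀, y₀)).2 ∈ V) ∧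
      lyapunov g κ w ((agdStep g κ)^[T] (y₀, y₀)) ≤
        (1 - 1 / √κ) ^ T * (g y₀ - g w + 1 / 2 * ‖y₀ - w‖ ^ 2) := by
  induction T with
  | zero => simp [lyapunov, agdCenter, hy₀]
  | succ k ih =>
    rw [Function.iterate_succ_apply']
    obtain ⟨⟨hy, hz⟩, hdecay⟩ := ih
    set yz := (agdStep g κ)^[k] (y₀, y₀)
    have hstep : yz.2 - (1 / κ) • gradient g yz.2 ∈ V :=
      V.sub_mem hz (V.smul_mem _ (hV _ hz))
    refine ⟨⟨hstep, V.add_mem hstep (V.smul_mem _ (V.sub_mem hstep hy))⟩, ?_⟩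
    calc lyapunov g κ w (agdStep g κ (yz.1, yz.2))
        ≤ (1 - 1 / √κ) * lyapunov g κ w (yz.1, yz.2) :=
          lyapunov_agdStep_le hκ (by linarith [hlow _ hz _ hy, sq_nonneg ‖yz.1 - yz.2‖])
            (hlow _ hz _ hw) (map_gradient_step_le (by linarith) (hup _ hz _ hstep))
      _ ≤ (1 - 1 / √κ) * ((1 - 1 / √κ) ^ k * (g y₀ - g w + 1 / 2 * ‖y₀ - w‖ ^ 2)) := by
          have : 1 / √κ ≤ 1 :=
            div_le_one_of_le₀ (Real.one_le_sqrt.2 hκ) (Real.sqrt_nonneg κ)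
          exact mul_le_mul_of_nonneg_left hdecay (sub_nonneg.2 this)
      _ = _ := by ring

lemma one_sub_inv_sqrt_pow_le_exp (hκ : 1 ≤ κ) (T : ℕ) :
    (1 - 1 / √κ) ^ T ≤ Real.exp (-(T / √κ)) := by
  have : 1 / √κ ≤ 1 := div_le_one_of_le₀ (Real.one_le_sqrt.2 hκ) (Real.sqrt_nonneg κ)
  calc (1 - 1 / √κ) ^ T ≤ Real.exp (-(1 / √κ)) ^ T :=
        pow_le_pow_left₀ (sub_nonneg.2 this) (Real.one_sub_le_exp_neg _) T
    _ = Real.exp (-(T / √κ)) := by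
        rw [← Real.exp_nat_mul]
        ring_nf

lemma agd_mem_and_sub_le (hκ : 1 ≤ κ) (V : Submodule ℝ E) (hV : ∀ z ∈ V, gradient g z ∈ V)
    (hlow : ∀ z ∈ V, ∀ u ∈ V, g z + inner ℝ (gradient g z) (u - z) + 1 / 2 * ‖u - z‖ ^ 2 ≤ g u)
    (hup : ∀ z ∈ V, ∀ u ∈ V, g u ≤ g z + inner ℝ (gradient g z) (u - z) + κ / 2 * ‖u - z‖ ^ 2)
    {w y₀ : E} (hw : w ∈ V) (hy₀ : y₀ ∈ V) (hmin : g w ≤ g y₀) (T : ℕ) :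
    agd g κ T y₀ ∈ V ∧ g (agd g κ T y₀) - g w ≤
      Real.exp (-(T / √κ)) * (g y₀ - g w + 1 / 2 * ‖y₀ - w‖ ^ 2) := by
  obtain ⟨⟨hmem, -⟩, hdecay⟩ := agd_mem_and_lyapunov_le hκ V hV hlow hup hw hy₀ T
  refine ⟨hmem, ?_⟩
  calc g (agd g κ T y₀) - g w
      ≤ lyapunov g κ w ((agdStep g κ)^[T] (y₀, y₀)) := le_add_of_nonneg_right (by positivity)
    _ ≤ (1 - 1 / √κ) ^ T * (g y₀ - g w + 1 / 2 * ‖y₀ - w‖ ^ 2) := hdecay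
    _ ≤ _ := mul_le_mul_of_nonneg_right (one_sub_inv_sqrt_pow_le_exp hκ T)
      (add_nonneg (sub_nonneg.2 hmin) (by positivity))

end AGD

/-! ### The quadratic extension -/

/-- The point of `[l, u]` nearest to `s`. -/
def clamp (l u s : ℝ) : ℝ := max l (min u s)

/-- The derivative of the quadratic extension. -/
def extend' (p t l u s : ℝ) : ℝ :=
  smooth' p t (clamp l u s) + smooth'' p t (clamp l u s) * (s - clamp l u s)

section Extension

variable {p t l u s : ℝ}

lemma clamp_of_le (hs : s ≤ l) : clamp l u s = l :=
  max_eq_left (min_le_of_right_le hs)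

lemma clamp_of_ge (hlu : l ≤ u) (hs : u ≤ s) : clamp l u s = u := by
  rw [clamp, min_eq_left hs, max_eq_right hlu]

lemma clamp_of_mem (hs : s ∈ Icc l u) : clamp l u s = s := by
  rw [clamp, min_eq_right hs.2, max_eq_right hs.1]

lemma extend_of_mem (hs : s ∈ Icc l u) : extend p t l u s = smooth p t s :=
  if_pos hs

lemma extend'_of_mem (hs : s ∈ Icc l u) : extend' p t l u s = smooth' p t s := by
  rw [extend', clamp_of_mem hs, sub_self, mul_zero, add_zero]

lemma extend_eq_ite (hlu : l ≤ u) : extend p t l u = fun s =>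
    if s ≤ l then smooth p t l + smooth' p t l * (s - l) + 1 / 2 * smooth'' p t l * (s - l) ^ 2
    else if s ≤ u then smooth p t s
    else smooth p t u + smooth' p t u * (s - u) + 1 / 2 * smooth'' p t u * (s - u) ^ 2 := by
  ext s
  rcases lt_trichotomy s l with hs | rfl | hs
  · rw [extend, if_neg (by simp [hs.not_ge]), if_neg (by linarith), if_pos hs.le]
  · simp [extend_of_mem ⟨le_refl s, hlu⟩]
  · rcases le_or_gt s u with hsu | hsu
    · rw [extend_of_mem ⟨hs.le, hsu⟩, if_neg hs.not_ge, if_pos hsu]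
    · rw [extend, if_neg (by simp [hsu.not_ge]), if_pos hsu.le, if_neg hs.not_ge,
        if_neg hsu.not_ge]

lemma extend'_eq_ite (hlu : l ≤ u) : extend' p t l u = fun s =>
    if s ≤ l then smooth' p t l + smooth'' p t l * (s - l)
    else if s ≤ u then smooth' p t s else smooth' p t u + smooth'' p t u * (s - u) := by
  ext s
  rcases le_or_gt s l with hs | hs
  · rw [extend', clamp_of_le hs, if_pos hs]
  · rcases le_or_gt s u with hsu | hsu
    · rw [extend'_of_mem ⟨hs.le, hsu⟩, if_neg hs.not_ge, if_pos hsu]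
    · rw [extend', clamp_of_ge hlu hsu.le, if_neg hs.not_ge, if_neg hsu.not_ge]

lemma hasDerivAt_extend (hp : 1 < p) (ht : 0 < t) (hlu : l ≤ u) (s : ℝ) :
    HasDerivAt (extend p t l u) (extend' p t l u s) s := by
  have htaylor : ∀ w x, HasDerivAt
      (fun s => smooth p t w + smooth' p t w * (s - w) + 1 / 2 * smooth'' p t w * (s - w) ^ 2)
      (smooth' p t w + smooth'' p t w * (x - w)) x := fun w x => by
    have hlin := (((hasDerivAt_id x).sub_const w).const_mul (smooth' p t w)).const_add
      (smooth p t w)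
    have hquad := (((hasDerivAt_id x).sub_const w).pow 2).const_mul (1 / 2 * smooth'' p t w)
    exact (hlin.add hquad).congr_deriv (by norm_num; ring)
  rw [extend_eq_ite hlu, extend'_eq_ite hlu]
  refine hasDerivAt_ite_le (fun x _ => htaylor l x) (fun x _ => hasDerivAt_ite_le
    (fun x _ => hasDerivAt_smooth hp ht x) (fun x _ => htaylor u x) ?_ ?_ x) ?_ ?_ s <;> simp [hlu]

lemma slopesIn_extend' {m L : ℝ} (ht : 0 < t) (hlu : l ≤ u)
    (h : ∀ x ∈ Icc l u, smooth'' p t x ∈ Icc m L) : SlopesIn m L (extend' p t l u) univ := by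
  refine .glue (c := l) ordConnected_univ ?_ (.glue (c := u) ?_ ?_ ?_)
  · refine (SlopesIn.of_affine (v := smooth' p t l) (w := l) (h l ⟨le_rfl, hlu⟩)).congr
      fun s hs => ?_
    rw [extend', clamp_of_le hs.2]
  · exact (convex_univ.inter (convex_Ici l)).ordConnected
  · rw [univ_inter, Ici_inter_Iic]
    exact (slopesIn_smooth' ht (convex_Icc l u) h).congr fun s hs => (extend'_of_mem hs).symm
  · refine (SlopesIn.of_affine (v := smooth' p t u) (w := u) (h u ⟨hlu, le_rfl⟩)).congr
      fun s hs => ?_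
    rw [extend', clamp_of_ge hlu hs.2]

end Extension

/-! ### The weights -/

section Weights

variable {p t : ℝ} {n : ℕ}

lemma stepH_pos (hp : 1 < p) : 0 < stepH p := by
  unfold stepH
  positivity

lemma stepH_le_half (hp : 1 < p) : stepH p ≤ 1 / 2 :=
  one_div_le_one_div_of_le two_pos (by linarith)

lemma one_sub_stepH_pos (hp : 1 < p) : 0 < 1 - stepH p := by
  linarith [stepH_le_half hp]

lemma shrink_pos (hp : 1 < p) (ht : 0 < t) : 0 < (1 - stepH p) * t :=
  mul_pos (one_sub_stepH_pos hp) ht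

lemma half_le_one_sub_stepH_rpow (hp : 1 < p) : 1 / 2 ≤ (1 - stepH p) ^ p := by
  have hbern := one_add_mul_self_le_rpow_one_add (s := -stepH p)
    (by linarith [stepH_le_half hp]) hp.le
  have h : p * -stepH p = -(1 / 2) := by
    unfold stepH
    field_simp
  rw [h, ← sub_eq_add_neg, ← sub_eq_add_neg] at hbern
  linarith

lemma half_mul_rpow_le_shrink_rpow (hp : 1 < p) (ht : 0 < t) :
    1 / 2 * t ^ p ≤ ((1 - stepH p) * t) ^ p := by
  rw [Real.mul_rpow (one_sub_stepH_pos hp).le ht.le]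
  have := half_le_one_sub_stepH_rpow hp
  gcongr

lemma drift_nonneg (hp : 1 < p) (n : ℕ) : 0 ≤ p ^ 3 / (p - 1) * √(n : ℝ) * stepH p := by
  have : 0 < p - 1 := sub_pos.2 hp
  have := stepH_pos hp
  positivity

lemma rpow_le_radius (hp : 1 < p) (n : ℕ) (ht : 0 < t) : t ^ (p / 2) ≤ radius p n t :=
  le_mul_of_one_le_left (by positivity) (le_add_of_nonneg_right (drift_nonneg hp n))

lemma radius_pos (hp : 1 < p) (n : ℕ) (ht : 0 < t) : 0 < radius p n t :=
  (Real.rpow_pos_of_pos ht _).trans_le (rpow_le_radius hp n ht)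

lemma weight_pos (hp : 1 < p) (ht : 0 < t) (s : Fin n → ℝ) (i : Fin n) : 0 < weight p t s i :=
  mul_pos (by linarith)
    (Real.rpow_pos_of_pos (lt_max_of_lt_left (Real.rpow_pos_of_pos ht _)) _)

/-- The base of the power in `kappa`; it equals `1 + 2 γ_t / t ^ (p / 2)`. -/
def kappaBase (p : ℝ) (n : ℕ) : ℝ := 3 + 2 * p ^ 3 / (p - 1) * √(n : ℝ) * stepH p

lemma one_le_kappaBase (hp : 1 < p) (n : ℕ) : 1 ≤ kappaBase p n := by
  have := drift_nonneg hp n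
  rw [kappaBase]
  linear_combination 2 * this

lemma two_mul_radius (p : ℝ) (n : ℕ) (t : ℝ) :
    2 * radius p n t = (kappaBase p n - 1) * t ^ (p / 2) := by
  unfold radius kappaBase
  ring

lemma rpow_half_rpow (hp : 0 < p) {x : ℝ} (hx : 0 ≤ x) :
    (x ^ (p / 2)) ^ (2 - 4 / p) = x ^ (p - 2) := by
  rw [← Real.rpow_mul hx]
  congr 1
  field_simp
  ring

lemma rpow_half_sub_one_sq {x : ℝ} (hx : 0 ≤ x) : (x ^ (p / 2 - 1)) ^ 2 = x ^ (p - 2) := by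
  rw [← Real.rpow_mul_natCast hx]
  ring_nf

lemma rpow_half_sq {x : ℝ} (hx : 0 ≤ x) : (x ^ (p / 2)) ^ 2 = x ^ p := by
  rw [← Real.rpow_mul_natCast hx]
  ring_nf

lemma rpow_le_rpow_abs_mul_rpow {e a b Q : ℝ} (ha : 0 < a) (hb : 0 < b) (hQ : 0 < Q)
    (hpos : 0 < e → a ≤ Q * b) (hneg : e < 0 → b ≤ Q * a) : a ^ e ≤ Q ^ |e| * b ^ e := by
  rcases lt_trichotomy e 0 with he | rfl | he
  · have := Real.rpow_le_rpow_of_nonpos hb (hneg he) he.le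
    rwa [Real.mul_rpow hQ.le ha.le, ← le_div_iff₀' (by positivity), div_eq_inv_mul,
      ← Real.rpow_neg hQ.le, ← abs_of_neg he] at this
  · simp
  · rw [abs_of_pos he, ← Real.mul_rpow hQ.le hb.le]
    exact Real.rpow_le_rpow ha.le (hpos he) he.le

lemma abs_abs_rpow_sub_le {r : ℝ} (hr : r ≠ 0) (x s : ℝ) :
    |(|x| ^ r - |s| ^ r)| ≤ |spow x r - spow s r| := by
  rw [← abs_spow hr, ← abs_spow hr]
  exact abs_abs_sub_abs_le _ _

lemma sign_sub_two_of_pos (hp : 0 < p) (h : 0 < 2 - 4 / p) :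
    (SignType.sign (p - 2) : ℝ) = 1 := by
  rw [sub_pos, div_lt_iff₀ hp] at h
  rw [sign_pos (by linarith), SignType.coe_one]

lemma sign_sub_two_of_neg (hp : 0 < p) (h : 2 - 4 / p < 0) :
    (SignType.sign (p - 2) : ℝ) = -1 := by
  rw [sub_neg, lt_div_iff₀ hp] at h
  rw [sign_neg (by linarith), SignType.coe_neg_one]

lemma weight_bounds (hp : 1 < p) (ht : 0 < t) (s : Fin n → ℝ) (i : Fin n) {x : ℝ}
    (hx : |spow x (p / 2) - spow (s i) (p / 2)| ≤ radius p n t) :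
    weight p t s i ≤ (p - 1) / 2 * max t |x| ^ (p - 2) ∧
      (p - 1) / 2 * max t |x| ^ (p - 2) ≤ kappaBase p n ^ |2 - 4 / p| * weight p t s i := by
  have hp0 : 0 < p := one_pos.trans hp
  have : 0 < (p - 1) / 2 := by linarith
  have hτ : 0 < t ^ (p / 2) := Real.rpow_pos_of_pos ht _
  have hQ := one_le_kappaBase hp n
  have hγ := two_mul_radius p n t
  have hγτ := rpow_le_radius hp n ht
  have : 0 ≤ |s i| ^ (p / 2) := by positivity
  obtain ⟨hσx, hxσ⟩ :=
    abs_sub_le_iff.1 ((abs_abs_rpow_sub_le (half_pos hp0).ne' x (s i)).trans hx)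
  have hmax : max t |x| ^ (p / 2) = max (t ^ (p / 2)) (|x| ^ (p / 2)) :=
    (Real.monotoneOn_rpow_Ici_of_exponent_nonneg (half_pos hp0).le).map_max ht.le (abs_nonneg x)
  rw [← rpow_half_rpow hp0 (ht.le.trans (le_max_left t |x|)), hmax, weight]
  set X := max (t ^ (p / 2)) (|x| ^ (p / 2))
  set W := max (t ^ (p / 2)) (|s i| ^ (p / 2) - SignType.sign (p - 2) * radius p n t)
  have hτX : t ^ (p / 2) ≤ X := le_max_left _ _
  have hτW : t ^ (p / 2) ≤ W := le_max_left _ _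
  have hxX : |x| ^ (p / 2) ≤ X := le_max_right _ _
  have hσW : |s i| ^ (p / 2) - SignType.sign (p - 2) * radius p n t ≤ W := le_max_right _ _
  have hX0 : 0 < X := hτ.trans_le hτX
  have hW0 : 0 < W := hτ.trans_le hτW
  constructor
  · have := rpow_le_rpow_abs_mul_rpow (e := 2 - 4 / p) hW0 hX0 one_pos
      (fun he => max_le (by linarith) (by rw [sign_sub_two_of_pos hp0 he]; linarith))
      (fun he => max_le (by linarith) (by rw [sign_sub_two_of_neg hp0 he] at hσW; linarith))
    rw [Real.one_rpow, one_mul] at this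
    gcongr
  · rw [mul_left_comm]
    gcongr
    refine rpow_le_rpow_abs_mul_rpow hX0 hW0 (by linarith)
      (fun he => ?_) (fun he => ?_)
    · rw [sign_sub_two_of_pos hp0 he] at hσW
      exact max_le (by nlinarith) (by nlinarith)
    · exact max_le (by nlinarith) (by rw [sign_sub_two_of_neg hp0 he]; nlinarith)

lemma max_rpow_le_kappa_mul_weight (hp : 1 < p) (ht : 0 < t) (s : Fin n → ℝ) (i : Fin n) {x : ℝ}
    (hx : |spow x (p / 2) - spow (s i) (p / 2)| ≤ radius p n t) :
    2 * p ^ 2 * max t |x| ^ (p - 2) ≤ kappa p n * weight p t s i := by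
  have hp1 : 0 < p - 1 := sub_pos.2 hp
  calc 2 * p ^ 2 * max t |x| ^ (p - 2)
      = 4 * p ^ 2 / (p - 1) * ((p - 1) / 2 * max t |x| ^ (p - 2)) := by field_simp; ring
    _ ≤ 4 * p ^ 2 / (p - 1) * (kappaBase p n ^ |2 - 4 / p| * weight p t s i) :=
        mul_le_mul_of_nonneg_left (weight_bounds hp ht s i hx).2 (by positivity)
    _ = kappa p n * weight p t s i := by rw [kappa, kappaBase]; ring

lemma max_shrink_rpow_bounds (hp : 1 < p) (ht : 0 < t) (x : ℝ) :
    max t |x| ^ (p - 2) ≤ 2 * max ((1 - stepH p) * t) |x| ^ (p - 2) ∧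
      max ((1 - stepH p) * t) |x| ^ (p - 2) ≤ 2 * max t |x| ^ (p - 2) := by
  have hh := stepH_pos hp
  have hu := one_sub_stepH_pos hp
  have ht' := shrink_pos hp ht
  have hQ1 : 1 ≤ (1 - stepH p)⁻¹ := (one_le_inv₀ hu).2 (by linarith)
  have hQ : (1 - stepH p)⁻¹ ^ |p - 2| ≤ 2 := by
    calc (1 - stepH p)⁻¹ ^ |p - 2| ≤ (1 - stepH p)⁻¹ ^ p :=
          Real.rpow_le_rpow_of_exponent_le hQ1 (abs_le.2 ⟨by linarith, by linarith⟩)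
      _ = ((1 - stepH p) ^ p)⁻¹ := Real.inv_rpow hu.le _
      _ ≤ (1 / 2)⁻¹ := inv_anti₀ one_half_pos (half_le_one_sub_stepH_rpow hp)
      _ = 2 := by norm_num
  have hM : 0 < max t |x| := lt_max_of_lt_left ht
  have hM' : 0 < max ((1 - stepH p) * t) |x| := lt_max_of_lt_left ht'
  have hle : max t |x| ≤ (1 - stepH p)⁻¹ * max ((1 - stepH p) * t) |x| := by
    rw [mul_max_of_nonneg _ _ (inv_pos.2 hu).le, inv_mul_cancel_left₀ hu.ne']
    exact max_le_max le_rfl (le_mul_of_one_le_left (abs_nonneg x) hQ1)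
  have hle' : max ((1 - stepH p) * t) |x| ≤ (1 - stepH p)⁻¹ * max t |x| :=
    (max_le_max (by nlinarith) le_rfl).trans (le_mul_of_one_le_left hM.le hQ1)
  constructor
  · refine (rpow_le_rpow_abs_mul_rpow hM hM' (inv_pos.2 hu) (fun _ => hle) fun _ => hle').trans ?_
    gcongr
  · refine (rpow_le_rpow_abs_mul_rpow hM' hM (inv_pos.2 hu) (fun _ => hle') fun _ => hle).trans ?_
    gcongr

lemma smooth''_mem_Icc_weight (hp : 1 < p) (ht : 0 < t) (s : Fin n → ℝ) (i : Fin n) {x : ℝ}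
    (hx : |spow x (p / 2) - spow (s i) (p / 2)| ≤ radius p n t) :
    smooth'' p ((1 - stepH p) * t) x ∈ Icc (weight p t s i) (kappa p n * weight p t s i) := by
  have : 0 < p - 1 := sub_pos.2 hp
  obtain ⟨hlow, hup⟩ := smooth''_bounds hp (shrink_pos hp ht) x
  obtain ⟨hM, hM'⟩ := max_shrink_rpow_bounds hp ht x
  have : 0 ≤ max ((1 - stepH p) * t) |x| ^ (p - 2) := by
    have := shrink_pos hp ht
    positivity
  constructor
  · calc weight p t s i ≤ (p - 1) / 2 * max t |x| ^ (p - 2) := (weight_bounds hp ht s i hx).1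
      _ ≤ (p - 1) / 2 * (2 * max ((1 - stepH p) * t) |x| ^ (p - 2)) := by gcongr
      _ = (p - 1) * max ((1 - stepH p) * t) |x| ^ (p - 2) := by ring
      _ ≤ p * min 1 (p - 1) * max ((1 - stepH p) * t) |x| ^ (p - 2) := by
          gcongr
          rcases min_choice 1 (p - 1) with h | h <;> rw [h] <;> nlinarith
      _ ≤ _ := hlow
  · calc smooth'' p ((1 - stepH p) * t) x
        ≤ p * max 1 (p - 1) * max ((1 - stepH p) * t) |x| ^ (p - 2) := hup
      _ ≤ p * p * (2 * max t |x| ^ (p - 2)) := by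
          gcongr
          exact max_le hp.le (by linarith)
      _ = 2 * p ^ 2 * max t |x| ^ (p - 2) := by ring
      _ ≤ _ := max_rpow_le_kappa_mul_weight hp ht s i hx

lemma max_rpow_mul_abs_sub_le {r : ℝ} (hr : 1 / 2 ≤ r) (ht : 0 < t) (a b : ℝ) :
    max t (max |a| |b|) ^ (r - 1) * |a - b| ≤ 2 * max (t ^ r) |spow a r - spow b r| := by
  rcases le_total t (max |a| |b|) with h | h
  · rw [max_eq_right h]
    linarith [half_mul_abs_sub_le_abs_spow_sub hr a b, le_max_right (t ^ r) |spow a r - spow b r|]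
  · rw [max_eq_left h]
    have hab : |a - b| ≤ 2 * t := by
      linarith [abs_sub a b, (max_le_iff.1 h).1, (max_le_iff.1 h).2]
    calc t ^ (r - 1) * |a - b| ≤ t ^ (r - 1) * (2 * t) := by gcongr
      _ = 2 * t ^ r := by rw [mul_left_comm, rpow_sub_one_mul (by linarith) ht.le]
      _ ≤ _ := by gcongr; exact le_max_left _ _

lemma rpow_sub_one_le_four_mul_max {r T M : ℝ} (hr : 1 / 2 ≤ r) (hT : 0 < T) (hM : 0 < M)
    (h : T ^ r / 4 ≤ M ^ r) : M ^ (r - 1) ≤ 4 * max T M ^ (r - 1) := by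
  rcases le_total T M with hTM | hMT
  · rw [max_eq_right hTM]
    linarith [Real.rpow_nonneg hM.le (r - 1)]
  have hratio : 1 ≤ T / M := (one_le_div hM).2 hMT
  have : (T / M) ^ (1 - r) ≤ 4 := by
    calc (T / M) ^ (1 - r) ≤ (T / M) ^ r :=
          Real.rpow_le_rpow_of_exponent_le hratio (by linarith)
      _ = T ^ r / M ^ r := Real.div_rpow hT.le hM.le r
      _ ≤ 4 := (div_le_iff₀ (Real.rpow_pos_of_pos hM r)).2 (by linarith)
  rwa [max_eq_left hMT, ← div_le_iff₀ (Real.rpow_pos_of_pos hT _), ← Real.div_rpow hM.le hT.le,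
    ← inv_div T M, Real.inv_rpow (by positivity), ← Real.rpow_neg (by positivity), neg_sub]

lemma exists_max_abs_eq (t a b : ℝ) : ∃ y, (y = a ∨ y = b) ∧ max t (max |a| |b|) = max t |y| := by
  rcases max_choice |a| |b| with h | h
  · exact ⟨a, .inl rfl, by rw [h]⟩
  · exact ⟨b, .inr rfl, by rw [h]⟩

lemma weight_mul_sq_le (hp : 1 < p) (ht : 0 < t) (s : Fin n → ℝ) (i : Fin n) {x : ℝ}
    (hx : |spow x (p / 2) - spow (s i) (p / 2)| ≤ radius p n t) :
    weight p t s i * (s i - x) ^ 2 ≤ 2 * (p - 1) * radius p n t ^ 2 := by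
  have : 0 ≤ p - 1 := (sub_pos.2 hp).le
  have hM : 0 ≤ max t (max |s i| |x|) := ht.le.trans (le_max_left _ _)
  have hweight : weight p t s i ≤ (p - 1) / 2 * max t (max |s i| |x|) ^ (p - 2) := by
    obtain ⟨y, rfl | rfl, hy⟩ := exists_max_abs_eq t (s i) x <;> rw [hy]
    · exact (weight_bounds hp ht s i (by simpa using (radius_pos hp n ht).le)).1
    · exact (weight_bounds hp ht s i hx).1
  have hdist : max t (max |s i| |x|) ^ (p / 2 - 1) * |s i - x| ≤ 2 * radius p n t :=
    (max_rpow_mul_abs_sub_le (by linarith) ht (s i) x).trans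
      (by gcongr; exact max_le (rpow_le_radius hp n ht) (by rwa [abs_sub_comm]))
  calc weight p t s i * (s i - x) ^ 2
      ≤ (p - 1) / 2 * max t (max |s i| |x|) ^ (p - 2) * (s i - x) ^ 2 := by gcongr
    _ = (p - 1) / 2 * (max t (max |s i| |x|) ^ (p / 2 - 1) * |s i - x|) ^ 2 := by
        rw [mul_pow, rpow_half_sub_one_sq hM, sq_abs, mul_assoc]
    _ ≤ (p - 1) / 2 * (2 * radius p n t) ^ 2 := by gcongr
    _ = 2 * (p - 1) * radius p n t ^ 2 := by ring

lemma rpow_half_le_mul_abs_sub (hp : 1 < p) (ht : 0 < t) {a b : ℝ}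
    (hab : t ^ (p / 2) / 2 ≤ |spow a (p / 2) - spow b (p / 2)|) :
    t ^ (p / 2) ≤ 16 * p * (max t (max |a| |b|) ^ (p / 2 - 1) * |a - b|) := by
  have hr : p / 2 ≠ 0 := by positivity
  set M := max |a| |b|
  have hM : 0 < M := by
    by_contra h
    obtain ⟨ha, hb⟩ := max_le_iff.1 (not_lt.1 h)
    rw [abs_nonpos_iff.1 ha, abs_nonpos_iff.1 hb, sub_self, abs_zero] at hab
    linarith [Real.rpow_pos_of_pos ht (p / 2)]
  have hMr : t ^ (p / 2) / 4 ≤ M ^ (p / 2) := by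
    have htri := abs_sub (spow a (p / 2)) (spow b (p / 2))
    rw [abs_spow hr, abs_spow hr] at htri
    have : |a| ^ (p / 2) ≤ M ^ (p / 2) := by gcongr; exact le_max_left _ _
    have : |b| ^ (p / 2) ≤ M ^ (p / 2) := by gcongr; exact le_max_right _ _
    linarith
  have hM4 := rpow_sub_one_le_four_mul_max (by linarith) ht hM hMr
  calc t ^ (p / 2) ≤ 2 * |spow a (p / 2) - spow b (p / 2)| := by linarith
    _ ≤ 2 * (max 2 (p / 2) * M ^ (p / 2 - 1) * |a - b|) := by
        gcongr
        exact abs_spow_sub_le (by linarith) a b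
    _ ≤ 2 * ((2 * p) * (4 * max t M ^ (p / 2 - 1)) * |a - b|) := by
        gcongr
        exact max_le (by linarith) (by linarith)
    _ = 16 * p * (max t M ^ (p / 2 - 1) * |a - b|) := by ring

lemma rpow_le_kappa_mul_weight_mul_sq (hp : 1 < p) (ht : 0 < t) (s : Fin n → ℝ) (i : Fin n)
    {a b : ℝ} (ha : |spow a (p / 2) - spow (s i) (p / 2)| ≤ radius p n t)
    (hb : |spow b (p / 2) - spow (s i) (p / 2)| ≤ radius p n t)
    (hab : ((1 - stepH p) * t) ^ (p / 2) / 2 ≤ |spow a (p / 2) - spow b (p / 2)|) :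
    ((1 - stepH p) * t) ^ p ≤ 256 * (kappa p n * weight p t s i) * (a - b) ^ 2 := by
  have ht' := shrink_pos hp ht
  have hdist := rpow_half_le_mul_abs_sub hp ht' hab
  set t' := (1 - stepH p) * t
  set N := max t' (max |a| |b|)
  have hN : 0 ≤ N := ht'.le.trans (le_max_left _ _)
  have hcurv : p ^ 2 * N ^ (p - 2) ≤ kappa p n * weight p t s i := by
    obtain ⟨y, hy, hNy : N = max t' |y|⟩ := exists_max_abs_eq t' a b
    have hybox : |spow y (p / 2) - spow (s i) (p / 2)| ≤ radius p n t := by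
      rcases hy with rfl | rfl <;> assumption
    calc p ^ 2 * N ^ (p - 2) ≤ p ^ 2 * (2 * max t |y| ^ (p - 2)) := by
          rw [hNy]
          gcongr
          exact (max_shrink_rpow_bounds hp ht y).2
      _ = 2 * p ^ 2 * max t |y| ^ (p - 2) := by ring
      _ ≤ _ := max_rpow_le_kappa_mul_weight hp ht s i hybox
  calc t' ^ p = (t' ^ (p / 2)) ^ 2 := (rpow_half_sq ht'.le).symm
    _ ≤ (16 * p * (N ^ (p / 2 - 1) * |a - b|)) ^ 2 := by gcongr
    _ = 256 * (p ^ 2 * N ^ (p - 2)) * (a - b) ^ 2 := by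
        rw [mul_pow, mul_pow (N ^ _), rpow_half_sub_one_sq hN, sq_abs]
        ring
    _ ≤ _ := by gcongr

end Weights

/-! ### The pseudoinverse of a weighted Gram matrix -/

section Pinv

variable {n d : ℕ} {M : Matrix (Fin d) (Fin d) ℝ}

lemma isSelfAdjoint_of_transpose_eq (hM : Mᵀ = M) : IsSelfAdjoint M := by
  rw [isSelfAdjoint_iff, star_eq_conjTranspose, conjTranspose_eq_transpose_of_trivial, hM]

lemma transpose_cfc (f : ℝ → ℝ) (M : Matrix (Fin d) (Fin d) ℝ) : (cfc f M)ᵀ = cfc f M := by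
  rw [← conjTranspose_eq_transpose_of_trivial]
  exact cfc_predicate f M

lemma cfc_mul_cfc (f g : ℝ → ℝ) (M : Matrix (Fin d) (Fin d) ℝ) :
    cfc f M * cfc g M = cfc (fun x => f x * g x) M :=
  (cfc_mul f g M (M.finite_spectrum.continuousOn f) (M.finite_spectrum.continuousOn g)).symm

lemma pinv_mul_self (hM : Mᵀ = M) : pinv M * M = cfc (fun x : ℝ => x⁻¹ * x) M := by
  have := isSelfAdjoint_of_transpose_eq hM
  nth_rewrite 2 [← cfc_id' ℝ M]
  exact cfc_mul_cfc _ _ M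

lemma self_mul_pinv (hM : Mᵀ = M) : M * pinv M = pinv M * M := by
  have := isSelfAdjoint_of_transpose_eq hM
  rw [pinv_mul_self hM]
  nth_rewrite 1 [← cfc_id' ℝ M]
  rw [pinv, cfc_mul_cfc]
  simp only [mul_comm]

lemma pinv_mul_self_mul_pinv (hM : Mᵀ = M) : pinv M * M * pinv M = pinv M := by
  rw [pinv_mul_self hM, pinv, cfc_mul_cfc]
  congr 1
  ext x
  simpa only [inv_inv] using mul_inv_mul_cancel x⁻¹

lemma self_mul_pinv_mul_self (hM : Mᵀ = M) : M * pinv M * M = M := by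
  have := isSelfAdjoint_of_transpose_eq hM
  rw [self_mul_pinv hM, pinv_mul_self hM]
  nth_rewrite 2 [← cfc_id' ℝ M]
  rw [cfc_mul_cfc]
  simp only [inv_mul_mul_self]
  exact cfc_id' ℝ M

lemma pinvSqrt_mul_pinvSqrt (hM : M.PosSemidef) : pinvSqrt M * pinvSqrt M = pinv M := by
  rw [pinvSqrt, cfc_mul_cfc]
  refine cfc_congr fun x hx => Real.mul_self_sqrt (inv_nonneg.2 ?_)
  rw [hM.1.spectrum_real_eq_range_eigenvalues] at hx
  obtain ⟨i, rfl⟩ := hx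
  exact hM.eigenvalues_nonneg i

lemma transpose_mulVec_dotProduct {k l : ℕ} (B : Matrix (Fin k) (Fin l) ℝ) (u : Fin k → ℝ)
    (v : Fin l → ℝ) : (Bᵀ *ᵥ u) ⬝ᵥ v = u ⬝ᵥ (B *ᵥ v) := by
  rw [mulVec_transpose, dotProduct_mulVec]

section KerOrth

variable {A : Matrix (Fin n) (Fin d) ℝ} {v w : Fin d → ℝ}

lemma kerOrth_transpose_mulVec (u : Fin n → ℝ) : KerOrth A (Aᵀ *ᵥ u) := fun w hw => by
  rw [transpose_mulVec_dotProduct, hw, dotProduct_zero]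

lemma KerOrth.add (hv : KerOrth A v) (hw : KerOrth A w) : KerOrth A (v + w) := fun u hu => by
  rw [add_dotProduct, hv u hu, hw u hu, add_zero]

lemma KerOrth.sub (hv : KerOrth A v) (hw : KerOrth A w) : KerOrth A (v - w) := fun u hu => by
  rw [sub_dotProduct, hv u hu, hw u hu, sub_zero]

lemma KerOrth.smul (a : ℝ) (hv : KerOrth A v) : KerOrth A (a • v) := fun u hu => by
  rw [smul_dotProduct, hv u hu, smul_zero]

lemma KerOrth.eq_of_mulVec_eq (hv : KerOrth A v) (hw : KerOrth A w) (h : A *ᵥ v = A *ᵥ w) :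
    v = w := by
  have := hv.sub hw (v - w) (by rw [mulVec_sub, h, sub_self])
  exact sub_eq_zero.1 (dotProduct_self_eq_zero.1 this)

end KerOrth

/-- The weighted Gram matrix `Aᵀ D A`, where `D` is the diagonal matrix with diagonal `D`; the
matrix `gram` is the case where the weights are those of a phase. -/
def weightedGram (A : Matrix (Fin n) (Fin d) ℝ) (D : Fin n → ℝ) : Matrix (Fin d) (Fin d) ℝ :=
  Aᵀ * diagonal D * A

lemma weightedGram_one (A : Matrix (Fin n) (Fin d) ℝ) : weightedGram A 1 = Aᵀ * A := by
  rw [weightedGram, diagonal_one', Matrix.mul_one]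

lemma transpose_weightedGram (A : Matrix (Fin n) (Fin d) ℝ) (D : Fin n → ℝ) :
    (weightedGram A D)ᵀ = weightedGram A D := by
  simp only [weightedGram, transpose_mul, diagonal_transpose, transpose_transpose, Matrix.mul_assoc]

lemma dotProduct_weightedGram_mulVec (A : Matrix (Fin n) (Fin d) ℝ) (D : Fin n → ℝ)
    (v : Fin d → ℝ) :
    v ⬝ᵥ (weightedGram A D *ᵥ v) = ∑ i, D i * (A *ᵥ v) i ^ 2 := by
  rw [weightedGram, ← mulVec_mulVec, ← mulVec_mulVec, dotProduct_comm, transpose_mulVec_dotProduct]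
  refine Finset.sum_congr rfl fun i _ => ?_
  rw [mulVec_diagonal]
  ring

variable {A : Matrix (Fin n) (Fin d) ℝ} {D : Fin n → ℝ}

lemma posSemidef_weightedGram (hD : ∀ i, 0 ≤ D i) : (weightedGram A D).PosSemidef := by
  refine PosSemidef.of_dotProduct_mulVec_nonneg
    (isSelfAdjoint_of_transpose_eq (transpose_weightedGram A D)) fun x => ?_
  rw [star_trivial, dotProduct_weightedGram_mulVec]
  exact Finset.sum_nonneg fun i _ => mul_nonneg (hD i) (sq_nonneg _)

lemma mulVec_eq_zero_of_weightedGram_mulVec_eq_zero (hD : ∀ i, 0 < D i) {v : Fin d → ℝ}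
    (h : weightedGram A D *ᵥ v = 0) : A *ᵥ v = 0 := by
  have h0 := dotProduct_weightedGram_mulVec A D v
  rw [h, dotProduct_zero, eq_comm, Finset.sum_eq_zero_iff_of_nonneg
    fun i _ => mul_nonneg (hD i).le (sq_nonneg _)] at h0
  ext i
  simpa [(hD i).ne'] using h0 i (Finset.mem_univ i)

lemma kerOrth_pinv_mulVec (w : Fin d → ℝ) : KerOrth A (pinv (weightedGram A D) *ᵥ w) := by
  have hM := transpose_weightedGram A D
  have : pinv (weightedGram A D) *ᵥ w =
      Aᵀ *ᵥ ((diagonal D * A * pinv (weightedGram A D) * pinv (weightedGram A D)) *ᵥ w) := by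
    nth_rewrite 1 [← pinv_mul_self_mul_pinv hM, ← self_mul_pinv hM]
    nth_rewrite 1 [weightedGram]
    simp only [mulVec_mulVec, Matrix.mul_assoc]
  rw [this]
  exact kerOrth_transpose_mulVec _

lemma pinv_mulVec_weightedGram_mulVec (hD : ∀ i, 0 < D i) {x : Fin d → ℝ} (hx : KerOrth A x) :
    pinv (weightedGram A D) *ᵥ (weightedGram A D *ᵥ x) = x := by
  refine (kerOrth_pinv_mulVec _).eq_of_mulVec_eq hx (sub_eq_zero.1 ?_)
  rw [← mulVec_sub]
  refine mulVec_eq_zero_of_weightedGram_mulVec_eq_zero hD ?_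
  rw [mulVec_sub, mulVec_mulVec, mulVec_mulVec,
    self_mul_pinv_mul_self (transpose_weightedGram A D), sub_self]

lemma weightedGram_mulVec_pinv_mulVec (hD : ∀ i, 0 < D i) {x : Fin d → ℝ} (hx : KerOrth A x) :
    weightedGram A D *ᵥ (pinv (weightedGram A D) *ᵥ x) = x := by
  rw [mulVec_mulVec, self_mul_pinv (transpose_weightedGram A D), ← mulVec_mulVec,
    pinv_mulVec_weightedGram_mulVec hD hx]

end Pinv

/-! ### The preconditioned variable -/

section Precond

variable {n d m : ℕ} {A : Matrix (Fin n) (Fin d) ℝ} {b : Fin n → ℝ} {p t : ℝ} {x : Fin d → ℝ}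
  {P : Matrix (Fin d) (Fin m) ℝ} {D : Fin n → ℝ}

lemma precond_mul_transpose (hp : 1 < p) (ht : 0 < t) :
    precond A b p t x * (precond A b p t x)ᵀ = pinv (gram A b p t x) := by
  rw [precond, pinvSqrt, transpose_cfc]
  exact pinvSqrt_mul_pinvSqrt (posSemidef_weightedGram fun i => (weight_pos hp ht _ i).le)

lemma precond'_mul_transpose (hp : 1 < p) (ht : 0 < t) :
    precond' A b p t x * (precond' A b p t x)ᵀ = pinv (gram A b p t x) := by
  have hsqrt : diagonal (fun i => √(weight p t (residual A b x) i)) *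
      diagonal (fun i => √(weight p t (residual A b x) i)) =
      diagonal (weight p t (residual A b x)) := by
    rw [diagonal_mul_diagonal]
    exact congrArg _ (funext fun i => Real.mul_self_sqrt (weight_pos hp ht _ i).le)
  have hpinv : (pinv (gram A b p t x))ᵀ = pinv (gram A b p t x) := transpose_cfc _ _
  calc precond' A b p t x * (precond' A b p t x)ᵀ
      = pinv (gram A b p t x) * (Aᵀ * (diagonal (fun i => √(weight p t (residual A b x) i)) *
          diagonal (fun i => √(weight p t (residual A b x) i))) * A) * pinv (gram A b p t x) := by
        simp only [precond', transpose_mul, hpinv, transpose_transpose, diagonal_transpose,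
          Matrix.mul_assoc]
    _ = pinv (gram A b p t x) := by
        rw [hsqrt]
        exact pinv_mul_self_mul_pinv (transpose_weightedGram _ _)

/-- The range of `Pᵀ`. The iterates of accelerated gradient descent stay in it, and on it the
Euclidean norm is the norm of the residuals weighted by `D`. -/
def iterSpace (P : Matrix (Fin d) (Fin m) ℝ) : Submodule ℝ (EuclideanSpace ℝ (Fin m)) :=
  LinearMap.range ((WithLp.linearEquiv 2 ℝ (Fin m → ℝ)).symm.toLinearMap ∘ₗ Pᵀ.mulVecLin)

lemma toLp_transpose_mulVec_mem_iterSpace (w : Fin d → ℝ) :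
    WithLp.toLp 2 (Pᵀ *ᵥ w) ∈ iterSpace P :=
  ⟨w, rfl⟩

lemma kerOrth_mulVec_of_mem_iterSpace (hP : P * Pᵀ = pinv (weightedGram A D))
    {y : EuclideanSpace ℝ (Fin m)} (hy : y ∈ iterSpace P) : KerOrth A (P *ᵥ y.ofLp) := by
  obtain ⟨w, rfl⟩ := hy
  change KerOrth A (P *ᵥ (Pᵀ *ᵥ w))
  rw [mulVec_mulVec, hP]
  exact kerOrth_pinv_mulVec w

lemma norm_sq_of_mem_iterSpace (hP : P * Pᵀ = pinv (weightedGram A D))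
    {y : EuclideanSpace ℝ (Fin m)} (hy : y ∈ iterSpace P) :
    ‖y‖ ^ 2 = ∑ i, D i * (A *ᵥ (P *ᵥ y.ofLp)) i ^ 2 := by
  obtain ⟨w, rfl⟩ := hy
  set M := weightedGram A D
  have hsymm : (pinv M)ᵀ = pinv M := transpose_cfc _ _
  have hnorm : ‖WithLp.toLp 2 (Pᵀ *ᵥ w)‖ ^ 2 = (Pᵀ *ᵥ w) ⬝ᵥ (Pᵀ *ᵥ w) := by
    rw [EuclideanSpace.real_norm_sq_eq]
    simp only [dotProduct, sq]
  calc ‖WithLp.toLp 2 (Pᵀ *ᵥ w)‖ ^ 2 = w ⬝ᵥ (pinv M *ᵥ w) := by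
        rw [hnorm, transpose_mulVec_dotProduct, mulVec_mulVec, hP]
    _ = ((pinv M)ᵀ *ᵥ w) ⬝ᵥ (M *ᵥ (pinv M *ᵥ w)) := by
        rw [transpose_mulVec_dotProduct, mulVec_mulVec, mulVec_mulVec,
          pinv_mul_self_mul_pinv (transpose_weightedGram A D)]
    _ = (P *ᵥ (Pᵀ *ᵥ w)) ⬝ᵥ (M *ᵥ (P *ᵥ (Pᵀ *ᵥ w))) := by
        rw [hsymm, mulVec_mulVec w P, hP]
    _ = _ := dotProduct_weightedGram_mulVec A D _

lemma mulVec_sub_ofLp_apply (A : Matrix (Fin n) (Fin d) ℝ) (b : Fin n → ℝ)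
    (P : Matrix (Fin d) (Fin m) ℝ) (u z : EuclideanSpace ℝ (Fin m)) (i : Fin n) :
    (A *ᵥ (P *ᵥ (u - z).ofLp)) i =
      residual A b (P *ᵥ u.ofLp) i - residual A b (P *ᵥ z.ofLp) i := by
  simp only [residual, WithLp.ofLp_sub, mulVec_sub, Pi.sub_apply, sub_sub_sub_cancel_right]

lemma norm_sub_sq_of_mem_iterSpace (b : Fin n → ℝ) (hP : P * Pᵀ = pinv (weightedGram A D))
    {u z : EuclideanSpace ℝ (Fin m)} (hu : u ∈ iterSpace P) (hz : z ∈ iterSpace P) :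
    ‖u - z‖ ^ 2 =
      ∑ i, D i * (residual A b (P *ᵥ u.ofLp) i - residual A b (P *ᵥ z.ofLp) i) ^ 2 := by
  simp only [norm_sq_of_mem_iterSpace hP ((iterSpace P).sub_mem hu hz),
    mulVec_sub_ofLp_apply A b P]

lemma mulVec_transpose_mulVec_weightedGram (hD : ∀ i, 0 < D i)
    (hP : P * Pᵀ = pinv (weightedGram A D)) (hx : KerOrth A x) :
    P *ᵥ (Pᵀ *ᵥ (weightedGram A D *ᵥ x)) = x := by
  rw [mulVec_mulVec, hP, pinv_mulVec_weightedGram_mulVec hD hx]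

lemma hasGradientAt_dotProduct_add_sum (A : Matrix (Fin n) (Fin d) ℝ) (b : Fin n → ℝ)
    (c : Fin d → ℝ) (P : Matrix (Fin d) (Fin m) ℝ) {F F' : Fin n → ℝ → ℝ}
    (hF : ∀ i s, HasDerivAt (F i) (F' i s) s) (y : EuclideanSpace ℝ (Fin m)) :
    HasGradientAt
      (fun y : EuclideanSpace ℝ (Fin m) =>
        c ⬝ᵥ (P *ᵥ y.ofLp) + ∑ i, F i (residual A b (P *ᵥ y.ofLp) i))
      (WithLp.toLp 2 (Pᵀ *ᵥ (c + Aᵀ *ᵥ fun i => F' i (residual A b (P *ᵥ y.ofLp) i)))) y := by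
  let mulP : EuclideanSpace ℝ (Fin m) →ₗ[ℝ] (Fin d → ℝ) :=
    P.mulVecLin ∘ₗ (WithLp.linearEquiv 2 ℝ (Fin m → ℝ)).toLinearMap
  let cost := ((dotProductBilin ℝ ℝ c).comp mulP).toContinuousLinearMap
  let row (i : Fin n) := (LinearMap.proj i ∘ₗ A.mulVecLin ∘ₗ mulP).toContinuousLinearMap
  have hrow (i : Fin n) : HasFDerivAt
      (fun y : EuclideanSpace ℝ (Fin m) => F i (residual A b (P *ᵥ y.ofLp) i))
      (F' i (residual A b (P *ᵥ y.ofLp) i) • row i) y :=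
    (hF i _).comp_hasFDerivAt y ((row i).hasFDerivAt.sub_const (b i))
  rw [hasGradientAt_iff_hasFDerivAt]
  refine HasFDerivAt.congr_fderiv
    (cost.hasFDerivAt.add (HasFDerivAt.fun_sum (u := Finset.univ) fun i _ => hrow i)) ?_
  ext v
  have hcost : cost v = c ⬝ᵥ (P *ᵥ v.ofLp) := rfl
  have hrowv (i : Fin n) : row i v = (A *ᵥ (P *ᵥ v.ofLp)) i := rfl
  simp only [_root_.add_apply, _root_.sum_apply, _root_.smul_apply, hcost, hrowv, smul_eq_mul,
    InnerProductSpace.toDual_apply_apply]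
  rw [EuclideanSpace.inner_eq_star_dotProduct, star_trivial, dotProduct_comm v.ofLp,
    transpose_mulVec_dotProduct, add_dotProduct, transpose_mulVec_dotProduct]
  rfl

lemma quadratic_bounds_dotProduct_add_sum (b : Fin n → ℝ) (c : Fin d → ℝ)
    (hP : P * Pᵀ = pinv (weightedGram A D)) {F F' : Fin n → ℝ → ℝ} {κ : ℝ}
    (hF : ∀ i s, HasDerivAt (F i) (F' i s) s)
    (hF' : ∀ i, SlopesIn (D i) (κ * D i) (F' i) univ) {g : EuclideanSpace ℝ (Fin m) → ℝ}
    (hg : g = fun y => c ⬝ᵥ (P *ᵥ y.ofLp) + ∑ i, F i (residual A b (P *ᵥ y.ofLp) i))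
    {z u : EuclideanSpace ℝ (Fin m)} (hz : z ∈ iterSpace P) (hu : u ∈ iterSpace P) :
    g z + inner ℝ (gradient g z) (u - z) + 1 / 2 * ‖u - z‖ ^ 2 ≤ g u ∧
      g u ≤ g z + inner ℝ (gradient g z) (u - z) + κ / 2 * ‖u - z‖ ^ 2 := by
  have hinner : inner ℝ (gradient g z) (u - z) = c ⬝ᵥ (P *ᵥ u.ofLp) - c ⬝ᵥ (P *ᵥ z.ofLp) +
      ∑ i, F' i (residual A b (P *ᵥ z.ofLp) i) *
        (residual A b (P *ᵥ u.ofLp) i - residual A b (P *ᵥ z.ofLp) i) := by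
    rw [hg, (hasGradientAt_dotProduct_add_sum A b c P hF z).gradient,
      EuclideanSpace.inner_eq_star_dotProduct, star_trivial, dotProduct_comm (u - z).ofLp,
      transpose_mulVec_dotProduct, add_dotProduct, transpose_mulVec_dotProduct,
      ← dotProduct_sub, ← mulVec_sub]
    simp only [← mulVec_sub_ofLp_apply A b P]
    rfl
  have hnorm (a : ℝ) : a / 2 * ‖u - z‖ ^ 2 = ∑ i, a * D i / 2 *
      (residual A b (P *ᵥ u.ofLp) i - residual A b (P *ᵥ z.ofLp) i) ^ 2 := by
    rw [norm_sub_sq_of_mem_iterSpace b hP hu hz, Finset.mul_sum]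
    exact Finset.sum_congr rfl fun i _ => by ring
  have hbounds (i : Fin n) := (hF' i).quadratic_bounds (hF i)
    (residual A b (P *ᵥ z.ofLp) i) (residual A b (P *ᵥ u.ofLp) i)
  have hlow := Finset.sum_le_sum fun i (_ : i ∈ Finset.univ) => (hbounds i).1
  have hup := Finset.sum_le_sum fun i (_ : i ∈ Finset.univ) => (hbounds i).2
  simp only [Finset.sum_add_distrib] at hlow hup
  rw [hinner, hnorm, hnorm, hg]
  simp only [one_mul]
  constructor <;> linarith

end Precond

/-! ### The homotopy path -/

section Path

variable {n d : ℕ} {A : Matrix (Fin n) (Fin d) ℝ} {b : Fin n → ℝ} {c : Fin d → ℝ} {p t : ℝ}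
  {x x' : Fin d → ℝ}

/-- The gradient `f_t'(s(x))` of the smoothed loss with respect to the residuals. -/
def smoothGrad (A : Matrix (Fin n) (Fin d) ℝ) (b : Fin n → ℝ) (p t : ℝ) (x : Fin d → ℝ)
    (i : Fin n) : ℝ :=
  smooth' p t (residual A b x i)

lemma residual_sub_residual (x x' : Fin d → ℝ) (i : Fin n) :
    residual A b x' i - residual A b x i = (A *ᵥ (x' - x)) i := by
  simp [residual, mulVec_sub]

lemma smoothObjective_le_of_stationary (hp : 1 < p) (ht : 0 < t)
    (h : c + Aᵀ *ᵥ smoothGrad A b p t x = 0) (x' : Fin d → ℝ) :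
    smoothObjective A b c p t x ≤ smoothObjective A b c p t x' := by
  have hlin : smoothGrad A b p t x ⬝ᵥ (A *ᵥ (x' - x)) = -(c ⬝ᵥ (x' - x)) := by
    rw [← transpose_mulVec_dotProduct, eq_neg_of_add_eq_zero_right h, neg_dotProduct]
  have hsum := Finset.sum_le_sum fun i (_ : i ∈ Finset.univ) =>
    smooth_add_le hp ht (residual A b x i) (residual A b x' i)
  simp only [residual_sub_residual, Finset.sum_add_distrib] at hsum
  change _ + smoothGrad A b p t x ⬝ᵥ (A *ᵥ (x' - x)) ≤ _ at hsum
  rw [hlin, dotProduct_sub] at hsum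
  unfold smoothObjective
  linarith

lemma hasDerivAt_smoothObjective_add_smul (hp : 1 < p) (ht : 0 < t) (A : Matrix (Fin n) (Fin d) ℝ)
    (b : Fin n → ℝ) (c x v : Fin d → ℝ) :
    HasDerivAt (fun ε : ℝ => smoothObjective A b c p t (x + ε • v))
      ((c + Aᵀ *ᵥ smoothGrad A b p t x) ⬝ᵥ v) 0 := by
  have hline : ∀ α β : ℝ, HasDerivAt (fun ε : ℝ => α + ε * β) β 0 := fun α β => by
    simpa using ((hasDerivAt_id (0 : ℝ)).mul_const β).const_add α
  have hcost : (fun ε : ℝ => c ⬝ᵥ (x + ε • v)) = fun ε => c ⬝ᵥ x + ε * (c ⬝ᵥ v) := by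
    simp only [dotProduct_add, dotProduct_smul, smul_eq_mul]
  have hres : ∀ i, (fun ε : ℝ => residual A b (x + ε • v) i) =
      fun ε => residual A b x i + ε * (A *ᵥ v) i := fun i => by
    ext ε
    simp [residual, mulVec_add, mulVec_smul]
    ring
  rw [add_dotProduct, transpose_mulVec_dotProduct]
  refine HasDerivAt.add (hcost ▸ hline _ _) (HasDerivAt.fun_sum fun i _ => ?_)
  have hcomp := (hasDerivAt_smooth hp ht (residual A b (x + (0 : ℝ) • v) i)).comp 0
    (hres i ▸ hline _ _)
  rwa [zero_smul, add_zero] at hcomp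

lemma isPathPoint_iff (hp : 1 < p) (ht : 0 < t) (hc : KerOrth A c) :
    IsPathPoint A b c p t x ↔ KerOrth A x ∧ c + Aᵀ *ᵥ smoothGrad A b p t x = 0 := by
  refine ⟨fun ⟨hx, hmin⟩ => ⟨hx, ?_⟩, fun ⟨hx, h⟩ =>
    ⟨hx, fun x' _ => smoothObjective_le_of_stationary hp ht h x'⟩⟩
  set v := c + Aᵀ *ᵥ smoothGrad A b p t x
  have hloc : IsLocalMin (fun ε : ℝ => smoothObjective A b c p t (x + ε • v)) 0 :=
    Filter.Eventually.of_forall fun ε => by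
      have hv : KerOrth A v := hc.add (kerOrth_transpose_mulVec _)
      simpa using hmin _ (hx.add (hv.smul ε))
  exact dotProduct_self_eq_zero.1
    (hloc.hasDerivAt_eq_zero (hasDerivAt_smoothObjective_add_smul hp ht A b c x v))

lemma sum_smooth'_sub_mul_residual_sub {t' : ℝ}
    (h : c + Aᵀ *ᵥ smoothGrad A b p t x = 0) (h' : c + Aᵀ *ᵥ smoothGrad A b p t' x' = 0) :
    ∑ i, (smooth' p t' (residual A b x' i) - smooth' p t (residual A b x i)) *
      (residual A b x' i - residual A b x i) = 0 := by
  simp only [residual_sub_residual]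
  change (smoothGrad A b p t' x' - smoothGrad A b p t x) ⬝ᵥ (A *ᵥ (x' - x)) = 0
  rw [← transpose_mulVec_dotProduct, mulVec_sub, eq_neg_of_add_eq_zero_right h,
    eq_neg_of_add_eq_zero_right h', sub_self, zero_dotProduct]

lemma IsPathPoint.unique (hp : 1 < p) (ht : 0 < t) (hc : KerOrth A c)
    (hx : IsPathPoint A b c p t x) (hx' : IsPathPoint A b c p t x') : x = x' := by
  obtain ⟨hk, h⟩ := (isPathPoint_iff hp ht hc).1 hx
  obtain ⟨hk', h'⟩ := (isPathPoint_iff hp ht hc).1 hx'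
  have hnonneg : ∀ u v : ℝ, 0 ≤ (smooth' p t v - smooth' p t u) * (v - u) := fun u v => by
    have hmono := (smooth'_strictMono hp ht).monotone
    rcases le_total u v with huv | huv
    · exact mul_nonneg (sub_nonneg.2 (hmono huv)) (sub_nonneg.2 huv)
    · exact mul_nonneg_of_nonpos_of_nonpos (sub_nonpos.2 (hmono huv)) (sub_nonpos.2 huv)
  have hzero := (Finset.sum_eq_zero_iff_of_nonneg fun i _ => hnonneg _ _).1
    (sum_smooth'_sub_mul_residual_sub h h')
  refine hk.eq_of_mulVec_eq hk' (funext fun i => ?_)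
  have hres : residual A b x' i = residual A b x i := by
    rcases mul_eq_zero.1 (hzero i (Finset.mem_univ i)) with h0 | h0
    · exact (smooth'_strictMono hp ht).injective (sub_eq_zero.1 h0)
    · exact sub_eq_zero.1 h0
  simpa [residual, eq_comm] using hres

lemma KerOrth.exists_eq_transpose_mulVec (hc : KerOrth A c) : ∃ u, c = Aᵀ *ᵥ u := by
  refine ⟨A *ᵥ (pinv (weightedGram A 1) *ᵥ c), ?_⟩
  rw [mulVec_mulVec, ← weightedGram_one,
    weightedGram_mulVec_pinv_mulVec (D := 1) (fun _ => one_pos) hc]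

lemma exists_kerOrth_mulVec_eq (A : Matrix (Fin n) (Fin d) ℝ) (x : Fin d → ℝ) :
    ∃ x', KerOrth A x' ∧ A *ᵥ x' = A *ᵥ x := by
  refine ⟨pinv (weightedGram A 1) *ᵥ (weightedGram A 1 *ᵥ x), kerOrth_pinv_mulVec _, ?_⟩
  rw [← sub_eq_zero, ← mulVec_sub]
  refine mulVec_eq_zero_of_weightedGram_mulVec_eq_zero (D := 1) (fun _ => one_pos) ?_
  rw [mulVec_sub, mulVec_mulVec, mulVec_mulVec,
    self_mul_pinv_mul_self (transpose_weightedGram A 1), sub_self]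

lemma exists_mul_abs_sub_le_smooth (hp : 1 < p) (ht : 0 < t) (K : ℝ) :
    ∃ B, ∀ s, K * |s| - B ≤ smooth p t s := by
  obtain ⟨a, hta, hKa⟩ : ∃ a, t ≤ a ∧ K ≤ p * a ^ (p - 1) := by
    have hlim := (tendsto_rpow_atTop (sub_pos.2 hp)).const_mul_atTop (zero_lt_one.trans hp)
    exact ((Filter.eventually_ge_atTop t).and (hlim.eventually_ge_atTop K)).exists
  have ha : 0 < a := ht.trans_le hta
  have hslope : smooth' p t a = p * a ^ (p - 1) := by
    rw [smooth'_of_le (by rwa [abs_of_pos ha]), abs_of_pos ha, mul_assoc,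
      show p - 2 = p - 1 - 1 by ring, rpow_sub_one_mul (by linarith) ha.le]
  refine ⟨smooth' p t a * a - smooth p t a, fun s => ?_⟩
  have heven : smooth p t |s| = smooth p t s := by simp [smooth]
  have htangent := smooth_add_le hp ht a |s|
  have hK := mul_le_mul_of_nonneg_right (hslope ▸ hKa) (abs_nonneg s)
  linarith

lemma exists_abs_sub_le_mul_add_smooth (hp : 1 < p) (ht : 0 < t) (k w : ℝ) :
    ∃ B, ∀ u, |u| - B ≤ k * u + smooth p t (u - w) := by
  obtain ⟨B, hB⟩ := exists_mul_abs_sub_le_smooth hp ht (1 + |k|)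
  refine ⟨B + (1 + |k|) * |w|, fun u => ?_⟩
  have hu : |u| ≤ |u - w| + |w| := by simpa using abs_add_le (u - w) w
  have hlin : -(|k| * |u|) ≤ k * u := abs_mul k u ▸ neg_abs_le _
  have hmul : (1 + |k|) * |u| ≤ (1 + |k|) * (|u - w| + |w|) := by gcongr
  linarith [hB (u - w)]

lemma exists_norm_sub_le_sum {ι : Type*} [Fintype ι] {f : ι → ℝ → ℝ}
    (h : ∀ i, ∃ B, ∀ u, |u| - B ≤ f i u) : ∃ B, ∀ u : ι → ℝ, ‖u‖ - B ≤ ∑ i, f i (u i) := by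
  choose B hB using h
  refine ⟨∑ i, B i, fun u => ?_⟩
  have hnorm : ‖u‖ ≤ ∑ i, |u i| :=
    (pi_norm_le_iff_of_nonneg (Finset.sum_nonneg fun _ _ => abs_nonneg _)).2 fun i =>
      Finset.single_le_sum (f := fun i => |u i|) (fun _ _ => abs_nonneg _) (Finset.mem_univ i)
  have hsum := Finset.sum_le_sum fun i (_ : i ∈ Finset.univ) => hB i (u i)
  rw [Finset.sum_sub_distrib] at hsum
  linarith

lemma exists_forall_mulVec_le {Φ : (Fin n → ℝ) → ℝ} (hΦ : Continuous Φ)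
    (hB : ∃ B, ∀ u, ‖u‖ - B ≤ Φ u) (A : Matrix (Fin n) (Fin d) ℝ) :
    ∃ x, ∀ x', Φ (A *ᵥ x) ≤ Φ (A *ᵥ x') := by
  obtain ⟨B, hB⟩ := hB
  have hlim : Filter.Tendsto Φ (Filter.cocompact (Fin n → ℝ)) Filter.atTop :=
    Filter.tendsto_atTop_mono hB
      (Filter.tendsto_atTop_add_const_right _ (-B) tendsto_norm_cocompact_atTop)
  obtain ⟨-, ⟨x, rfl⟩, hmin⟩ := hΦ.continuousOn.exists_isMinOn'
    (Submodule.closed_of_finiteDimensional (LinearMap.range A.mulVecLin))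
    (zero_mem (LinearMap.range A.mulVecLin))
    ((hlim.eventually_ge_atTop (Φ 0)).filter_mono inf_le_left)
  exact ⟨x, fun x' => hmin ⟨x', rfl⟩⟩

lemma exists_isPathPoint (hp : 1 < p) (ht : 0 < t) (A : Matrix (Fin n) (Fin d) ℝ) (b : Fin n → ℝ)
    (hc : KerOrth A c) : ∃ x, IsPathPoint A b c p t x := by
  obtain ⟨k, rfl⟩ := hc.exists_eq_transpose_mulVec
  set Φ : (Fin n → ℝ) → ℝ := fun u => ∑ i, (k i * u i + smooth p t (u i - b i))
  have hobj : ∀ x, smoothObjective A b (Aᵀ *ᵥ k) p t x = Φ (A *ᵥ x) := fun x => by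
    simp only [Φ, Finset.sum_add_distrib, smoothObjective, transpose_mulVec_dotProduct]
    rfl
  have hΦ : Continuous Φ := by
    have := continuous_smooth hp ht
    fun_prop
  obtain ⟨x, hx⟩ := exists_forall_mulVec_le hΦ
    (exists_norm_sub_le_sum fun i => exists_abs_sub_le_mul_add_smooth hp ht (k i) (b i)) A
  obtain ⟨y, hy, hAy⟩ := exists_kerOrth_mulVec_eq A x
  exact ⟨y, hy, fun z _ => by rw [hobj, hobj, hAy]; exact hx z⟩

/-! ### The initial point -/

lemma transpose_mulVec_mulVec_pinv_mulVec {w : Fin d → ℝ} (hw : KerOrth A w) :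
    Aᵀ *ᵥ (A *ᵥ (pinv (Aᵀ * A) *ᵥ w)) = w := by
  rw [mulVec_mulVec, ← weightedGram_one,
    weightedGram_mulVec_pinv_mulVec (D := 1) (fun _ => one_pos) hw]

lemma sq_le_dotProduct_self (v : Fin n → ℝ) (i : Fin n) : v i ^ 2 ≤ v ⬝ᵥ v := by
  rw [pow_two]
  exact Finset.single_le_sum (f := fun i => v i * v i) (fun i _ => mul_self_nonneg _)
    (Finset.mem_univ i)

lemma abs_residual_leastSquares_le (A : Matrix (Fin n) (Fin d) ℝ) (b : Fin n → ℝ) (i : Fin n) :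
    |residual A b (pinv (Aᵀ * A) *ᵥ (Aᵀ *ᵥ b)) i| ≤ ‖WithLp.toLp 2 b‖ := by
  set a := A *ᵥ (pinv (Aᵀ * A) *ᵥ (Aᵀ *ᵥ b))
  change |(a - b) i| ≤ _
  have horth : (a - b) ⬝ᵥ a = 0 := by
    rw [← transpose_mulVec_dotProduct, mulVec_sub,
      transpose_mulVec_mulVec_pinv_mulVec (kerOrth_transpose_mulVec b), sub_self, zero_dotProduct]
  have hpythagoras : b ⬝ᵥ b = a ⬝ᵥ a + (a - b) ⬝ᵥ (a - b) := by
    simp only [sub_dotProduct, dotProduct_sub, dotProduct_comm b a] at horth ⊢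
    linarith
  have hnorm : ‖WithLp.toLp 2 b‖ ^ 2 = b ⬝ᵥ b := by
    simp [EuclideanSpace.norm_sq_eq, dotProduct, ← pow_two]
  have ha : 0 ≤ a ⬝ᵥ a := Finset.sum_nonneg fun i _ => mul_self_nonneg _
  refine abs_le_of_sq_le_sq ?_ (norm_nonneg _)
  linarith [sq_le_dotProduct_self (a - b) i]

lemma costEnergy_eq (hc : KerOrth A c) :
    costEnergy A c = (A *ᵥ (pinv (Aᵀ * A) *ᵥ c)) ⬝ᵥ (A *ᵥ (pinv (Aᵀ * A) *ᵥ c)) := by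
  rw [← transpose_mulVec_dotProduct, transpose_mulVec_mulVec_pinv_mulVec hc]
  rfl

lemma costEnergy_nonneg (hc : KerOrth A c) : 0 ≤ costEnergy A c :=
  costEnergy_eq hc ▸ Finset.sum_nonneg fun _ _ => mul_self_nonneg _

lemma isPathPoint_initialPoint (hp : 1 < p) (ht : 0 < t) (hc : KerOrth A c)
    (hb : 2 * ‖WithLp.toLp 2 b‖ ≤ t)
    (hE : 1 / p * t ^ (2 - p) * √(costEnergy A c) ≤ t / 2) :
    IsPathPoint A b c p t (initialPoint A b c p t) := by
  set e := residual A b (pinv (Aᵀ * A) *ᵥ (Aᵀ *ᵥ b))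
  set v := A *ᵥ (pinv (Aᵀ * A) *ᵥ c)
  set k := 1 / p * t ^ (2 - p)
  have hk : 0 < k := by positivity
  have hres : residual A b (initialPoint A b c p t) = e - k • v := by
    simp only [residual, initialPoint, mulVec_sub, mulVec_smul, e, v, k]
    abel
  have hquad : ∀ i, |(e - k • v) i| ≤ t := fun i => by
    have he : |e i| ≤ ‖WithLp.toLp 2 b‖ := abs_residual_leastSquares_le A b i
    have hv : |v i| ≤ √(costEnergy A c) :=
      Real.abs_le_sqrt (costEnergy_eq hc ▸ sq_le_dotProduct_self v i)
    calc |(e - k • v) i| ≤ |e i| + |k * v i| := abs_sub _ _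
      _ = |e i| + k * |v i| := by rw [abs_mul, abs_of_pos hk]
      _ ≤ ‖WithLp.toLp 2 b‖ + k * √(costEnergy A c) := by gcongr
      _ ≤ t := by linarith
  have hgrad : smoothGrad A b p t (initialPoint A b c p t) = (p * t ^ (p - 2)) • (e - k • v) := by
    ext i
    rw [smoothGrad, hres]
    exact if_pos (hquad i)
  have he : Aᵀ *ᵥ e = 0 := by
    simp only [e, residual, mulVec_sub,
      transpose_mulVec_mulVec_pinv_mulVec (kerOrth_transpose_mulVec b), sub_self]
  have hone : p * t ^ (p - 2) * k = 1 := by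
    calc p * t ^ (p - 2) * (1 / p * t ^ (2 - p)) = t ^ (p - 2) * t ^ (2 - p) := by field_simp
      _ = 1 := by rw [← Real.rpow_add ht]; simp
  refine (isPathPoint_iff hp ht hc).2 ⟨?_, ?_⟩
  · rw [initialPoint, ← weightedGram_one]
    exact (kerOrth_pinv_mulVec _).sub ((kerOrth_pinv_mulVec _).smul _)
  · rw [hgrad, mulVec_smul, mulVec_sub, mulVec_smul, he, transpose_mulVec_mulVec_pinv_mulVec hc,
      zero_sub, smul_neg, smul_smul, hone, one_smul, add_neg_cancel]

/-! ### Movement along the path -/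

lemma shrink_le (hp : 1 < p) (ht : 0 < t) : (1 - stepH p) * t ≤ t :=
  mul_le_of_le_one_left ht.le (by linarith [stepH_pos hp])

lemma abs_mul_abs_max_shrink_rpow_sub_le (hp : 1 < p) (ht : 0 < t) {s : ℝ} (hs : |s| ≤ t) :
    |s| * |max ((1 - stepH p) * t) |s| ^ (p - 2) - t ^ (p - 2)| ≤
      max 1 (p - 1) * stepH p * t ^ (p - 1) := by
  set h := stepH p
  set M := max ((1 - h) * t) |s|
  have hM : 0 < M := lt_max_of_lt_left (shrink_pos hp ht)
  have hMt : M ≤ t := max_le (shrink_le hp ht) hs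
  have hh : 0 < h := stepH_pos hp
  have hh' : h ≤ 1 / 2 := stepH_le_half hp
  have hpow : ∀ a : ℝ, 0 < a → a * a ^ (p - 2) = a ^ (p - 1) := fun a ha => by
    rw [mul_comm, show p - 2 = p - 1 - 1 by ring, rpow_sub_one_mul (by linarith) ha.le]
  rcases le_total p 2 with hp2 | hp2
  · have hle : t ^ (p - 2) ≤ M ^ (p - 2) := Real.rpow_le_rpow_of_nonpos hM hMt (by linarith)
    rw [abs_of_nonneg (sub_nonneg.2 hle), max_eq_left (by linarith)]
    calc |s| * (M ^ (p - 2) - t ^ (p - 2))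
        ≤ M * (M ^ (p - 2) - t ^ (p - 2)) :=
          mul_le_mul_of_nonneg_right (le_max_right _ _) (sub_nonneg.2 hle)
      _ = M ^ (p - 1) - M * t ^ (p - 2) := by rw [mul_sub, hpow M hM]
      _ ≤ t ^ (p - 1) - (1 - h) * t * t ^ (p - 2) := by
          gcongr
          exact le_max_left _ _
      _ = 1 * h * t ^ (p - 1) := by rw [mul_assoc, hpow t ht]; ring
  · have hle : M ^ (p - 2) ≤ t ^ (p - 2) := Real.rpow_le_rpow hM.le hMt (by linarith)
    rw [abs_of_nonpos (sub_nonpos.2 hle), max_eq_right (by linarith)]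
    have hbernoulli : 1 - (p - 1) * h ≤ (1 - h) ^ (p - 2) := by
      have hone := one_add_mul_self_le_rpow_one_add (s := -h) (p := p - 1) (by linarith)
        (by linarith)
      have hexp : (1 - h) ^ (p - 1) ≤ (1 - h) ^ (p - 2) :=
        Real.rpow_le_rpow_of_exponent_ge (by linarith) (by linarith) (by linarith)
      rw [← sub_eq_add_neg] at hone
      linarith
    have hlow : (1 - (p - 1) * h) * t ^ (p - 2) ≤ M ^ (p - 2) :=
      calc (1 - (p - 1) * h) * t ^ (p - 2) ≤ (1 - h) ^ (p - 2) * t ^ (p - 2) := by gcongr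
        _ = ((1 - h) * t) ^ (p - 2) := (Real.mul_rpow (by linarith) ht.le).symm
        _ ≤ M ^ (p - 2) :=
          Real.rpow_le_rpow (shrink_pos hp ht).le (le_max_left _ _) (by linarith)
    calc |s| * -(M ^ (p - 2) - t ^ (p - 2)) ≤ t * ((p - 1) * h * t ^ (p - 2)) :=
          mul_le_mul hs (by linarith) (by linarith) ht.le
      _ = (p - 1) * h * t ^ (p - 1) := by rw [← hpow t ht]; ring

lemma smooth'_shrink_sub_mul_sub_ge_of_small (hp : 1 < p) (ht : 0 < t) {u v : ℝ} (hu : |u| ≤ t)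
    (hv : |v| ≤ t) :
    -(p * (max 1 (p - 1) * stepH p) ^ 2 * t ^ p / 4) ≤
      (smooth' p ((1 - stepH p) * t) v - smooth' p t u) * (v - u) := by
  set H := max 1 (p - 1) * stepH p
  set X := max ((1 - stepH p) * t) |v| ^ (p - 2) - t ^ (p - 2) with hX
  have hcross : -(H * t ^ (p - 1) * |v - u|) ≤ v * X * (v - u) := by
    have hle := mul_le_mul_of_nonneg_right (abs_mul_abs_max_shrink_rpow_sub_le hp ht hv)
      (abs_nonneg (v - u))
    rw [← abs_mul, ← abs_mul] at hle
    exact (neg_le_neg hle).trans (neg_abs_le _)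
  have hpow₁ : t ^ (p - 1) = t ^ (p - 2) * t := by
    rw [show p - 2 = p - 1 - 1 by ring, rpow_sub_one_mul (by linarith) ht.le]
  have hsplit : (smooth' p ((1 - stepH p) * t) v - smooth' p t u) * (v - u) =
      p * (t ^ (p - 2) * |v - u| ^ 2 + v * X * (v - u)) := by
    rw [smooth'_eq, smooth'_eq, max_eq_left hu, sq_abs, hX]
    ring
  rw [hsplit]
  calc -(p * H ^ 2 * t ^ p / 4)
      = p * (t ^ (p - 2) * -(H * t / 2) ^ 2) := by rw [← rpow_sub_two_mul_sq ht]; ring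
    _ ≤ p * (t ^ (p - 2) * (|v - u| ^ 2 - H * t * |v - u|)) := by
        gcongr
        linarith [sq_nonneg (|v - u| - H * t / 2)]
    _ = p * (t ^ (p - 2) * |v - u| ^ 2 - H * t ^ (p - 1) * |v - u|) := by rw [hpow₁]; ring
    _ ≤ p * (t ^ (p - 2) * |v - u| ^ 2 + v * X * (v - u)) := by
        gcongr
        linarith

lemma smooth'_sub_mul_sub_ge_of_le_two (hp : 1 < p) (hp2 : p ≤ 2) (ht : 0 < t) {u v : ℝ}
    (hM : t ≤ max |u| |v|) :
    p * min (p - 1) (1 / 2) * (max |u| |v| ^ (p - 2) * (v - u) ^ 2) ≤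
      (smooth' p t v - smooth' p t u) * (v - u) := by
  wlog huv : u ≤ v generalizing u v
  · have := this (by rwa [max_comm]) (le_of_not_ge huv)
    rw [max_comm] at this
    linarith
  have hslope : SlopesIn (p * min (p - 1) (1 / 2) * max |u| |v| ^ (p - 2))
      (p * max 1 (p - 1) * t ^ (p - 2)) (smooth' p t) (Icc u v) := by
    refine slopesIn_smooth' ht (convex_Icc u v) fun x hx => ⟨le_trans ?_
      (smooth''_bounds hp ht x).1, (smooth''_bounds hp ht x).2.trans ?_⟩
    · have hpow : max |u| |v| ^ (p - 2) ≤ max t |x| ^ (p - 2) :=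
        Real.rpow_le_rpow_of_nonpos (by positivity)
          (max_le hM (abs_le_max_abs_abs hx.1 hx.2)) (by linarith)
      have hmin : min (p - 1) (1 / 2) ≤ min 1 (p - 1) :=
        le_min ((min_le_right _ _).trans (by norm_num)) (min_le_left _ _)
      have : 0 ≤ min 1 (p - 1) := le_min zero_le_one (by linarith)
      gcongr
    · gcongr ?_ * ?_
      exact Real.rpow_le_rpow_of_nonpos ht (le_max_left _ _) (by linarith)
  have hle := (hslope u ⟨le_rfl, huv⟩ v ⟨huv, le_rfl⟩ huv).1
  nlinarith [mul_le_mul_of_nonneg_right hle (sub_nonneg.2 huv)]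

lemma smooth'_sub_mul_sub_ge_of_two_le (hp2 : 2 ≤ p) (ht : 0 < t) {u v : ℝ}
    (hM : t ≤ max |u| |v|) :
    p / 2 * (max |u| |v| ^ (p - 2) * (v - u) ^ 2) ≤
      (smooth' p t v - smooth' p t u) * (v - u) := by
  set φ : ℝ → ℝ := fun s => max t |s| ^ (p - 2) with hφ
  have hmono : ∀ {x y : ℝ}, |x| ≤ |y| → φ x ≤ φ y := fun h =>
    Real.rpow_le_rpow (by positivity) (max_le_max_left t h) (by linarith)
  have hcross : 0 ≤ (φ v - φ u) * (v ^ 2 - u ^ 2) := by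
    rcases le_total |u| |v| with h | h
    · exact mul_nonneg (sub_nonneg.2 (hmono h)) (sub_nonneg.2 (sq_le_sq.2 h))
    · exact mul_nonneg_of_nonpos_of_nonpos (sub_nonpos.2 (hmono h))
        (sub_nonpos.2 (sq_le_sq.2 h))
  have hsum : max |u| |v| ^ (p - 2) ≤ φ u + φ v := by
    have hu : 0 < φ u := by positivity
    have hv : 0 < φ v := by positivity
    rcases max_choice |u| |v| with h | h <;> rw [h] at hM ⊢ <;>
      simp only [hφ, max_eq_right hM] at hu hv ⊢ <;> linarith
  rw [smooth'_eq, smooth'_eq]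
  calc p / 2 * (max |u| |v| ^ (p - 2) * (v - u) ^ 2)
      ≤ p / 2 * ((φ u + φ v) * (v - u) ^ 2) := by gcongr
    _ ≤ p / 2 * ((φ u + φ v) * (v - u) ^ 2 + (φ v - φ u) * (v ^ 2 - u ^ 2)) := by
        gcongr
        linarith
    _ = (p * φ v * v - p * φ u * u) * (v - u) := by ring

lemma smooth'_sub_mul_sub_ge (hp : 1 < p) (ht : 0 < t) {u v : ℝ} (hM : t ≤ max |u| |v|) :
    p * min (p - 1) (1 / 2) * (max |u| |v| ^ (p - 2) * (v - u) ^ 2) ≤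
      (smooth' p t v - smooth' p t u) * (v - u) := by
  rcases le_total p 2 with hp2 | hp2
  · exact smooth'_sub_mul_sub_ge_of_le_two hp hp2 ht hM
  · rw [min_eq_right (by linarith), mul_one_div]
    exact smooth'_sub_mul_sub_ge_of_two_le hp2 ht hM

lemma smooth'_shrink_sub_mul_sub_ge_of_large (hp : 1 < p) (ht : 0 < t) {u v : ℝ}
    (hM : t ≤ |u| ∨ t ≤ |v|) :
    p * min (p - 1) (1 / 2) * (max |u| |v| ^ (p - 2) * (v - u) ^ 2) ≤
      (smooth' p ((1 - stepH p) * t) v - smooth' p t u) * (v - u) := by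
  have hle := shrink_le hp ht
  rcases hM with h | h
  · rw [show smooth' p t u = smooth' p ((1 - stepH p) * t) u by
      rw [smooth'_of_le h, smooth'_of_le (hle.trans h)]]
    exact smooth'_sub_mul_sub_ge hp (shrink_pos hp ht) (hle.trans (h.trans (le_max_left _ _)))
  · rw [show smooth' p ((1 - stepH p) * t) v = smooth' p t v by
      rw [smooth'_of_le h, smooth'_of_le (hle.trans h)]]
    exact smooth'_sub_mul_sub_ge hp ht (h.trans (le_max_right _ _))

lemma four_le_sq_div_sub_one (hp : 1 < p) : 4 ≤ p ^ 2 / (p - 1) := by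
  rw [le_div_iff₀ (by linarith)]
  nlinarith [sq_nonneg (p - 2)]

lemma two_le_drift (hp : 1 < p) (hn : 0 < n) : 2 ≤ p ^ 3 / (p - 1) * √(n : ℝ) * stepH p := by
  have hsqrt : 1 ≤ √(n : ℝ) := Real.one_le_sqrt.2 (by exact_mod_cast hn)
  calc (2 : ℝ) = 4 / 2 * 1 := by norm_num
    _ ≤ p ^ 2 / (p - 1) / 2 * √n := by
      have := four_le_sq_div_sub_one hp
      gcongr
    _ = p ^ 3 / (p - 1) * √n * stepH p := by unfold stepH; field_simp

lemma drift_constant_le (hp : 1 < p) :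
    max 2 (p / 2) ^ 2 * max 1 (p - 1) ^ 2 ≤
      4 * min (p - 1) (1 / 2) * (p ^ 3 / (p - 1)) ^ 2 := by
  have : 0 < p - 1 := by linarith
  rw [div_pow, ← mul_div_assoc, le_div_iff₀ (by positivity)]
  rcases le_total p 2 with h2 | h2
  · rw [max_eq_left (by linarith), max_eq_left (by linarith)]
    have hp6 : 1 ≤ p ^ 6 := one_le_pow₀ hp.le
    rcases le_total (p - 1) (1 / 2) with h | h
    · rw [min_eq_left h]
      nlinarith
    · rw [min_eq_right h]
      have : (3 / 2 : ℝ) ^ 6 ≤ p ^ 6 := by gcongr; linarith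
      nlinarith
  · rw [max_eq_right (show 1 ≤ p - 1 by linarith), min_eq_right (by linarith)]
    have hmax : max 2 (p / 2) ≤ p := max_le h2 (by linarith)
    have hsub : p - 1 ≤ p := by linarith
    calc max 2 (p / 2) ^ 2 * (p - 1) ^ 2 * (p - 1) ^ 2 ≤ p ^ 2 * p ^ 2 * p ^ 2 := by gcongr
      _ ≤ 4 * (1 / 2) * (p ^ 3) ^ 2 := by nlinarith [show 0 ≤ p ^ 6 by positivity]

lemma IsPathPoint.max_rpow_mul_abs_residual_sub_sq_le (hp : 1 < p) (ht : 0 < t) (hc : KerOrth A c)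
    (hx : IsPathPoint A b c p t x) (hx' : IsPathPoint A b c p ((1 - stepH p) * t) x') {i : Fin n}
    (hi : t ≤ |residual A b x i| ∨ t ≤ |residual A b x' i|) :
    4 * min (p - 1) (1 / 2) * (max |residual A b x i| |residual A b x' i| ^ (p / 2 - 1) *
      |residual A b x i - residual A b x' i|) ^ 2 ≤
      n * (max 1 (p - 1) * stepH p) ^ 2 * t ^ p := by
  set s := residual A b x
  set s' := residual A b x'
  set H := max 1 (p - 1) * stepH p
  set q : Fin n → ℝ := fun j => (smooth' p ((1 - stepH p) * t) (s' j) - smooth' p t (s j)) *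
    (s' j - s j)
  have hsum : ∑ j, q j = 0 := sum_smooth'_sub_mul_residual_sub ((isPathPoint_iff hp ht hc).1 hx).2
    ((isPathPoint_iff hp (shrink_pos hp ht) hc).1 hx').2
  have hlow : ∀ j, -(p * H ^ 2 * t ^ p / 4) ≤ q j := fun j => by
    by_cases hj : |s j| ≤ t ∧ |s' j| ≤ t
    · exact smooth'_shrink_sub_mul_sub_ge_of_small hp ht hj.1 hj.2
    · rw [not_and_or, not_le, not_le] at hj
      refine le_trans ?_ (smooth'_shrink_sub_mul_sub_ge_of_large hp ht (hj.imp le_of_lt le_of_lt))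
      have : 0 ≤ min (p - 1) (1 / 2) := le_min (by linarith) (by norm_num)
      exact (neg_nonpos.2 (by positivity)).trans (by positivity)
  have hup : q i ≤ n * (p * H ^ 2 * t ^ p / 4) := by
    have hrest := Finset.card_nsmul_le_sum (Finset.univ.erase i) _ _ fun j _ => hlow j
    have hcard : ((Finset.univ.erase i).card : ℝ) ≤ n := by
      exact_mod_cast Finset.card_erase_le.trans (by simp)
    rw [← Finset.add_sum_erase _ _ (Finset.mem_univ i)] at hsum
    rw [nsmul_eq_mul] at hrest
    have : 0 ≤ p * H ^ 2 * t ^ p / 4 := by positivity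
    nlinarith
  have hsq : (max |s i| |s' i| ^ (p / 2 - 1) * |s i - s' i|) ^ 2 =
      max |s i| |s' i| ^ (p - 2) * (s' i - s i) ^ 2 := by
    rw [mul_pow, rpow_half_sub_one_sq (by positivity), sq_abs, ← neg_sq, neg_sub]
  rw [hsq]
  refine le_of_mul_le_mul_left ?_ (zero_lt_one.trans hp)
  linarith [smooth'_shrink_sub_mul_sub_ge_of_large hp ht hi]

lemma IsPathPoint.abs_spow_residual_sub_le (hp : 1 < p) (ht : 0 < t) (hc : KerOrth A c)
    (hx : IsPathPoint A b c p t x) (hx' : IsPathPoint A b c p ((1 - stepH p) * t) x')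
    (i : Fin n) :
    |spow (residual A b x i) (p / 2) - spow (residual A b x' i) (p / 2)| ≤
      p ^ 3 / (p - 1) * √(n : ℝ) * stepH p * t ^ (p / 2) := by
  have hmin : 0 < min (p - 1) (1 / 2) := lt_min (by linarith) (by norm_num)
  have hnonneg : 0 ≤ p ^ 3 / (p - 1) * √(n : ℝ) * stepH p := drift_nonneg hp n
  by_cases hi : |residual A b x i| ≤ t ∧ |residual A b x' i| ≤ t
  · refine (abs_sub _ _).trans ?_
    rw [abs_spow (by positivity), abs_spow (by positivity)]
    calc _ ≤ t ^ (p / 2) + t ^ (p / 2) := by gcongr; exacts [hi.1, hi.2]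
      _ = 2 * t ^ (p / 2) := by ring
      _ ≤ _ := by gcongr; exact two_le_drift hp i.pos
  · rw [not_and_or, not_le, not_le] at hi
    have hsq := hx.max_rpow_mul_abs_residual_sub_sq_le hp ht hc hx' (hi.imp le_of_lt le_of_lt)
    have hup := abs_spow_sub_le (r := p / 2) (by linarith) (residual A b x i) (residual A b x' i)
    rw [mul_assoc] at hup
    set E := max |residual A b x i| |residual A b x' i| ^ (p / 2 - 1) *
      |residual A b x i - residual A b x' i|
    refine hup.trans (abs_le_of_sq_le_sq' ?_ (by positivity)).2
    refine le_of_mul_le_mul_left ?_ (mul_pos four_pos hmin)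
    calc 4 * min (p - 1) (1 / 2) * (max 2 (p / 2) * E) ^ 2
        = max 2 (p / 2) ^ 2 * (4 * min (p - 1) (1 / 2) * E ^ 2) := by ring
      _ ≤ max 2 (p / 2) ^ 2 * (n * (max 1 (p - 1) * stepH p) ^ 2 * t ^ p) := by gcongr
      _ = max 2 (p / 2) ^ 2 * max 1 (p - 1) ^ 2 * (n * stepH p ^ 2 * t ^ p) := by ring
      _ ≤ 4 * min (p - 1) (1 / 2) * (p ^ 3 / (p - 1)) ^ 2 * (n * stepH p ^ 2 * t ^ p) :=
          mul_le_mul_of_nonneg_right (drift_constant_le hp) (by positivity)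
      _ = 4 * min (p - 1) (1 / 2) * (p ^ 3 / (p - 1) * √n * stepH p * t ^ (p / 2)) ^ 2 := by
          simp only [mul_pow, Real.sq_sqrt n.cast_nonneg, rpow_half_sq ht.le]
          ring

end Path

/-! ### One phase -/

section Nbhd

variable {n : ℕ} {p γ γ' : ℝ} {s s' s'' : Fin n → ℝ}

lemma mem_nbhd_comm : s' ∈ Nbhd p s γ ↔ s ∈ Nbhd p s' γ :=
  forall_congr' fun _ => by rw [abs_sub_comm]

lemma nbhd_subset_nbhd (h : γ ≤ γ') : Nbhd p s γ ⊆ Nbhd p s γ' :=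
  fun _ hs i => (hs i).trans h

lemma mem_nbhd_add (h : s'' ∈ Nbhd p s' γ) (h' : s' ∈ Nbhd p s γ') : s'' ∈ Nbhd p s (γ + γ') :=
  fun i => (abs_sub_le _ _ _).trans (add_le_add (h i) (h' i))

lemma exists_abs_spow_sub_eq_of_lt {a b ρ : ℝ} (hp : 0 < p) (hρ : 0 ≤ ρ)
    (h : ρ < |spow b (p / 2) - spow a (p / 2)|) :
    ∃ v, |spow v (p / 2) - spow a (p / 2)| = ρ ∧ (v - a) ^ 2 ≤ (b - a) ^ 2 := by
  have hspow (v : ℝ) : spow (spow v (2 / p)) (p / 2) = v :=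
    spow_spow (by positivity) (by field_simp) v
  obtain ⟨hla, hau⟩ : a ∈ Icc (lower p ρ a) (upper p ρ a) :=
    (mem_Icc_lower_upper hp).2 (by simpa using hρ)
  rcases lt_abs.1 h with h | h
  · refine ⟨upper p ρ a, by rw [upper, hspow, add_sub_cancel_left, abs_of_nonneg hρ], ?_⟩
    have : upper p ρ a < b := lt_of_not_ge fun hb => by linarith [(le_upper_iff hp).1 hb]
    gcongr
  · refine ⟨lower p ρ a, by rw [lower, hspow, sub_sub_cancel_left, abs_neg, abs_of_nonneg hρ], ?_⟩
    have : b < lower p ρ a := lt_of_not_ge fun hb => by linarith [(lower_le_iff hp).1 hb]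
    rw [← neg_sub a, ← neg_sub a b, neg_sq, neg_sq]
    gcongr

end Nbhd

lemma one_le_kappa {p : ℝ} (hp : 1 < p) (n : ℕ) : 1 ≤ kappa p n := by
  have hbase : 1 ≤ kappaBase p n ^ |2 - 4 / p| :=
    Real.one_le_rpow (one_le_kappaBase hp n) (abs_nonneg _)
  have hfactor : 1 ≤ 4 * p ^ 2 / (p - 1) := by
    rw [mul_div_assoc]
    linarith [four_le_sq_div_sub_one hp]
  exact one_le_mul_of_one_le_of_one_le hfactor hbase

section Phase

variable {n d m : ℕ} {A : Matrix (Fin n) (Fin d) ℝ} {b : Fin n → ℝ} {c : Fin d → ℝ} {p t : ℝ}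
  {x x' : Fin d → ℝ} {P : Matrix (Fin d) (Fin m) ℝ}

/-- The starting vector `Pᵀ Aᵀ D_t A v` of a phase, for an arbitrary vector `v` in place of the
point `x` at which `D_t` is built: the preimage under `P` of `v ∈ ker(A)ᗮ` in the space in which
accelerated gradient descent moves. -/
def precondPreimage (A : Matrix (Fin n) (Fin d) ℝ) (b : Fin n → ℝ) (p t : ℝ) (x : Fin d → ℝ)
    (P : Matrix (Fin d) (Fin m) ℝ) (v : Fin d → ℝ) : EuclideanSpace ℝ (Fin m) :=
  WithLp.toLp 2 (Pᵀ *ᵥ (gram A b p t x *ᵥ v))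

lemma mulVec_precondPreimage (hp : 1 < p) (ht : 0 < t) (hP : P * Pᵀ = pinv (gram A b p t x))
    {v : Fin d → ℝ} (hv : KerOrth A v) : P *ᵥ (precondPreimage A b p t x P v).ofLp = v :=
  mulVec_transpose_mulVec_weightedGram (weight_pos hp ht _) hP hv

lemma precondPreimage_mem_iterSpace (v : Fin d → ℝ) :
    precondPreimage A b p t x P v ∈ iterSpace P :=
  toLp_transpose_mulVec_mem_iterSpace _

lemma gradient_precondObjective (hp : 1 < p) (ht : 0 < t) (y : EuclideanSpace ℝ (Fin m)) :
    gradient (precondObjective A b c p t x P) y =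
      WithLp.toLp 2 (Pᵀ *ᵥ (c + Aᵀ *ᵥ fun i => extend' p ((1 - stepH p) * t)
        (lower p (radius p n t) (residual A b x i)) (upper p (radius p n t) (residual A b x i))
        (residual A b (P *ᵥ y.ofLp) i))) :=
  (hasGradientAt_dotProduct_add_sum A b c P (fun _ => hasDerivAt_extend hp (shrink_pos hp ht)
    (lower_le_upper (one_pos.trans hp) (radius_pos hp n ht).le)) y).gradient

lemma precondObjective_quadratic_bounds (hp : 1 < p) (ht : 0 < t)
    (hP : P * Pᵀ = pinv (gram A b p t x)) {z u : EuclideanSpace ℝ (Fin m)}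
    (hz : z ∈ iterSpace P) (hu : u ∈ iterSpace P) :
    let g := precondObjective A b c p t x P
    g z + inner ℝ (gradient g z) (u - z) + 1 / 2 * ‖u - z‖ ^ 2 ≤ g u ∧
      g u ≤ g z + inner ℝ (gradient g z) (u - z) + kappa p n / 2 * ‖u - z‖ ^ 2 := by
  have hp0 := one_pos.trans hp
  have hlu (i : Fin n) := lower_le_upper (s := residual A b x i) hp0 (radius_pos hp n ht).le
  exact quadratic_bounds_dotProduct_add_sum b c hP
    (fun i => hasDerivAt_extend hp (shrink_pos hp ht) (hlu i))
    (fun i => slopesIn_extend' (shrink_pos hp ht) (hlu i) fun s hs =>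
      smooth''_mem_Icc_weight hp ht _ i ((mem_Icc_lower_upper hp0).1 hs)) rfl hz hu

lemma precondObjective_eq_smoothObjective (hp : 0 < p) {y : EuclideanSpace ℝ (Fin m)}
    (hy : residual A b (P *ᵥ y.ofLp) ∈ Nbhd p (residual A b x) (radius p n t)) :
    precondObjective A b c p t x P y =
      smoothObjective A b c p ((1 - stepH p) * t) (P *ᵥ y.ofLp) :=
  congrArg (_ + ·) <| Finset.sum_congr rfl fun i _ =>
    extend_of_mem ((mem_Icc_lower_upper hp).2 (hy i))

lemma gradient_precondObjective_eq_zero (hp : 1 < p) (ht : 0 < t) (hc : KerOrth A c)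
    (hx' : IsPathPoint A b c p ((1 - stepH p) * t) x')
    (hbox : residual A b x' ∈ Nbhd p (residual A b x) (radius p n t))
    {y : EuclideanSpace ℝ (Fin m)} (hy : P *ᵥ y.ofLp = x') :
    gradient (precondObjective A b c p t x P) y = 0 := by
  have hstationary := ((isPathPoint_iff hp (shrink_pos hp ht) hc).1 hx').2
  have hextend (i : Fin n) :=
    extend'_of_mem (p := p) (t := (1 - stepH p) * t)
      ((mem_Icc_lower_upper (one_pos.trans hp)).2 (hbox i))
  simp only [gradient_precondObjective hp ht, hy, hextend]
  exact (congrArg (fun v => WithLp.toLp 2 (Pᵀ *ᵥ v)) hstationary).trans (by simp)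

lemma norm_precondPreimage_sub_sq_le (hp : 1 < p) (ht : 0 < t)
    (hP : P * Pᵀ = pinv (gram A b p t x)) (hx : KerOrth A x) (hx' : KerOrth A x')
    (hbox : residual A b x' ∈ Nbhd p (residual A b x) (radius p n t)) :
    ‖precondPreimage A b p t x P x - precondPreimage A b p t x P x'‖ ^ 2 ≤
      n * (2 * (p - 1) * radius p n t ^ 2) := by
  rw [norm_sub_sq_of_mem_iterSpace b hP (precondPreimage_mem_iterSpace _)
    (precondPreimage_mem_iterSpace _), mulVec_precondPreimage hp ht hP hx,
    mulVec_precondPreimage hp ht hP hx']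
  calc _ ≤ ∑ _i : Fin n, 2 * (p - 1) * radius p n t ^ 2 :=
        Finset.sum_le_sum fun i _ => weight_mul_sq_le hp ht _ i (hbox i)
    _ = _ := by simp

/-- If a coordinate of the residual at `P u` were too far away, then already a point of the box
strictly between the two residuals would contribute too much to the norm. -/
lemma residual_mem_nbhd_of_norm_sub_sq_lt (hp : 1 < p) (ht : 0 < t)
    (hP : P * Pᵀ = pinv (gram A b p t x)) {u w : EuclideanSpace ℝ (Fin m)}
    (hu : u ∈ iterSpace P) (hw : w ∈ iterSpace P)
    (hbox : residual A b (P *ᵥ w.ofLp) ∈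
      Nbhd p (residual A b x) (radius p n t - ((1 - stepH p) * t) ^ (p / 2) / 2))
    (hnorm : 256 * kappa p n * ‖u - w‖ ^ 2 < ((1 - stepH p) * t) ^ p) :
    residual A b (P *ᵥ u.ofLp) ∈
      Nbhd p (residual A b (P *ᵥ w.ofLp)) (((1 - stepH p) * t) ^ (p / 2) / 2) := by
  intro i
  by_contra! hfar
  have hρ : 0 ≤ ((1 - stepH p) * t) ^ (p / 2) / 2 :=
    div_nonneg (Real.rpow_nonneg (shrink_pos hp ht).le _) zero_le_two
  obtain ⟨v, hv, hvu⟩ := exists_abs_spow_sub_eq_of_lt (one_pos.trans hp) hρ hfar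
  have hvbox : |spow v (p / 2) - spow (residual A b x i) (p / 2)| ≤ radius p n t :=
    (abs_sub_le _ (spow (residual A b (P *ᵥ w.ofLp) i) (p / 2)) _).trans (by linarith [hbox i])
  have hlarge := rpow_le_kappa_mul_weight_mul_sq hp ht (residual A b x) i hvbox
    ((hbox i).trans (sub_le_self _ hρ)) hv.ge
  have hcoord : weight p t (residual A b x) i *
      (residual A b (P *ᵥ u.ofLp) i - residual A b (P *ᵥ w.ofLp) i) ^ 2 ≤ ‖u - w‖ ^ 2 := by
    rw [norm_sub_sq_of_mem_iterSpace b hP hu hw]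
    exact Finset.single_le_sum (f := fun i => weight p t (residual A b x) i *
      (residual A b (P *ᵥ u.ofLp) i - residual A b (P *ᵥ w.ofLp) i) ^ 2)
      (fun j _ => mul_nonneg (weight_pos hp ht _ j).le (sq_nonneg _)) (Finset.mem_univ i)
  have hκ := zero_le_one.trans (one_le_kappa hp n)
  have hweight := (weight_pos hp ht (residual A b x) i).le
  refine hnorm.not_ge ?_
  calc ((1 - stepH p) * t) ^ p
      ≤ 256 * kappa p n * (weight p t (residual A b x) i *
          (v - residual A b (P *ᵥ w.ofLp) i) ^ 2) := hlarge.trans_eq (by ring)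
    _ ≤ 256 * kappa p n * (weight p t (residual A b x) i *
          (residual A b (P *ᵥ u.ofLp) i - residual A b (P *ᵥ w.ofLp) i) ^ 2) := by gcongr
    _ ≤ 256 * kappa p n * ‖u - w‖ ^ 2 := by gcongr

lemma agd_precondObjective_sub_le (hp : 1 < p) (ht : 0 < t) (hc : KerOrth A c)
    (hx : KerOrth A x) (hP : P * Pᵀ = pinv (gram A b p t x))
    (hx' : IsPathPoint A b c p ((1 - stepH p) * t) x')
    (hbox : residual A b x' ∈ Nbhd p (residual A b x) (radius p n t)) (T : ℕ) :
    let g := precondObjective A b c p t x P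
    let w := precondPreimage A b p t x P x'
    let yT := agd g (kappa p n) T (precondPreimage A b p t x P x)
    yT ∈ iterSpace P ∧ 1 / 2 * ‖yT - w‖ ^ 2 ≤ g yT - g w ∧
      g yT - g w ≤
        Real.exp (-(T / √(kappa p n))) * (2 * kappa p n * n * (p - 1) * radius p n t ^ 2) := by
  intro g w yT
  set y₀ := precondPreimage A b p t x P x
  have hκ := one_le_kappa hp n
  have hy₀V : y₀ ∈ iterSpace P := precondPreimage_mem_iterSpace _
  have hwV : w ∈ iterSpace P := precondPreimage_mem_iterSpace _
  have hgw : gradient g w = 0 := gradient_precondObjective_eq_zero hp ht hc hx' hbox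
    (mulVec_precondPreimage hp ht hP hx'.1)
  have hbounds {u : EuclideanSpace ℝ (Fin m)} (hu : u ∈ iterSpace P) :
      1 / 2 * ‖u - w‖ ^ 2 ≤ g u - g w ∧ g u - g w ≤ kappa p n / 2 * ‖u - w‖ ^ 2 := by
    have hquad := precondObjective_quadratic_bounds (c := c) hp ht hP hwV hu
    simp only [g, hgw, inner_zero_left] at hquad ⊢
    constructor <;> linarith
  obtain ⟨hyTV, hdecay⟩ := agd_mem_and_sub_le hκ (iterSpace P)
    (fun z _ => (gradient_precondObjective hp ht z).symm ▸ toLp_transpose_mulVec_mem_iterSpace _)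
    (fun z hz u hu => (precondObjective_quadratic_bounds hp ht hP hz hu).1)
    (fun z hz u hu => (precondObjective_quadratic_bounds hp ht hP hz hu).2) hwV hy₀V
    (sub_nonneg.1 ((by positivity : (0 : ℝ) ≤ _).trans (hbounds hy₀V).1)) T
  refine ⟨hyTV, (hbounds hyTV).1, hdecay.trans ?_⟩
  gcongr
  calc g y₀ - g w + 1 / 2 * ‖y₀ - w‖ ^ 2
      ≤ kappa p n / 2 * ‖y₀ - w‖ ^ 2 + kappa p n / 2 * ‖y₀ - w‖ ^ 2 := by
        gcongr
        exact (hbounds hy₀V).2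
    _ = kappa p n * ‖y₀ - w‖ ^ 2 := by ring
    _ ≤ kappa p n * (n * (2 * (p - 1) * radius p n t ^ 2)) := by
        gcongr
        exact norm_precondPreimage_sub_sq_le hp ht hP hx hx'.1 hbox
    _ = _ := by ring

/-- `y` approximates the point `x` of the homotopy path at parameter `t` in the box metric and in
the objective; this is the invariant of the homotopy method. -/
structure Tracks (A : Matrix (Fin n) (Fin d) ℝ) (b : Fin n → ℝ) (c : Fin d → ℝ) (p t : ℝ)
    (x y : Fin d → ℝ) : Prop where
  kerOrth : KerOrth A y
  mem_nbhd : residual A b y ∈ Nbhd p (residual A b x) (t ^ (p / 2) / 2)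
  smoothObjective_le :
    smoothObjective A b c p t y ≤ smoothObjective A b c p t x + t ^ p / (1024 * kappa p n)

theorem tracks_phase (hp : 1 < p) (ht : 0 < t) (hc : KerOrth A c) (hx : KerOrth A x)
    (hP : P * Pᵀ = pinv (gram A b p t x))
    (hx' : IsPathPoint A b c p ((1 - stepH p) * t) x')
    (hclose : residual A b x' ∈ Nbhd p (residual A b x) (radius p n t - t ^ (p / 2) / 2)) {T : ℕ}
    (hT : Real.exp (-(T / √(kappa p n))) * (2 * kappa p n * n * (p - 1) * radius p n t ^ 2) ≤
      ((1 - stepH p) * t) ^ p / (1024 * kappa p n)) :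
    Tracks A b c p ((1 - stepH p) * t) x' (phase A b c p t T P x) := by
  have hp0 := one_pos.trans hp
  have hκ := one_pos.trans_le (one_le_kappa hp n)
  have ht' := shrink_pos hp ht
  have hclose' : residual A b x' ∈ Nbhd p (residual A b x)
      (radius p n t - ((1 - stepH p) * t) ^ (p / 2) / 2) := by
    refine nbhd_subset_nbhd ?_ hclose
    gcongr
    exact shrink_le hp ht
  have hbox : residual A b x' ∈ Nbhd p (residual A b x) (radius p n t) :=
    nbhd_subset_nbhd (sub_le_self _ (by positivity)) hclose'
  have hw := mulVec_precondPreimage hp ht hP hx'.1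
  obtain ⟨hyTV, hnorm, hgap⟩ := agd_precondObjective_sub_le hp ht hc hx hP hx' hbox T
  set yT := agd (precondObjective A b c p t x P) (kappa p n) T (precondPreimage A b p t x P x)
  have hphase : phase A b c p t T P x = P *ᵥ yT.ofLp := rfl
  have hsmall := (hnorm.trans hgap).trans hT
  have hcoord : residual A b (P *ᵥ yT.ofLp) ∈
      Nbhd p (residual A b x') (((1 - stepH p) * t) ^ (p / 2) / 2) := by
    nth_rw 1 [← hw]
    refine residual_mem_nbhd_of_norm_sub_sq_lt hp ht hP hyTV (precondPreimage_mem_iterSpace _)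
      (by rwa [hw]) ?_
    rw [le_div_iff₀ (by positivity)] at hsmall
    have : 0 < ((1 - stepH p) * t) ^ p := by positivity
    linarith
  have hyTbox : residual A b (P *ᵥ yT.ofLp) ∈ Nbhd p (residual A b x) (radius p n t) := by
    simpa only [add_sub_cancel] using mem_nbhd_add hcoord hclose'
  have hvalue := hgap.trans hT
  rw [precondObjective_eq_smoothObjective hp0 hyTbox,
    precondObjective_eq_smoothObjective hp0 (by rwa [hw]), hw] at hvalue
  rw [hphase]
  exact ⟨kerOrth_mulVec_of_mem_iterSpace hP hyTV, hcoord, sub_le_iff_le_add'.1 hvalue⟩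

end Phase

/-! ### The number of iterations per phase -/

section Iterations

variable {p t : ℝ} {n : ℕ}

lemma sub_one_le_sq_div_sub_one (hp : 1 < p) : p - 1 ≤ p ^ 2 / (p - 1) := by
  rw [le_div_iff₀ (sub_pos.2 hp)]
  nlinarith

lemma kappaBase_le (hp : 1 < p) (hn : 1 ≤ n) :
    kappaBase p n ≤ 2 * (p ^ 2 / (p - 1)) * √(n : ℝ) := by
  have hq := four_le_sq_div_sub_one hp
  have hn' : 1 ≤ √(n : ℝ) := Real.one_le_sqrt.2 (by exact_mod_cast hn)
  have heq : kappaBase p n = 3 + p ^ 2 / (p - 1) * √(n : ℝ) := by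
    have : p - 1 ≠ 0 := (sub_pos.2 hp).ne'
    rw [kappaBase, stepH]
    field_simp
  rw [heq]
  nlinarith

lemma abs_two_sub_four_div_le (hp : 1 < p) : |2 - 4 / p| ≤ 2 := by
  have hle : 4 / p ≤ 4 := div_le_self zero_le_four hp.le
  have : 0 < p := one_pos.trans hp
  have hpos : 0 < 4 / p := by positivity
  exact abs_le.2 ⟨by linarith, by linarith⟩

lemma kappa_le_rpow_mul (hp : 1 < p) (hn : 1 ≤ n) :
    kappa p n ≤ 16 * (p ^ 2 / (p - 1)) ^ 3 * √(n : ℝ) ^ |2 - 4 / p| := by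
  have hq := four_le_sq_div_sub_one hp
  have hbase := zero_le_one.trans (one_le_kappaBase hp n)
  have hpow : (2 * (p ^ 2 / (p - 1))) ^ |2 - 4 / p| ≤ (2 * (p ^ 2 / (p - 1))) ^ 2 := by
    rw [← Real.rpow_two (2 * _)]
    exact Real.rpow_le_rpow_of_exponent_le (by linarith) (abs_two_sub_four_div_le hp)
  calc kappa p n = 4 * (p ^ 2 / (p - 1)) * kappaBase p n ^ |2 - 4 / p| := by
        rw [kappa, mul_div_assoc, kappaBase]
    _ ≤ 4 * (p ^ 2 / (p - 1)) * (2 * (p ^ 2 / (p - 1)) * √(n : ℝ)) ^ |2 - 4 / p| := by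
        gcongr
        exact kappaBase_le hp hn
    _ ≤ 4 * (p ^ 2 / (p - 1)) * ((2 * (p ^ 2 / (p - 1))) ^ 2 * √(n : ℝ) ^ |2 - 4 / p|) := by
        rw [Real.mul_rpow (by linarith) (Real.sqrt_nonneg _)]
        gcongr
    _ = _ := by ring

lemma kappa_le (hp : 1 < p) (hn : 1 ≤ n) : kappa p n ≤ 16 * (p ^ 2 / (p - 1)) ^ 3 * n := by
  have : 0 ≤ p ^ 2 / (p - 1) := zero_le_four.trans (four_le_sq_div_sub_one hp)
  refine (kappa_le_rpow_mul hp hn).trans ?_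
  gcongr
  calc √(n : ℝ) ^ |2 - 4 / p| ≤ √(n : ℝ) ^ (2 : ℝ) :=
        Real.rpow_le_rpow_of_exponent_le (Real.one_le_sqrt.2 (by exact_mod_cast hn))
          (abs_two_sub_four_div_le hp)
    _ = n := by rw [Real.rpow_two, Real.sq_sqrt n.cast_nonneg]

lemma sqrt_kappa_le (hp : 1 < p) (hn : 1 ≤ n) :
    √(kappa p n) ≤ 4 * (p ^ 2 / (p - 1)) ^ 2 * (n : ℝ) ^ |1 / 2 - 1 / p| := by
  have hq := four_le_sq_div_sub_one hp
  have hexp : |2 - 4 / p| = 4 * |1 / 2 - 1 / p| := by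
    rw [show 2 - 4 / p = 4 * (1 / 2 - 1 / p) by ring, abs_mul, abs_of_pos four_pos]
  refine Real.sqrt_le_iff.2 ⟨by positivity, (kappa_le_rpow_mul hp hn).trans ?_⟩
  calc 16 * (p ^ 2 / (p - 1)) ^ 3 * √(n : ℝ) ^ |2 - 4 / p|
      ≤ 16 * (p ^ 2 / (p - 1)) ^ 4 * √(n : ℝ) ^ |2 - 4 / p| := by
        gcongr
        · linarith
        · norm_num
    _ = 16 * (p ^ 2 / (p - 1)) ^ 4 * ((n : ℝ) ^ |1 / 2 - 1 / p|) ^ 2 := by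
        rw [Real.sqrt_eq_rpow, ← Real.rpow_mul n.cast_nonneg, ← Real.rpow_mul_natCast n.cast_nonneg,
          hexp]
        ring_nf
    _ = _ := by ring

lemma radius_sq_le (hp : 1 < p) (ht : 0 < t) (hn : 1 ≤ n) :
    radius p n t ^ 2 ≤ 2 * (p ^ 2 / (p - 1)) ^ 2 * n * ((1 - stepH p) * t) ^ p := by
  have hradius : radius p n t ≤ p ^ 2 / (p - 1) * √(n : ℝ) * t ^ (p / 2) := by
    have htwo := two_mul_radius p n t
    have : (kappaBase p n - 1) * t ^ (p / 2) ≤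
        2 * (p ^ 2 / (p - 1)) * √(n : ℝ) * t ^ (p / 2) := by
      gcongr
      linarith [kappaBase_le hp hn]
    linarith
  calc radius p n t ^ 2 ≤ (p ^ 2 / (p - 1) * √(n : ℝ) * t ^ (p / 2)) ^ 2 :=
        pow_le_pow_left₀ (radius_pos hp n ht).le hradius 2
    _ = 2 * (p ^ 2 / (p - 1)) ^ 2 * n * (1 / 2 * t ^ p) := by
        rw [mul_pow, mul_pow, Real.sq_sqrt n.cast_nonneg, rpow_half_sq ht.le]
        ring
    _ ≤ _ := by
        gcongr
        exact half_mul_rpow_le_shrink_rpow hp ht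

lemma log_two_pow_mul_le {q : ℝ} (hq : 4 ≤ q) (hn : 1 ≤ n) :
    Real.log (2 ^ 20 * q ^ 9 * n ^ 4) ≤ 20 * q * Real.log (n + 1) := by
  have hn' : (1 : ℝ) ≤ n := by exact_mod_cast hn
  have hlog_two : Real.log 2 ≤ Real.log (n + 1) := Real.log_le_log two_pos (by linarith)
  have hhalf : 1 / 2 ≤ Real.log 2 := by linarith [Real.log_two_gt_d9]
  have hlog_q : Real.log q ≤ q - 1 := Real.log_le_sub_one_of_pos (by linarith)
  have hlog_n : Real.log n ≤ Real.log (n + 1) := Real.log_le_log (by linarith) (by linarith)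
  rw [Real.log_mul (by positivity) (by positivity), Real.log_mul (by positivity) (by positivity),
    Real.log_pow, Real.log_pow, Real.log_pow]
  push_cast
  nlinarith

lemma two_pow_mul_le_exp_of_iterations_le (hp : 1 < p) (hn : 0 < n) {T : ℕ}
    (hT : 80 * (p ^ 2 / (p - 1)) ^ 3 * (n : ℝ) ^ |1 / 2 - 1 / p| * Real.log (n + 1) ≤ T) :
    2 ^ 20 * (p ^ 2 / (p - 1)) ^ 9 * n ^ 4 ≤ Real.exp (T / √(kappa p n)) := by
  have hq := four_le_sq_div_sub_one hp
  have hlog : 0 ≤ Real.log (n + 1) := Real.log_nonneg (by simp)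
  rw [← Real.log_le_iff_le_exp (by positivity)]
  refine (log_two_pow_mul_le hq hn).trans ?_
  rw [le_div_iff₀ (Real.sqrt_pos.2 (one_pos.trans_le (one_le_kappa hp n)))]
  calc (20 * (p ^ 2 / (p - 1)) * Real.log (n + 1) * √(kappa p n) : ℝ)
      ≤ 20 * (p ^ 2 / (p - 1)) * Real.log (n + 1) *
          (4 * (p ^ 2 / (p - 1)) ^ 2 * (n : ℝ) ^ |1 / 2 - 1 / p|) := by
        gcongr
        exact sqrt_kappa_le hp hn
    _ = 80 * (p ^ 2 / (p - 1)) ^ 3 * (n : ℝ) ^ |1 / 2 - 1 / p| * Real.log (n + 1) := by ring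
    _ ≤ T := hT

lemma exp_neg_mul_le_of_iterations_le (hp : 1 < p) (ht : 0 < t) {T : ℕ}
    (hT : 80 * (p ^ 2 / (p - 1)) ^ 3 * (n : ℝ) ^ |1 / 2 - 1 / p| * Real.log (n + 1) ≤ T) :
    Real.exp (-(T / √(kappa p n))) * (2 * kappa p n * n * (p - 1) * radius p n t ^ 2) ≤
      ((1 - stepH p) * t) ^ p / (1024 * kappa p n) := by
  have := four_le_sq_div_sub_one hp
  have hκ := one_pos.trans_le (one_le_kappa hp n)
  have := sub_pos.2 hp
  have := shrink_pos hp ht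
  rcases Nat.eq_zero_or_pos n with rfl | hn
  · simp only [Nat.cast_zero, mul_zero, zero_mul]
    positivity
  have hexp := two_pow_mul_le_exp_of_iterations_le hp hn hT
  rw [Real.exp_neg, inv_mul_le_iff₀ (Real.exp_pos _), ← mul_div_assoc, le_div_iff₀ (by positivity)]
  calc 2 * kappa p n * n * (p - 1) * radius p n t ^ 2 * (1024 * kappa p n)
      = 2048 * kappa p n ^ 2 * n * (p - 1) * radius p n t ^ 2 := by ring
    _ ≤ 2048 * (16 * (p ^ 2 / (p - 1)) ^ 3 * n) ^ 2 * n * (p ^ 2 / (p - 1)) *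
          (2 * (p ^ 2 / (p - 1)) ^ 2 * n * ((1 - stepH p) * t) ^ p) := by
        gcongr
        exacts [kappa_le hp hn, sub_one_le_sq_div_sub_one hp, radius_sq_le hp ht hn]
    _ = 2 ^ 20 * (p ^ 2 / (p - 1)) ^ 9 * n ^ 4 * ((1 - stepH p) * t) ^ p := by ring
    _ ≤ Real.exp (T / √(kappa p n)) * ((1 - stepH p) * t) ^ p := by gcongr

end Iterations

/-! ### Optimality for the original problem -/

section Optimality

variable {p t : ℝ}

lemma half_mul_sq_sub_rpow_mem_Icc (hp : 1 ≤ p) {u : ℝ} (hu : u ∈ Icc 0 1) :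
    p / 2 * u ^ 2 - u ^ p ∈ Icc (max 0 (p / 2 - 1) - p / 2) (max 0 (p / 2 - 1)) := by
  have hsq : u ^ p = (1 + (u ^ 2 - 1)) ^ (p / 2) := by
    rw [add_sub_cancel, ← Real.rpow_natCast_mul hu.1]
    ring_nf
  have : u ^ 2 ≤ 1 := pow_le_one₀ hu.1 hu.2
  rcases le_total p 2 with h2 | h2
  · have hbernoulli := rpow_one_add_le_one_add_mul_self (s := u ^ 2 - 1)
      (by linarith [sq_nonneg u]) (p := p / 2) (by linarith) (by linarith)
    rw [← hsq] at hbernoulli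
    have hle : u ^ 2 ≤ u ^ p := by
      rw [← Real.rpow_two]
      exact Real.rpow_le_rpow_of_exponent_ge_of_imp hu.1 hu.2 h2 (by intros; linarith)
    rw [max_eq_left (by linarith)]
    constructor <;> nlinarith [sq_nonneg u]
  · have hbernoulli := one_add_mul_self_le_rpow_one_add (s := u ^ 2 - 1)
      (by linarith [sq_nonneg u]) (p := p / 2) (by linarith)
    rw [← hsq] at hbernoulli
    have hle : u ^ p ≤ 1 := Real.rpow_le_one hu.1 hu.2 (by linarith)
    rw [max_eq_right (by linarith)]
    constructor <;> nlinarith [sq_nonneg u]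

lemma smooth_sub_rpow_mem_Icc (hp : 1 ≤ p) (ht : 0 < t) (s : ℝ) :
    smooth p t s - |s| ^ p ∈
      Icc (max 0 (p / 2 - 1) * t ^ p - p / 2 * t ^ p) (max 0 (p / 2 - 1) * t ^ p) := by
  obtain ⟨u, hu, hval⟩ : ∃ u ∈ Icc (0 : ℝ) 1,
      smooth p t s - |s| ^ p = (p / 2 * u ^ 2 - u ^ p) * t ^ p := by
    rcases le_total |s| t with hs | hs
    · refine ⟨|s| / t, ⟨by positivity, (div_le_one ht).2 hs⟩, ?_⟩
      rw [smooth, if_pos hs, Real.div_rpow (abs_nonneg s) ht.le, sub_mul,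
        div_mul_cancel₀ _ (Real.rpow_pos_of_pos ht p).ne', ← rpow_sub_two_mul_sq (p := p) ht,
        ← sq_abs s]
      field_simp
    · refine ⟨1, by simp, ?_⟩
      rw [smooth_of_le ht hs, Real.one_rpow]
      ring
  obtain ⟨hlow, hup⟩ := half_mul_sq_sub_rpow_mem_Icc hp hu
  rw [hval, ← sub_mul]
  constructor <;> gcongr

lemma IsPathPoint.isEpsOptimal_of_smoothObjective_le {n d : ℕ}
    {A : Matrix (Fin n) (Fin d) ℝ} {b : Fin n → ℝ} {c : Fin d → ℝ} {ε : ℝ} {x y : Fin d → ℝ}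
    (hp : 1 < p) (ht : 0 < t) (hc : KerOrth A c) (hx : IsPathPoint A b c p t x)
    (hy : smoothObjective A b c p t y ≤ smoothObjective A b c p t x + n * p / 2 * t ^ p)
    (hε : n * p * t ^ p ≤ ε) : IsEpsOptimal A b c p ε y := by
  intro z
  have hxz := smoothObjective_le_of_stationary hp ht ((isPathPoint_iff hp ht hc).1 hx).2 z
  have hlow := Finset.sum_le_sum fun i (_ : i ∈ Finset.univ) =>
    (smooth_sub_rpow_mem_Icc hp.le ht (residual A b y i)).1
  have hup := Finset.sum_le_sum fun i (_ : i ∈ Finset.univ) =>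
    (smooth_sub_rpow_mem_Icc hp.le ht (residual A b z i)).2
  simp only [Finset.sum_sub_distrib, Finset.sum_const, Finset.card_univ, Fintype.card_fin,
    nsmul_eq_mul] at hlow hup
  rw [smoothObjective, smoothObjective] at hy
  rw [smoothObjective, smoothObjective] at hxz
  rw [objective, objective]
  linarith

end Optimality

/-! ### Compiling arithmetic expressions to straight-line programs -/

section Compiler

open Function

variable {n d m : ℕ} {V ι : Type*}

/-- Arithmetic expressions over the variables `V`, the source language of the programs;
`ite a b u v` stands for `if a ≤ b then u else v`. -/
inductive Arith (V : Type*) : Type _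
  | var (v : V)
  | const (q : ℚ)
  | op (o : BinOp) (a b : Arith V)
  | ite (a b u v : Arith V)

/-- The value of an expression when the variables have the values `σ`. -/
def Arith.value (σ : V → ℝ) : Arith V → ℝ
  | .var v => σ v
  | .const q => q
  | .op o a b => o.eval (a.value σ) (b.value σ)
  | .ite a b u v => if a.value σ ≤ b.value σ then u.value σ else v.value σ

/-- The number of nodes of an expression. -/
def Arith.size : Arith V → ℕ
  | .var _ => 1
  | .const _ => 1
  | .op _ a b => a.size + b.size + 1
  | .ite a b u v => a.size + b.size + u.size + v.size + 1

/-- The absolute value as an expression. -/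
def Arith.abs (a : Arith V) : Arith V := .ite (.const 0) a a (.op .sub (.const 0) a)

lemma Arith.value_abs (σ : V → ℝ) (a : Arith V) : a.abs.value σ = |a.value σ| := by
  simp only [Arith.abs, Arith.value, BinOp.eval, Rat.cast_zero, zero_sub]
  split_ifs with h
  · rw [abs_of_nonneg h]
  · rw [abs_of_neg (not_le.1 h)]

/-- The cells of the work array `0`, which the compiler uses as its stack. -/
def scratch (k : ℕ) : Cell n d m := .work 0 k

lemma scratch_ne_scratch {j k : ℕ} (h : j ≠ k) : (scratch j : Cell n d m) ≠ scratch k := by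
  simpa [scratch] using h

/-- A placement of the variables `V` in distinct memory cells off the stack of the compiler. -/
structure Layout (V : Type*) (n d m : ℕ) where
  cell : V → Cell n d m
  injective : Injective cell
  ne_scratch : ∀ v k, cell v ≠ scratch k

variable (L : Layout V n d m) (P : Matrix (Fin d) (Fin m) ℝ)

/-- The values of the variables in a memory. -/
def Layout.load (mem : Cell n d m → ℝ) (v : V) : ℝ := mem (L.cell v)

lemma run_append (prog prog' : List (Instr n d m)) (mem : Cell n d m → ℝ) :
    run P (prog ++ prog') mem = run P prog' (run P prog mem) :=
  List.foldl_append

lemma run_singleton (i : Instr n d m) (mem : Cell n d m → ℝ) : run P [i] mem = i.exec P mem :=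
  rfl

/-- Code that pushes the value of an expression to position `k` of the stack. An instruction
`select` with equal arguments copies a cell. -/
def Arith.compile : Arith V → ℕ → List (Instr n d m)
  | .var v, k => [.select (scratch k) (L.cell v) (L.cell v) (L.cell v) (L.cell v)]
  | .const q, k => [.const (scratch k) q]
  | .op o a b, k =>
    a.compile k ++ b.compile (k + 1) ++ [.op o (scratch k) (scratch k) (scratch (k + 1))]
  | .ite a b u v, k =>
    a.compile k ++ b.compile (k + 1) ++ u.compile (k + 2) ++ v.compile (k + 3) ++
      [.select (scratch k) (scratch k) (scratch (k + 1)) (scratch (k + 2)) (scratch (k + 3))]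

lemma run_compile_of_ne (e : Arith V) {k : ℕ} (mem : Cell n d m → ℝ) {c : Cell n d m}
    (hc : ∀ j, k ≤ j → c ≠ scratch j) : run P (e.compile L k) mem c = mem c := by
  induction e generalizing k mem with
  | var v => exact update_of_ne (hc k le_rfl) _ _
  | const q => exact update_of_ne (hc k le_rfl) _ _
  | op o a b iha ihb =>
    rw [Arith.compile, run_append, run_append, run_singleton, Instr.exec,
      update_of_ne (hc k le_rfl), ihb _ fun j hj => hc j (by omega), iha _ hc]
  | ite a b u v iha ihb ihu ihv =>
    rw [Arith.compile, run_append, run_append, run_append, run_append, run_singleton, Instr.exec,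
      update_of_ne (hc k le_rfl), ihv _ fun j hj => hc j (by omega),
      ihu _ fun j hj => hc j (by omega), ihb _ fun j hj => hc j (by omega), iha _ hc]

lemma load_run_compile (e : Arith V) (k : ℕ) (mem : Cell n d m → ℝ) :
    L.load (run P (e.compile L k) mem) = L.load mem :=
  funext fun v => run_compile_of_ne L P e mem fun j _ => L.ne_scratch v j

lemma run_compile_scratch_of_lt (e : Arith V) {j k : ℕ} (hjk : j < k) (mem : Cell n d m → ℝ) :
    run P (e.compile L k) mem (scratch j) = mem (scratch j) :=
  run_compile_of_ne L P e mem fun _ hk => scratch_ne_scratch (hjk.trans_le hk).ne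

lemma run_compile_scratch (e : Arith V) (k : ℕ) (mem : Cell n d m → ℝ) :
    run P (e.compile L k) mem (scratch k) = e.value (L.load mem) := by
  induction e generalizing k mem with
  | var v => simp [Arith.compile, run_singleton, Instr.exec, Arith.value, Layout.load]
  | const q => simp [Arith.compile, run_singleton, Instr.exec, Arith.value]
  | op o a b iha ihb =>
    simp [Arith.compile, run_append, run_singleton, Instr.exec, Arith.value, iha, ihb,
      load_run_compile, run_compile_scratch_of_lt]
  | ite a b u v iha ihb ihu ihv =>
    simp [Arith.compile, run_append, run_singleton, Instr.exec, Arith.value, iha, ihb, ihu, ihv,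
      load_run_compile, run_compile_scratch_of_lt]

/-- Code for the assignment `v := e`. -/
def assign (v : V) (e : Arith V) : List (Instr n d m) :=
  e.compile L 0 ++ [.select (L.cell v) (scratch 0) (scratch 0) (scratch 0) (scratch 0)]

lemma load_run_assign [DecidableEq V] (v : V) (e : Arith V) (mem : Cell n d m → ℝ) :
    L.load (run P (assign L v e) mem) = update (L.load mem) v (e.value (L.load mem)) := by
  rw [assign, run_append, run_singleton, Instr.exec, if_pos le_rfl, run_compile_scratch,
    ← load_run_compile L P e 0 mem]
  exact update_comp_eq_of_injective _ L.injective _ _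

/-- Code for the assignments `dst i := e i`, for the indices `i` of a list. -/
def loop (idx : List ι) (dst : ι → V) (e : ι → Arith V) : List (Instr n d m) :=
  idx.flatMap fun i => assign L (dst i) (e i)

lemma loop_cons (i : ι) (idx : List ι) (dst : ι → V) (e : ι → Arith V) :
    loop L (i :: idx) dst e = assign L (dst i) (e i) ++ loop L idx dst e :=
  List.flatMap_cons

lemma load_run_loop [DecidableEq V] (idx : List ι) (dst : ι → V) (e : ι → Arith V)
    (mem : Cell n d m → ℝ) :
    L.load (run P (loop L idx dst e) mem) =
      idx.foldl (fun σ i => update σ (dst i) ((e i).value σ)) (L.load mem) := by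
  induction idx generalizing mem with
  | nil => rfl
  | cons i idx ih => rw [loop_cons, run_append, ih, load_run_assign, List.foldl_cons]

lemma foldl_update_apply [DecidableEq V] {dst : ι → V} (hdst : Injective dst)
    {f : ι → (V → ℝ) → ℝ} (hf : ∀ i j σ a, f i (update σ (dst j) a) = f i σ) (l : List ι)
    (σ : V → ℝ) {i : ι} (hi : i ∈ l) :
    l.foldl (fun σ i => update σ (dst i) (f i σ)) σ (dst i) = f i σ := by
  have hinv : ∀ (l : List ι) (i : ι),
      f i (l.foldl (fun σ i => update σ (dst i) (f i σ)) σ) = f i σ := by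
    intro l i
    induction l using List.reverseRecOn with
    | nil => rfl
    | append_singleton l j ih => rw [List.foldl_append, List.foldl_cons, List.foldl_nil, hf, ih]
  induction l using List.reverseRecOn with
  | nil => simp at hi
  | append_singleton l j ih =>
    rw [List.foldl_append, List.foldl_cons, List.foldl_nil]
    rcases eq_or_ne i j with rfl | hij
    · rw [update_self, hinv]
    · rw [update_of_ne (hdst.ne hij), ih (by simpa [hij] using hi)]

lemma foldl_update_of_notMem [DecidableEq V] {dst : ι → V} (f : ι → (V → ℝ) → ℝ) (l : List ι)
    (σ : V → ℝ) {v : V} (hv : v ∉ range dst) :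
    l.foldl (fun σ i => update σ (dst i) (f i σ)) σ v = σ v := by
  induction l generalizing σ with
  | nil => rfl
  | cons i l ih =>
    rw [List.foldl_cons, ih, update_of_ne fun h => hv ⟨i, h.symm⟩]

lemma foldl_update_add_mul [DecidableEq V] {dst s₁ s₂ : ι → V} (h₁ : ∀ a, s₁ a ∉ range dst)
    (h₂ : ∀ a, s₂ a ∉ range dst) (l : List ι) (σ : V → ℝ) (v : V) :
    l.foldl (fun σ a => update σ (dst a) (σ (dst a) + σ (s₁ a) * σ (s₂ a))) σ v =
      σ v + (l.map fun a => if dst a = v then σ (s₁ a) * σ (s₂ a) else 0).sum := by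
  induction l generalizing σ with
  | nil => simp
  | cons i l ih =>
    have hne : ∀ {s : ι → V}, (∀ a, s a ∉ range dst) → ∀ a, s a ≠ dst i :=
      fun hs a h => hs a ⟨i, h.symm⟩
    rw [List.foldl_cons, ih]
    simp only [update_of_ne (hne h₁ _), update_of_ne (hne h₂ _), List.map_cons, List.sum_cons]
    rcases eq_or_ne (dst i) v with rfl | hv
    · rw [update_self, if_pos rfl, add_assoc]
    · rw [update_of_ne hv.symm, if_neg hv, zero_add]

/-- Code that fills the array `dst` with the values of the expressions `e`. -/
def fill {k : ℕ} (dst : Fin k → V) (e : Fin k → Arith V) : List (Instr n d m) :=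
  loop L (List.finRange k) dst e

lemma load_run_fill [DecidableEq V] {k : ℕ} {dst : Fin k → V} (hdst : Injective dst)
    {e : Fin k → Arith V} (he : ∀ i j σ a, (e i).value (update σ (dst j) a) = (e i).value σ)
    (mem : Cell n d m → ℝ) :
    L.load (run P (fill L dst e) mem) =
      Function.extend dst (fun i => (e i).value (L.load mem)) (L.load mem) := by
  funext v
  rw [fill, load_run_loop]
  by_cases hv : v ∈ range dst
  · obtain ⟨i, rfl⟩ := hv
    rw [hdst.extend_apply, foldl_update_apply hdst (f := fun i σ => (e i).value σ) he _ _
      (List.mem_finRange i)]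
  · rw [extend_apply' _ _ _ hv, foldl_update_of_notMem (fun i σ => (e i).value σ) _ _ hv]

/-- Code that fills the array `dst` with the values of the expressions `e` and then, for every
`a ∈ S`, adds the product of `s₁ a` and `s₂ a` to the entry `row a`. -/
def fillSum {k : ℕ} (S : Finset ι) (row : ι → Fin k) (dst : Fin k → V) (e : Fin k → Arith V)
    (s₁ s₂ : ι → V) : List (Instr n d m) :=
  fill L dst e ++ loop L S.toList (fun a => dst (row a)) fun a =>
    .op .add (.var (dst (row a))) (.op .mul (.var (s₁ a)) (.var (s₂ a)))

lemma load_run_fillSum [DecidableEq V] {k : ℕ} (S : Finset ι) (row : ι → Fin k)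
    {dst : Fin k → V} (hdst : Injective dst) {e : Fin k → Arith V}
    (he : ∀ i j σ a, (e i).value (update σ (dst j) a) = (e i).value σ) {s₁ s₂ : ι → V}
    (h₁ : ∀ a, s₁ a ∉ range dst) (h₂ : ∀ a, s₂ a ∉ range dst) (mem : Cell n d m → ℝ) :
    L.load (run P (fillSum L S row dst e s₁ s₂) mem) =
      Function.extend dst (fun i => (e i).value (L.load mem) +
        ∑ a ∈ S, if row a = i then L.load mem (s₁ a) * L.load mem (s₂ a) else 0)
        (L.load mem) := by
  have hrange : range (fun a => dst (row a)) ⊆ range dst := range_subset_iff.2 fun a => ⟨row a, rfl⟩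
  funext v
  rw [fillSum, run_append, load_run_loop, load_run_fill L P hdst he]
  refine (foldl_update_add_mul (fun a h => h₁ a (hrange h)) (fun a h => h₂ a (hrange h))
    _ _ v).trans ?_
  simp only [extend_apply' _ _ _ (h₁ _), extend_apply' _ _ _ (h₂ _), Finset.sum_map_toList]
  by_cases hv : v ∈ range dst
  · obtain ⟨i, rfl⟩ := hv
    simp only [hdst.extend_apply, hdst.eq_iff]
  · have hne : ∀ i, dst i ≠ v := fun i h => hv ⟨i, h⟩
    simp only [extend_apply' _ _ _ hv, hne, if_false, Finset.sum_const_zero, add_zero]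

lemma load_writeArray {k : ℕ} {dst : ℕ} {f : Fin k → V} (hf : ∀ i, L.cell (f i) = .work dst i)
    (hne : ∀ v ∉ range f, ∀ i, L.cell v ≠ .work dst i) (u : Fin k → ℝ) (mem : Cell n d m → ℝ) :
    L.load (writeArray mem dst u) = Function.extend f u (L.load mem) := by
  have hinj : Injective f := fun i j h => by simpa [hf, Fin.ext_iff] using congrArg L.cell h
  funext v
  by_cases hv : v ∈ range f
  · obtain ⟨i, rfl⟩ := hv
    simp [hinj.extend_apply, Layout.load, hf, writeArray]
  · rw [extend_apply' _ _ _ hv, Layout.load, Layout.load]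
    cases hcell : L.cell v with
    | work r i =>
      have : r ≠ dst := fun h => hne v hv i (by rw [hcell, h])
      simp [writeArray, this]
    | _ => rfl

lemma applyCount_append (prog prog' : List (Instr n d m)) :
    applyCount (prog ++ prog') = applyCount prog + applyCount prog' := List.countP_append

lemma elemCount_append (prog prog' : List (Instr n d m)) :
    elemCount (prog ++ prog') = elemCount prog + elemCount prog' := List.countP_append

lemma applyCount_compile (e : Arith V) (k : ℕ) : applyCount (e.compile L k) = 0 := by
  induction e generalizing k with
  | var v => rfl
  | const q => rfl
  | op o a b iha ihb => rw [Arith.compile, applyCount_append, applyCount_append, iha, ihb]; rfl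
  | ite a b u v iha ihb ihu ihv =>
    rw [Arith.compile, applyCount_append, applyCount_append, applyCount_append, applyCount_append,
      iha, ihb, ihu, ihv]
    rfl

lemma length_compile (e : Arith V) (k : ℕ) : (e.compile L k).length = e.size := by
  induction e generalizing k with
  | var v => rfl
  | const q => rfl
  | op o a b iha ihb =>
    simp only [Arith.compile, Arith.size, List.length_append, List.length_singleton, iha, ihb]
  | ite a b u v iha ihb ihu ihv =>
    simp only [Arith.compile, Arith.size, List.length_append, List.length_singleton, iha, ihb,
      ihu, ihv]

lemma elemCount_assign_le (v : V) (e : Arith V) : elemCount (assign L v e) ≤ e.size + 1 :=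
  List.countP_le_length.trans (by simp [assign, length_compile])

lemma applyCount_loop (idx : List ι) (dst : ι → V) (e : ι → Arith V) :
    applyCount (loop L idx dst e) = 0 := by
  induction idx with
  | nil => rfl
  | cons i idx ih =>
    rw [loop_cons, applyCount_append, ih, assign, applyCount_append, applyCount_compile]
    rfl

lemma elemCount_loop_le (idx : List ι) (dst : ι → V) {e : ι → Arith V} {N : ℕ}
    (he : ∀ i, (e i).size < N) : elemCount (loop L idx dst e) ≤ N * idx.length := by
  induction idx with
  | nil => exact Nat.zero_le _
  | cons i idx ih =>
    have := (elemCount_assign_le L (dst i) (e i)).trans (he i)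
    rw [loop_cons, elemCount_append, List.length_cons, mul_add_one]
    omega

lemma applyCount_fill {k : ℕ} (dst : Fin k → V) (e : Fin k → Arith V) :
    applyCount (fill L dst e) = 0 :=
  applyCount_loop L _ _ _

lemma elemCount_fill_le {k N : ℕ} (dst : Fin k → V) {e : Fin k → Arith V}
    (he : ∀ i, (e i).size < N) : elemCount (fill L dst e) ≤ N * k := by
  simpa [fill] using elemCount_loop_le L (List.finRange k) dst he

lemma applyCount_fillSum {k : ℕ} (S : Finset ι) (row : ι → Fin k) (dst : Fin k → V)
    (e : Fin k → Arith V) (s₁ s₂ : ι → V) : applyCount (fillSum L S row dst e s₁ s₂) = 0 := by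
  rw [fillSum, applyCount_append, applyCount_fill, applyCount_loop]

lemma elemCount_fillSum_le {k N : ℕ} (S : Finset ι) (row : ι → Fin k) (dst : Fin k → V)
    {e : Fin k → Arith V} (he : ∀ i, (e i).size < N) (s₁ s₂ : ι → V) :
    elemCount (fillSum L S row dst e s₁ s₂) ≤ N * k + 6 * S.card := by
  rw [fillSum, elemCount_append, ← Finset.length_toList]
  exact add_le_add (elemCount_fill_le L dst he)
    (elemCount_loop_le L _ _ fun _ => by simp [Arith.size])

end Compiler

/-! ### The program for one step of accelerated gradient descent -/

section Program

variable {n d m : ℕ}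

section Expressions

variable {V : Type*}

/-- The expression for the maximum. -/
def Arith.max (a b : Arith V) : Arith V := .ite a b b a

lemma Arith.value_max (σ : V → ℝ) (a b : Arith V) :
    (a.max b).value σ = Max.max (a.value σ) (b.value σ) :=
  (max_def _ _).symm

/-- The expression for the minimum. -/
def Arith.min (a b : Arith V) : Arith V := .ite a b a b

lemma Arith.value_min (σ : V → ℝ) (a b : Arith V) :
    (a.min b).value σ = Min.min (a.value σ) (b.value σ) :=
  (min_def _ _).symm

/-- The expression for `smooth'`. -/
def Arith.smoothSlope (p t s : Arith V) : Arith V :=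
  .ite s.abs t (.op .mul (.op .mul p (.op .pow t (.op .sub p (.const 2)))) s)
    (.op .mul (.op .mul p (.op .pow s.abs (.op .sub p (.const 2)))) s)

lemma Arith.value_smoothSlope (σ : V → ℝ) (p t s : Arith V) :
    (smoothSlope p t s).value σ = smooth' (p.value σ) (t.value σ) (s.value σ) := by
  simp only [smoothSlope, value, value_abs, BinOp.eval, smooth', Rat.cast_ofNat]

/-- The expression for `smooth''`. -/
def Arith.smoothCurvature (p t s : Arith V) : Arith V :=
  .ite s.abs t (.op .mul p (.op .pow t (.op .sub p (.const 2))))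
    (.op .mul (.op .mul p (.op .sub p (.const 1))) (.op .pow s.abs (.op .sub p (.const 2))))

lemma Arith.value_smoothCurvature (σ : V → ℝ) (p t s : Arith V) :
    (smoothCurvature p t s).value σ = smooth'' (p.value σ) (t.value σ) (s.value σ) := by
  simp only [smoothCurvature, value, value_abs, BinOp.eval, smooth'', Rat.cast_ofNat,
    Rat.cast_one]

/-- The expression for `extend'`. -/
def Arith.extendSlope (p t l u s : Arith V) : Arith V :=
  .op .add (smoothSlope p t (l.max (u.min s)))
    (.op .mul (smoothCurvature p t (l.max (u.min s))) (.op .sub s (l.max (u.min s))))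

lemma Arith.value_extendSlope (σ : V → ℝ) (p t l u s : Arith V) :
    (extendSlope p t l u s).value σ =
      extend' (p.value σ) (t.value σ) (l.value σ) (u.value σ) (s.value σ) := by
  simp only [extendSlope, value, BinOp.eval, value_smoothSlope, value_smoothCurvature, value_max,
    value_min, extend', clamp]

/-- The expression for the extrapolation `y' + (√κ - 1) / (√κ + 1) * (y' - y)`. -/
def Arith.extrapolate (κ y y' : Arith V) : Arith V :=
  .op .add y' (.op .mul
    (.op .div (.op .sub (.op .pow κ (.const (1 / 2))) (.const 1))
      (.op .add (.op .pow κ (.const (1 / 2))) (.const 1)))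
    (.op .sub y' y))

lemma Arith.value_extrapolate (σ : V → ℝ) (κ y y' : Arith V) :
    (extrapolate κ y y').value σ = y'.value σ +
      (√(κ.value σ) - 1) / (√(κ.value σ) + 1) * (y'.value σ - y.value σ) := by
  simp [extrapolate, value, BinOp.eval, Real.sqrt_eq_rpow]

end Expressions

/-- The variables of the program: the memory cells with the data of the phase and the state,
followed by the intermediate results `z`, `P z`, `A P z - b`, the slopes
`f̃ᵢ'`, the vector `c + Aᵀ f̃'`, the gradient, and the next iterate `y`. -/
inductive StepVar (n d m : ℕ) : Type
  | matA (i : Fin n) (j : Fin d)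
  | vecB (i : Fin n)
  | vecC (j : Fin d)
  | lo (i : Fin n)
  | hi (i : Fin n)
  | expo
  | smoothing
  | cond
  | y (k : Fin m)
  | z (k : Fin m)
  | input (k : Fin m)
  | point (j : Fin d)
  | resid (i : Fin n)
  | slope (i : Fin n)
  | cost (j : Fin d)
  | grad (k : Fin m)
  | next (k : Fin m)
  deriving DecidableEq

/-- The memory cell of a variable. -/
def StepVar.cell : StepVar n d m → Cell n d m
  | .matA i j => .matA i j
  | .vecB i => .vecB i
  | .vecC j => .vecC j
  | .lo i => .lo i
  | .hi i => .hi i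
  | .expo => .expo
  | .smoothing => .smoothing
  | .cond => .cond
  | .y k => .y k
  | .z k => .z k
  | .input k => .work 1 k
  | .point j => .work 2 j
  | .resid i => .work 3 i
  | .slope i => .work 4 i
  | .cost j => .work 5 j
  | .grad k => .work 6 k
  | .next k => .work 7 k

/-- The placement of the variables in the memory. -/
def stepLayout : Layout (StepVar n d m) n d m where
  cell := StepVar.cell
  injective := by
    intro v w h
    cases v <;> cases w <;> simp_all [StepVar.cell, Fin.ext_iff]
  ne_scratch := by
    intro v k
    cases v <;> simp [StepVar.cell, scratch]

/-- The variables with the data of the phase and the state. -/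
def StepVar.IsData (v : StepVar n d m) : Prop := ∀ r i, v.cell ≠ .work r i

lemma extend_of_isData {k : ℕ} {f : Fin k → StepVar n d m} (hf : ∀ i, ¬ (f i).IsData)
    (g : Fin k → ℝ) (σ : StepVar n d m → ℝ) {v : StepVar n d m} (hv : v.IsData) :
    Function.extend f g σ v = σ v :=
  Function.extend_apply' _ _ _ fun ⟨i, hi⟩ => hf i (hi ▸ hv)

section Holds

variable {A : Matrix (Fin n) (Fin d) ℝ} {b : Fin n → ℝ} {c : Fin d → ℝ} {p t : ℝ}
  {x : Fin d → ℝ} {yz : EuclideanSpace ℝ (Fin m) × EuclideanSpace ℝ (Fin m)}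
  {mem mem' : Cell n d m → ℝ}

lemma Holds.of_load_eq_extend (h : Holds A b c p t x yz mem) {k : ℕ} {f : Fin k → StepVar n d m}
    (hf : ∀ i, ¬ (f i).IsData) {g : Fin k → ℝ}
    (hload : stepLayout.load mem' = Function.extend f g (stepLayout.load mem)) :
    Holds A b c p t x yz mem' := by
  have hmem (v : StepVar n d m) (hv : v.IsData) : stepLayout.load mem' v = stepLayout.load mem v :=
    hload ▸ extend_of_isData hf g _ hv
  simp only [StepVar.IsData] at hmem
  exact
  { matA i j := (hmem (.matA i j) nofun).trans (h.matA i j)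
    vecB i := (hmem (.vecB i) nofun).trans (h.vecB i)
    vecC j := (hmem (.vecC j) nofun).trans (h.vecC j)
    lo i := (hmem (.lo i) nofun).trans (h.lo i)
    hi i := (hmem (.hi i) nofun).trans (h.hi i)
    expo := (hmem .expo nofun).trans h.expo
    smoothing := (hmem .smoothing nofun).trans h.smoothing
    cond := (hmem .cond nofun).trans h.cond
    y k := (hmem (.y k) nofun).trans (h.y k)
    z k := (hmem (.z k) nofun).trans (h.z k) }

lemma Holds.and_load_comp (h : Holds A b c p t x yz mem) {k : ℕ} {f : Fin k → StepVar n d m}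
    (hinj : Function.Injective f) (hf : ∀ i, ¬ (f i).IsData) {g : Fin k → ℝ}
    (hload : stepLayout.load mem' = Function.extend f g (stepLayout.load mem)) :
    Holds A b c p t x yz mem' ∧ stepLayout.load mem' ∘ f = g :=
  ⟨h.of_load_eq_extend hf hload, hload ▸ Function.extend_comp hinj g _⟩

lemma Holds.run_fill (P : Matrix (Fin d) (Fin m) ℝ) (h : Holds A b c p t x yz mem) {k : ℕ}
    {f : Fin k → StepVar n d m} (hinj : Function.Injective f) (hf : ∀ i, ¬ (f i).IsData)
    {e : Fin k → Arith (StepVar n d m)}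
    (he : ∀ i j σ a, (e i).value (Function.update σ (f j) a) = (e i).value σ) :
    Holds A b c p t x yz (run P (fill stepLayout f e) mem) ∧
      stepLayout.load (run P (fill stepLayout f e) mem) ∘ f =
        fun i => (e i).value (stepLayout.load mem) :=
  h.and_load_comp hinj hf (load_run_fill _ _ hinj he _)

lemma Holds.run_fillSum {S : Finset (Fin n × Fin d)} (P : Matrix (Fin d) (Fin m) ℝ)
    (h : Holds A b c p t x yz mem) {k : ℕ} (row : Fin n × Fin d → Fin k)
    {f : Fin k → StepVar n d m} (hinj : Function.Injective f) (hf : ∀ i, ¬ (f i).IsData)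
    {e : Fin k → Arith (StepVar n d m)}
    (he : ∀ i j σ a, (e i).value (Function.update σ (f j) a) = (e i).value σ)
    {s : Fin n × Fin d → StepVar n d m} (hs : ∀ a, s a ∉ range f) :
    Holds A b c p t x yz (run P (fillSum stepLayout S row f e (fun a => .matA a.1 a.2) s) mem) ∧
      stepLayout.load (run P (fillSum stepLayout S row f e (fun a => .matA a.1 a.2) s) mem) ∘ f =
        fun i => (e i).value (stepLayout.load mem) +
          ∑ a ∈ S, if row a = i then A a.1 a.2 * stepLayout.load mem (s a) else 0 := by
  have hload := load_run_fillSum stepLayout P S row hinj he (s₁ := fun a => .matA a.1 a.2)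
    (fun a ⟨i, hi⟩ => hf i (hi ▸ nofun)) hs mem
  have hA (a : Fin n × Fin d) : stepLayout.load mem (.matA a.1 a.2) = A a.1 a.2 := h.matA _ _
  simp only [hA] at hload
  exact h.and_load_comp hinj hf hload

/-- The code that computes `P z`. -/
def pointProgram : List (Instr n d m) :=
  fill stepLayout .input (fun k => .var (.z k)) ++ [.applyP 2 1]

lemma elemCount_pointProgram_le : elemCount (pointProgram : List (Instr n d m)) ≤ 2 * m := by
  rw [pointProgram, elemCount_append]
  exact elemCount_fill_le _ _ fun _ => by simp [Arith.size]

lemma Holds.run_pointProgram (P : Matrix (Fin d) (Fin m) ℝ) (h : Holds A b c p t x yz mem) :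
    Holds A b c p t x yz (run P pointProgram mem) ∧
      stepLayout.load (run P pointProgram mem) ∘ .point = P *ᵥ yz.2.ofLp := by
  obtain ⟨h₁, hinput⟩ := h.run_fill P (f := .input) (fun _ _ => StepVar.input.inj)
    (fun i hi => hi 1 i rfl) (e := fun k => .var (.z k)) (by simp [Arith.value])
  have hz : yz.2.ofLp = _ := (funext fun k => (h.z k).symm).trans hinput.symm
  rw [pointProgram, run_append, run_singleton, hz]
  refine h₁.and_load_comp (fun _ _ => StepVar.point.inj) (fun j hj => hj 2 j rfl)
    (load_writeArray _ (fun _ => rfl) ?_ _ _)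
  intro v hv
  cases v <;> simp_all [stepLayout, StepVar.cell]

lemma sum_finset_eq_sum_sum {α β : Type*} [Fintype α] [Fintype β] {S : Finset (α × β)}
    {f : α × β → ℝ} (hS : ∀ a, f a ≠ 0 → a ∈ S) : ∑ a ∈ S, f a = ∑ i, ∑ j, f (i, j) := by
  rw [← Fintype.sum_prod_type]
  exact Finset.sum_subset (Finset.subset_univ S) fun a _ ha => not_not.1 fun h => ha (hS a h)

/-- The code that computes the residual `A u - b` from `u`. -/
def residualProgram (S : Finset (Fin n × Fin d)) : List (Instr n d m) :=
  fillSum stepLayout S Prod.fst .resid (fun i => .op .sub (.const 0) (.var (.vecB i)))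
    (fun a => .matA a.1 a.2) (fun a => .point a.2)

lemma elemCount_residualProgram_le (S : Finset (Fin n × Fin d)) :
    elemCount (residualProgram S : List (Instr n d m)) ≤ 4 * n + 6 * S.card :=
  elemCount_fillSum_le _ _ _ _ (fun _ => by simp [Arith.size]) _ _

lemma Holds.run_residualProgram {S : Finset (Fin n × Fin d)} (hS : ∀ i j, A i j ≠ 0 → (i, j) ∈ S)
    (P : Matrix (Fin d) (Fin m) ℝ) (h : Holds A b c p t x yz mem) {u : Fin d → ℝ}
    (hu : stepLayout.load mem ∘ .point = u) :
    Holds A b c p t x yz (run P (residualProgram S) mem) ∧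
      stepLayout.load (run P (residualProgram S) mem) ∘ .resid = residual A b u := by
  obtain ⟨h₁, hresid⟩ := h.run_fillSum (S := S) P Prod.fst (fun _ _ => StepVar.resid.inj)
    (fun i hi => hi 3 i rfl) (e := fun i => .op .sub (.const 0) (.var (.vecB i)))
    (by simp [Arith.value]) (s := fun a => .point a.2) (by simp)
  refine ⟨h₁, hresid.trans (funext fun i => ?_)⟩
  have hb : stepLayout.load mem (.vecB i) = b i := h.vecB i
  have hpoint (j : Fin d) : stepLayout.load mem (.point j) = u j := congrFun hu j
  rw [sum_finset_eq_sum_sum fun a ha => hS a.1 a.2 fun hA => ha (by simp [hA]), Finset.sum_comm]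
  simp [Arith.value, BinOp.eval, hb, hpoint, residual, mulVec, dotProduct]
  ring

/-- The code that computes the slopes `f̃ᵢ'` at the entries of a vector. -/
def slopeProgram : List (Instr n d m) :=
  fill stepLayout .slope fun i =>
    .extendSlope (.var .expo) (.var .smoothing) (.var (.lo i)) (.var (.hi i)) (.var (.resid i))

lemma elemCount_slopeProgram_le : elemCount (slopeProgram : List (Instr n d m)) ≤ 252 * n :=
  elemCount_fill_le _ _ fun _ => by
    simp [Arith.size, Arith.extendSlope, Arith.smoothSlope, Arith.smoothCurvature, Arith.max,
      Arith.min, Arith.abs]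

lemma Holds.run_slopeProgram (P : Matrix (Fin d) (Fin m) ℝ) (h : Holds A b c p t x yz mem)
    {r : Fin n → ℝ} (hr : stepLayout.load mem ∘ .resid = r) :
    Holds A b c p t x yz (run P slopeProgram mem) ∧
      stepLayout.load (run P slopeProgram mem) ∘ .slope = fun i => extend' p ((1 - stepH p) * t)
        (lower p (radius p n t) (residual A b x i)) (upper p (radius p n t) (residual A b x i))
        (r i) := by
  obtain ⟨h₁, hslope⟩ := h.run_fill P (f := .slope) (fun _ _ => StepVar.slope.inj)
    (fun i hi => hi 4 i rfl) (e := fun i => .extendSlope (.var .expo) (.var .smoothing)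
      (.var (.lo i)) (.var (.hi i)) (.var (.resid i)))
    (by simp [Arith.value_extendSlope, Arith.value])
  refine ⟨h₁, hslope.trans (funext fun i => ?_)⟩
  have hexpo : stepLayout.load mem .expo = p := h.expo
  have hsmoothing : stepLayout.load mem .smoothing = (1 - stepH p) * t := h.smoothing
  have hlo : stepLayout.load mem (.lo i) = _ := h.lo i
  have hhi : stepLayout.load mem (.hi i) = _ := h.hi i
  have hresid : stepLayout.load mem (.resid i) = r i := congrFun hr i
  simp only [Arith.value_extendSlope, Arith.value, hexpo, hsmoothing, hlo, hhi, hresid]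

/-- The code that computes `c + Aᵀ w` from `w`. -/
def costProgram (S : Finset (Fin n × Fin d)) : List (Instr n d m) :=
  fillSum stepLayout S Prod.snd .cost (fun j => .var (.vecC j))
    (fun a => .matA a.1 a.2) (fun a => .slope a.1)

lemma elemCount_costProgram_le (S : Finset (Fin n × Fin d)) :
    elemCount (costProgram S : List (Instr n d m)) ≤ 2 * d + 6 * S.card :=
  elemCount_fillSum_le _ _ _ _ (fun _ => by simp [Arith.size]) _ _

lemma Holds.run_costProgram {S : Finset (Fin n × Fin d)} (hS : ∀ i j, A i j ≠ 0 → (i, j) ∈ S)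
    (P : Matrix (Fin d) (Fin m) ℝ) (h : Holds A b c p t x yz mem) {w : Fin n → ℝ}
    (hw : stepLayout.load mem ∘ .slope = w) :
    Holds A b c p t x yz (run P (costProgram S) mem) ∧
      stepLayout.load (run P (costProgram S) mem) ∘ .cost = c + Aᵀ *ᵥ w := by
  obtain ⟨h₁, hcost⟩ := h.run_fillSum (S := S) P Prod.snd (fun _ _ => StepVar.cost.inj)
    (fun j hj => hj 5 j rfl) (e := fun j => .var (.vecC j)) (by simp [Arith.value])
    (s := fun a => .slope a.1) (by simp)
  refine ⟨h₁, hcost.trans (funext fun j => ?_)⟩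
  have hc : stepLayout.load mem (.vecC j) = c j := h.vecC j
  have hslope (i : Fin n) : stepLayout.load mem (.slope i) = w i := congrFun hw i
  rw [sum_finset_eq_sum_sum fun a ha => hS a.1 a.2 fun hA => ha (by simp [hA])]
  simp [Arith.value, hc, hslope, mulVec, dotProduct]

lemma Holds.run_applyPT (P : Matrix (Fin d) (Fin m) ℝ) (h : Holds A b c p t x yz mem)
    {w : Fin d → ℝ} (hw : stepLayout.load mem ∘ .cost = w) :
    Holds A b c p t x yz (run P [.applyPT 6 5] mem) ∧
      stepLayout.load (run P [.applyPT 6 5] mem) ∘ .grad = Pᵀ *ᵥ w := by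
  rw [← hw]
  refine h.and_load_comp (fun _ _ => StepVar.grad.inj) (fun j hj => hj 6 j rfl)
    (load_writeArray _ (fun _ => rfl) ?_ _ _)
  intro v hv
  cases v <;> simp_all [stepLayout, StepVar.cell]

/-- The code that updates the state from the gradient. -/
def updateProgram : List (Instr n d m) :=
  fill stepLayout .next (fun k => .op .sub (.var (.z k))
    (.op .mul (.op .div (.const 1) (.var .cond)) (.var (.grad k)))) ++
  fill stepLayout .z (fun k => .extrapolate (.var .cond) (.var (.y k)) (.var (.next k))) ++
  fill stepLayout .y (fun k => .var (.next k))

lemma elemCount_updateProgram_le :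
    elemCount (updateProgram : List (Instr n d m)) ≤ 8 * m + 18 * m + 2 * m := by
  rw [updateProgram, elemCount_append, elemCount_append]
  exact add_le_add (add_le_add
    (elemCount_fill_le _ _ fun _ => by simp [Arith.size])
    (elemCount_fill_le _ _ fun _ => by simp [Arith.size, Arith.extrapolate]))
    (elemCount_fill_le _ _ fun _ => by simp [Arith.size])

lemma Holds.of_load_eq_extend_state (h : Holds A b c p t x yz mem)
    {yz' : EuclideanSpace ℝ (Fin m) × EuclideanSpace ℝ (Fin m)}
    (hload : stepLayout.load mem' =
      Function.extend .y yz'.1.ofLp (Function.extend .z yz'.2.ofLp (stepLayout.load mem))) :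
    Holds A b c p t x yz' mem' := by
  have hmem (v : StepVar n d m) (hy : ¬ ∃ k, .y k = v) (hz : ¬ ∃ k, .z k = v) :
      stepLayout.load mem' v = stepLayout.load mem v := by
    rw [hload, Function.extend_apply' _ _ _ hy, Function.extend_apply' _ _ _ hz]
  have hy (k : Fin m) : stepLayout.load mem' (.y k) = yz'.1 k := by
    rw [hload, Function.Injective.extend_apply fun _ _ => StepVar.y.inj]
  have hz (k : Fin m) : stepLayout.load mem' (.z k) = yz'.2 k := by
    rw [hload, Function.extend_apply' _ _ _ (by simp),
      Function.Injective.extend_apply fun _ _ => StepVar.z.inj]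
  exact
  { matA i j := (hmem (.matA i j) nofun nofun).trans (h.matA i j)
    vecB i := (hmem (.vecB i) nofun nofun).trans (h.vecB i)
    vecC j := (hmem (.vecC j) nofun nofun).trans (h.vecC j)
    lo i := (hmem (.lo i) nofun nofun).trans (h.lo i)
    hi i := (hmem (.hi i) nofun nofun).trans (h.hi i)
    expo := (hmem .expo nofun nofun).trans h.expo
    smoothing := (hmem .smoothing nofun nofun).trans h.smoothing
    cond := (hmem .cond nofun nofun).trans h.cond
    y := hy
    z := hz }

lemma Holds.run_updateProgram (P : Matrix (Fin d) (Fin m) ℝ) (h : Holds A b c p t x yz mem)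
    {g : EuclideanSpace ℝ (Fin m) → ℝ}
    (hg : stepLayout.load mem ∘ .grad = (gradient g yz.2).ofLp) :
    Holds A b c p t x (agdStep g (kappa p n) yz) (run P updateProgram mem) := by
  obtain ⟨h₁, hnext⟩ := h.run_fill P (f := .next) (fun _ _ => StepVar.next.inj)
    (fun i hi => hi 7 i rfl) (e := fun k => .op .sub (.var (.z k))
      (.op .mul (.op .div (.const 1) (.var .cond)) (.var (.grad k)))) (by simp [Arith.value])
  rw [updateProgram, run_append, run_append]
  set mem₁ := run P _ mem
  have hz := load_run_fill stepLayout P (dst := .z) (fun _ _ => StepVar.z.inj)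
    (e := fun k => .extrapolate (.var .cond) (.var (.y k)) (.var (.next k)))
    (by simp [Arith.value_extrapolate, Arith.value]) mem₁
  have hy := load_run_fill stepLayout P (dst := .y) (fun _ _ => StepVar.y.inj)
    (e := fun k => .var (.next k)) (by simp [Arith.value])
    (run P (fill stepLayout .z
      fun k => .extrapolate (.var .cond) (.var (.y k)) (.var (.next k))) mem₁)
  have hnext (k : Fin m) : stepLayout.load mem₁ (.next k) = (agdStep g (kappa p n) yz).1 k := by
    have hzk : stepLayout.load mem (.z k) = yz.2 k := h.z k
    have hcond : stepLayout.load mem .cond = kappa p n := h.cond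
    have hgrad : stepLayout.load mem (.grad k) = gradient g yz.2 k := congrFun hg k
    refine (congrFun hnext k).trans ?_
    simp [Arith.value, BinOp.eval, hzk, hcond, hgrad, agdStep]
  have hyk (k : Fin m) : stepLayout.load mem₁ (.y k) = yz.1 k := h₁.y k
  have hcond : stepLayout.load mem₁ .cond = kappa p n := h₁.cond
  have hload_next (k : Fin m) (f : Fin m → ℝ) :
      Function.extend .z f (stepLayout.load mem₁) (.next k) = _ :=
    (Function.extend_apply' _ _ _ (by simp)).trans (hnext k)
  refine h₁.of_load_eq_extend_state (hy.trans ?_)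
  rw [hz]
  simp only [Arith.value, Arith.value_extrapolate, hload_next, hnext, hyk, hcond]
  rfl

/-- The program for one step. -/
def stepProgram (S : Finset (Fin n × Fin d)) : List (Instr n d m) :=
  pointProgram ++ residualProgram S ++ slopeProgram ++ costProgram S ++ [.applyPT 6 5] ++
    updateProgram

end Holds

theorem implementsStep_stepProgram (S : Finset (Fin n × Fin d)) :
    ImplementsStep S (stepProgram S : List (Instr n d m)) := by
  intro A hS b c p t hp ht x P yz mem h
  obtain ⟨h₁, hpoint⟩ := h.run_pointProgram P
  obtain ⟨h₂, hresid⟩ := h₁.run_residualProgram hS P hpoint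
  obtain ⟨h₃, hslope⟩ := h₂.run_slopeProgram P hresid
  obtain ⟨h₄, hcost⟩ := h₃.run_costProgram hS P hslope
  obtain ⟨h₅, hgrad⟩ := h₄.run_applyPT P hcost
  simp only [stepProgram, run_append]
  exact h₅.run_updateProgram P (hgrad.trans
    (congrArg WithLp.ofLp (gradient_precondObjective hp ht yz.2)).symm)

lemma applyCount_stepProgram (S : Finset (Fin n × Fin d)) :
    applyCount (stepProgram S : List (Instr n d m)) = 2 := by
  simp only [stepProgram, pointProgram, residualProgram, slopeProgram, costProgram, updateProgram,
    applyCount_append, applyCount_fill, applyCount_fillSum]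
  rfl

lemma elemCount_stepProgram_le (S : Finset (Fin n × Fin d)) :
    elemCount (stepProgram S : List (Instr n d m)) ≤ 300 * (S.card + n + d + m) := by
  have hpoint := elemCount_pointProgram_le (n := n) (d := d) (m := m)
  have hresid := elemCount_residualProgram_le (m := m) S
  have hslope := elemCount_slopeProgram_le (n := n) (d := d) (m := m)
  have hcost := elemCount_costProgram_le (m := m) S
  have hgrad : elemCount ([.applyPT 6 5] : List (Instr n d m)) = 0 := rfl
  have hupdate := elemCount_updateProgram_le (n := n) (d := d) (m := m)
  simp only [stepProgram, elemCount_append]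
  omega

end Program

/-! ### The homotopy method -/

section Homotopy

variable {n d m : ℕ} {A : Matrix (Fin n) (Fin d) ℝ} {b : Fin n → ℝ} {c : Fin d → ℝ}
  {p t t₀ ε : ℝ} {x x' y : Fin d → ℝ}

lemma Tracks.mem_nbhd_radius (hp : 1 < p) (ht : 0 < t) (h : Tracks A b c p t x y) :
    residual A b y ∈ Nbhd p (residual A b x) (radius p n t) := by
  have hpos := Real.rpow_pos_of_pos ht (p / 2)
  exact nbhd_subset_nbhd (by linarith [rpow_le_radius hp n ht]) h.mem_nbhd

lemma IsPathPoint.tracks_self (hp : 1 < p) (ht : 0 < t) (hx : IsPathPoint A b c p t x) :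
    Tracks A b c p t x x where
  kerOrth := hx.1
  mem_nbhd i := by
    rw [sub_self, abs_zero]
    positivity
  smoothObjective_le := by
    have := one_pos.trans_le (one_le_kappa hp n)
    exact le_add_of_nonneg_right (by positivity)

lemma isEpsOptimal_of_isEmpty {A : Matrix (Fin 0) (Fin d) ℝ} {b : Fin 0 → ℝ} (hc : KerOrth A c)
    (hε : 0 < ε) (x : Fin d → ℝ) : IsEpsOptimal A b c p ε x := by
  have hc0 : c = 0 := dotProduct_self_eq_zero.1 (hc c (Subsingleton.elim _ _))
  intro x'
  simp [objective, hc0, hε.le]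

lemma Tracks.isEpsOptimal (hp : 1 < p) (ht : 0 < t) (hc : KerOrth A c)
    (hx : IsPathPoint A b c p t x) (h : Tracks A b c p t x y) (hε : 0 < ε)
    (hle : n * p * t ^ p ≤ ε) : IsEpsOptimal A b c p ε y := by
  rcases Nat.eq_zero_or_pos n with rfl | hn
  · exact isEpsOptimal_of_isEmpty hc hε y
  have hn' : (1 : ℝ) ≤ n := by exact_mod_cast hn
  have hgap : t ^ p / (1024 * kappa p n) ≤ n * p / 2 * t ^ p := by
    rw [div_eq_inv_mul]
    gcongr
    calc (1024 * kappa p n)⁻¹ ≤ 1 / 2 := by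
          rw [one_div]
          gcongr
          linarith [one_le_kappa hp n]
      _ ≤ n * p / 2 := by
          gcongr
          exact one_le_mul_of_one_le_of_one_le hn' hp.le
  exact hx.isEpsOptimal_of_smoothObjective_le hp ht hc
    (h.smoothObjective_le.trans (by gcongr)) hle

lemma Tracks.phase (hp : 1 < p) (ht : 0 < t) (hc : KerOrth A c) (hx : IsPathPoint A b c p t x)
    (h : Tracks A b c p t x y) {P : Matrix (Fin d) (Fin m) ℝ}
    (hP : P * Pᵀ = pinv (gram A b p t y)) (hx' : IsPathPoint A b c p ((1 - stepH p) * t) x')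
    {T : ℕ}
    (hT : 80 * (p ^ 2 / (p - 1)) ^ 3 * (n : ℝ) ^ |1 / 2 - 1 / p| * Real.log (n + 1) ≤ T) :
    Tracks A b c p ((1 - stepH p) * t) x' (phase A b c p t T P y) := by
  have hdrift : residual A b x' ∈ Nbhd p (residual A b x)
      (p ^ 3 / (p - 1) * √(n : ℝ) * stepH p * t ^ (p / 2)) :=
    mem_nbhd_comm.1 (hx.abs_spow_residual_sub_le hp ht hc hx')
  have hclose : residual A b x' ∈ Nbhd p (residual A b y) (radius p n t - t ^ (p / 2) / 2) :=
    nbhd_subset_nbhd (by rw [radius]; linarith) (mem_nbhd_add hdrift (mem_nbhd_comm.1 h.mem_nbhd))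
  exact tracks_phase hp ht hc h.kerOrth hP hx' hclose (exp_neg_mul_le_of_iterations_le hp ht hT)

lemma tSeq_pos (hp : 1 < p) (ht₀ : 0 < t₀) (k : ℕ) : 0 < tSeq p t₀ k :=
  mul_pos (pow_pos (one_sub_stepH_pos hp) k) ht₀

lemma tSeq_succ (p t₀ : ℝ) (k : ℕ) : tSeq p t₀ (k + 1) = (1 - stepH p) * tSeq p t₀ k := by
  rw [tSeq, tSeq, pow_succ', mul_assoc]

theorem tracks_homotopy (hp : 1 < p) (ht₀ : 0 < t₀) (hc : KerOrth A c)
    {pre : ℝ → (Fin d → ℝ) → Matrix (Fin d) (Fin m) ℝ}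
    (hpre : ∀ t y, 0 < t → pre t y * (pre t y)ᵀ = pinv (gram A b p t y)) {T : ℕ}
    (hT : 80 * (p ^ 2 / (p - 1)) ^ 3 * (n : ℝ) ^ |1 / 2 - 1 / p| * Real.log (n + 1) ≤ T)
    {x₀ : Fin d → ℝ} (hx₀ : IsPathPoint A b c p t₀ x₀) (k : ℕ)
    (hx : IsPathPoint A b c p (tSeq p t₀ k) x) :
    Tracks A b c p (tSeq p t₀ k) x (homotopy A b c p t₀ pre T x₀ k) := by
  induction k generalizing x with
  | zero =>
    have hzero : tSeq p t₀ 0 = t₀ := by simp [tSeq]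
    rw [hzero] at hx ⊢
    obtain rfl := hx.unique hp ht₀ hc hx₀
    exact hx.tracks_self hp ht₀
  | succ k ih =>
    have ht := tSeq_pos hp ht₀ k
    obtain ⟨z, hz⟩ := exists_isPathPoint hp ht A b hc
    rw [tSeq_succ] at hx ⊢
    exact (ih hz).phase hp ht hc hz (hpre _ _ ht) hx hT

lemma tSeq_rpow_le (hp : 1 < p) (ht₀ : 0 < t₀) (K : ℕ) :
    tSeq p t₀ K ^ p ≤ Real.exp (-(K / 2)) * t₀ ^ p := by
  have hnonneg := (one_sub_stepH_pos hp).le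
  have hshrink : (1 - stepH p) ^ K ≤ Real.exp (-(K * stepH p)) := by
    rw [← mul_neg, Real.exp_nat_mul]
    gcongr
    linarith [Real.add_one_le_exp (-stepH p)]
  have hexp : Real.exp (-(K * stepH p)) ^ p = Real.exp (-(K / 2)) := by
    rw [← Real.exp_mul, stepH]
    field_simp
  rw [tSeq, Real.mul_rpow (by positivity) ht₀.le, ← hexp]
  gcongr

lemma mul_tSeq_rpow_le (hp : 1 < p) (ht₀ : 0 < t₀) (hε : 0 < ε) {C : ℝ} (hC : 2 ≤ C) {K : ℕ}
    (hK : C * Real.log (n * p / ε * t₀ ^ p) ≤ K) : n * p * tSeq p t₀ K ^ p ≤ ε := by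
  rcases Nat.eq_zero_or_pos n with rfl | hn
  · simpa using hε.le
  have : (0 : ℝ) < n := by exact_mod_cast hn
  set R := n * p / ε * t₀ ^ p with hR
  have hlog : Real.log R ≤ K / 2 := by
    rcases le_total 0 (Real.log R) with h | h
    · nlinarith
    · exact h.trans (by positivity)
  have hexp : R ≤ Real.exp (K / 2) := (Real.log_le_iff_le_exp (by positivity)).1 hlog
  calc n * p * tSeq p t₀ K ^ p ≤ n * p * (Real.exp (-(K / 2)) * t₀ ^ p) := by
        gcongr
        exact tSeq_rpow_le hp ht₀ K
    _ = ε * (R / Real.exp (K / 2)) := by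
        rw [hR, Real.exp_neg]
        field_simp
    _ ≤ ε * 1 := by
        gcongr
        exact (div_le_one (Real.exp_pos _)).2 hexp
    _ = ε := mul_one ε

end Homotopy

/-! ### The two choices of the initial parameter -/

section InitialParameter

variable {n d : ℕ} {A : Matrix (Fin n) (Fin d) ℝ} {b : Fin n → ℝ} {c : Fin d → ℝ} {p t : ℝ}

lemma rpow_two_sub_mul_le_half (hp : 1 < p) (ht : 0 < t) {r : ℝ} (hr : 0 ≤ r)
    (h : (2 * r) ^ (1 / (p - 1)) ≤ t) : t ^ (2 - p) * r ≤ t / 2 := by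
  have hle : 2 * r ≤ t ^ (p - 1) := by
    rwa [one_div, Real.rpow_inv_le_iff_of_pos (by positivity) ht.le (sub_pos.2 hp)] at h
  have hmul : t ^ (2 - p) * t ^ (p - 1) = t := by
    rw [← Real.rpow_add ht]
    norm_num
  calc t ^ (2 - p) * r = t ^ (2 - p) * (2 * r) / 2 := by ring
    _ ≤ t ^ (2 - p) * t ^ (p - 1) / 2 := by gcongr
    _ = t / 2 := by rw [hmul]

lemma isPathPoint_initialPoint_of_sqrt_le (hp : 1 < p) (ht : 0 < t) (hc : KerOrth A c)
    (hE : (2 * √(costEnergy A c)) ^ (1 / (p - 1)) ≤ t) (hb : 2 * ‖WithLp.toLp 2 b‖ ≤ t) :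
    IsPathPoint A b c p t (initialPoint A b c p t) := by
  refine isPathPoint_initialPoint hp ht hc hb ?_
  calc 1 / p * t ^ (2 - p) * √(costEnergy A c) ≤ 1 * t ^ (2 - p) * √(costEnergy A c) := by
        gcongr
        exact (div_le_one (by linarith)).2 hp.le
    _ = t ^ (2 - p) * √(costEnergy A c) := by rw [one_mul]
    _ ≤ t / 2 := rpow_two_sub_mul_le_half hp ht (Real.sqrt_nonneg _) hE

lemma isPathPoint_initialPoint_of_le (hp : 1 < p) (ht : 0 < t) (hc : KerOrth A c)
    (hE : (2 * costEnergy A c) ^ (1 / (p - 1)) ≤ t) (hlarge : 1 ≤ p ^ 2 * costEnergy A c)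
    (hb : 2 * ‖WithLp.toLp 2 b‖ ≤ t) : IsPathPoint A b c p t (initialPoint A b c p t) := by
  have hnonneg := costEnergy_nonneg hc
  have hone : 1 ≤ p * √(costEnergy A c) := by
    rwa [← one_le_sq_iff₀ (by positivity), mul_pow, Real.sq_sqrt hnonneg]
  have hsqrt : 1 / p * √(costEnergy A c) ≤ costEnergy A c := by
    rw [one_div, inv_mul_le_iff₀ (by linarith)]
    calc √(costEnergy A c) ≤ p * √(costEnergy A c) * √(costEnergy A c) :=
          le_mul_of_one_le_left (Real.sqrt_nonneg _) hone
      _ = p * costEnergy A c := by rw [mul_assoc, Real.mul_self_sqrt hnonneg]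
  refine isPathPoint_initialPoint hp ht hc hb ?_
  calc 1 / p * t ^ (2 - p) * √(costEnergy A c) = t ^ (2 - p) * (1 / p * √(costEnergy A c)) := by
        ring
    _ ≤ t ^ (2 - p) * costEnergy A c := by gcongr
    _ ≤ t / 2 := rpow_two_sub_mul_le_half hp ht hnonneg hE

end InitialParameter

end LpHomotopy

end

theorem theorem1 :
    ∃ (C : ℝ) (a : ℕ), 0 < C ∧
      -- correctness of the method, and the numbers of phases and iterations
      (∀ (p : ℝ), 1 < p → ∀ (n d : ℕ) (A : Matrix (Fin n) (Fin d) ℝ) (b : Fin n → ℝ)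
        (c : Fin d → ℝ), LpHomotopy.KerOrth A c → ∀ (t₀ : ℝ), 0 < t₀ →
        ∃ x₀ : Fin d → ℝ,
          (∀ x : Fin d → ℝ, LpHomotopy.IsPathPoint A b c p t₀ x ↔ x = x₀) ∧
          (t₀ = max ((2 * √(LpHomotopy.costEnergy A c)) ^ (1 / (p - 1))) (2 * ‖WithLp.toLp 2 b‖) →
            x₀ = LpHomotopy.initialPoint A b c p t₀) ∧
          (t₀ = max ((2 * LpHomotopy.costEnergy A c) ^ (1 / (p - 1))) (2 * ‖WithLp.toLp 2 b‖) →
            1 ≤ p ^ 2 * LpHomotopy.costEnergy A c →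
            x₀ = LpHomotopy.initialPoint A b c p t₀) ∧
          ∀ (T : ℕ), C * (p ^ 2 / (p - 1)) ^ a * (n : ℝ) ^ |1 / 2 - 1 / p| * Real.log (n + 1) ≤ T →
            (∀ (k : ℕ) (x : Fin d → ℝ),
              LpHomotopy.IsPathPoint A b c p (LpHomotopy.tSeq p t₀ k) x →
              LpHomotopy.residual A b
                  (LpHomotopy.homotopy A b c p t₀ (LpHomotopy.precond A b p) T x₀ k) ∈
                LpHomotopy.Nbhd p (LpHomotopy.residual A b x)
                  (LpHomotopy.radius p n (LpHomotopy.tSeq p t₀ k)) ∧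
              LpHomotopy.residual A b
                  (LpHomotopy.homotopy A b c p t₀ (LpHomotopy.precond' A b p) T x₀ k) ∈
                LpHomotopy.Nbhd p (LpHomotopy.residual A b x)
                  (LpHomotopy.radius p n (LpHomotopy.tSeq p t₀ k))) ∧
            ∀ (ε : ℝ), 0 < ε → ∀ (K : ℕ), C * Real.log (n * p / ε * t₀ ^ p) ≤ K →
              (∀ x : Fin d → ℝ, LpHomotopy.IsPathPoint A b c p (LpHomotopy.tSeq p t₀ K) x →
                LpHomotopy.IsEpsOptimal A b c p ε x) ∧
              LpHomotopy.IsEpsOptimal A b c p ε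
                (LpHomotopy.homotopy A b c p t₀ (LpHomotopy.precond A b p) T x₀ K) ∧
              LpHomotopy.IsEpsOptimal A b c p ε
                (LpHomotopy.homotopy A b c p t₀ (LpHomotopy.precond' A b p) T x₀ K)) ∧
      -- cost of one iteration
      (∀ (n d m : ℕ) (S : Finset (Fin n × Fin d)),
        ∃ prog : List (LpHomotopy.Instr n d m),
          LpHomotopy.ImplementsStep S prog ∧
          (LpHomotopy.applyCount prog : ℝ) ≤ C ∧
          (LpHomotopy.elemCount prog : ℝ) ≤ C * (S.card + n + d + m + 1)) := by
  open LpHomotopy in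
  refine ⟨300, 3, by norm_num, fun p hp n d A b c hc t₀ ht => ?_, fun n d m S =>
    ⟨stepProgram S, implementsStep_stepProgram S, ?_, ?_⟩⟩
  · obtain ⟨x₀, hx₀⟩ := exists_isPathPoint hp ht A b hc
    refine ⟨x₀, fun x => ⟨fun hx => hx.unique hp ht hc hx₀, fun hx => hx ▸ hx₀⟩,
      fun h => hx₀.unique hp ht hc (isPathPoint_initialPoint_of_sqrt_le hp ht hc
        (le_of_max_le_left h.ge) (le_of_max_le_right h.ge)),
      fun h hE => hx₀.unique hp ht hc (isPathPoint_initialPoint_of_le hp ht hc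
        (le_of_max_le_left h.ge) hE (le_of_max_le_right h.ge)), fun T hT => ?_⟩
    have hT' : 80 * (p ^ 2 / (p - 1)) ^ 3 * (n : ℝ) ^ |1 / 2 - 1 / p| * Real.log (n + 1) ≤ T := by
      have : 0 < p - 1 := sub_pos.2 hp
      have : 0 ≤ Real.log ((n : ℝ) + 1) := Real.log_nonneg (by simp)
      exact le_trans (by gcongr; norm_num) hT
    have tracks k x hx := tracks_homotopy (x := x) hp ht hc (pre := precond A b p)
      (fun t y ht => precond_mul_transpose hp ht) hT' hx₀ k hx
    have tracks' k x hx := tracks_homotopy (x := x) hp ht hc (pre := precond' A b p)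
      (fun t y ht => precond'_mul_transpose hp ht) hT' hx₀ k hx
    refine ⟨fun k x hx => ⟨(tracks k x hx).mem_nbhd_radius hp (tSeq_pos hp ht k),
      (tracks' k x hx).mem_nbhd_radius hp (tSeq_pos hp ht k)⟩, fun ε hε K hK => ?_⟩
    have htK := tSeq_pos hp ht K
    have hle := mul_tSeq_rpow_le hp ht hε (by norm_num) hK
    obtain ⟨z, hz⟩ := exists_isPathPoint hp htK A b hc
    exact ⟨fun x hx => (hx.tracks_self hp htK).isEpsOptimal hp htK hc hx hε hle,
      (tracks K z hz).isEpsOptimal hp htK hc hz hε hle,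
      (tracks' K z hz).isEpsOptimal hp htK hc hz hε hle⟩
  · rw [applyCount_stepProgram]
    norm_num
  · have hcount : (elemCount (stepProgram S : List (Instr n d m)) : ℝ)
        ≤ 300 * (S.card + n + d + m) := by exact_mod_cast elemCount_stepProgram_le S
    linarith
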